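/- Let $d\in\mathbb N$, $p,q\in[1,\infty]$, and let $\phi\in\mathcal S(\mathbb R^d)$ satisfy $\int\phi=1$ and $\int x^\alpha\phi(x)\,dx=0$ for all multi-indices $\alpha\neq0$. For $\psi\in\mathcal S(\mathbb R^d)$ put $\psi_\varepsilon=\varepsilon^{-d}\psi(\cdot/\varepsilon)$, $0<\varepsilon<1$. In all integrals below with respect to $d\varepsilon/\varepsilon$ or $dy/y$, if $q=\infty$ the $L^q$-norm is replaced by the supremum over $(0,1)$. *Generalized functions.* For open $\omega$ let $\|f\|_{W^{k,p}(\omega)}=\max_{|\alpha|\le k}\|\partial^\alpha f\|_{L^p(\omega)}$. Let $\mathcal E_q(\mathbb R^d)$ be the space of nets $(f_\varepsilon)_{\varepsilon\in(0,1)}$ of smooth complex functions with $\varepsilon\mapsto f_\varepsilon$ continuous from $(0,1)$ to $C^\infty(\mathbb R^d)$ such that for every $k\in\mathbb N_0$ and every relatively compact open $\omega\subset\mathbb R^d$ there is $s\in\mathbb R$ with $\int_0^1\varepsilon^{qs}\|f_\varepsilon\|_{W^{k,p}(\omega)}^q\frac{d\varepsilon}\varepsilon<\infty$. For $k\in\mathbb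 N_0$ and $s\in\mathbb R$ let $$\mathcal E^{k,-s}_{q,L^p}=\Big\{(f_\varepsilon)_\varepsilon\in\mathcal E_q(\mathbb R^d):\int_0^1\varepsilon^{qs}\|f_\varepsilon\|^q_{W^{k,p}(\mathbb R^d)}\frac{d\varepsilon}{\varepsilon}<\infty\Big\},$$ $\mathcal E_{q,L^p}=\bigcap_k\bigcup_s\mathcal E^{k,-s}_{q,L^p}$, $\mathcal E^\infty_{q,L^p}=\bigcup_s\bigcap_k\mathcal E^{k,-s}_{q,L^p}$, $\mathcal N_{q,L^p}=\bigcap_{k,s}\mathcal E^{k,-s}_{q,L^p}$, and $\mathcal G_{q,L^p}=\mathcal E_{q,L^p}/\mathcal N_{q,L^p}$. Let $\mathcal G^{k,-s}_{q,L^p}$ be the set of elements of $\mathcal G_{q,L^p}$ that have a representative in $\mathcal E^{k,-s}_{q,L^p}$, and let $\mathcal G^\infty_{q,L^p}=\mathcal E^\infty_{q,L^p}/\mathcal N_{q,L^p}\subset\mathcal G_{q,L^p}$. *Distributions.* Let $\mathcal D_{L^p}=\bigcap_kW^{k,p}(\mathbb R^d)$ and $\mathcal D'_{L^p}=\bigcup_kW_0^{-k,p}(\mathbb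 R^d)$, where $W_0^{-k,p}(\mathbb R^d)$ is the space of all $T\in\mathcal S'(\mathbb R^d)$ with $|\langle T,\chi\rangle|\le C\|\chi\|_{W^{k,p'}(\mathbb R^d)}$ for some $C$ and all $\chi\in\mathcal S(\mathbb R^d)$, $1/p+1/p'=1$. For $r\in\mathbb R$, an LP-pair of order $r$ is a pair $\eta,\psi\in\mathcal S(\mathbb R^d)$ such that for some $\sigma>0$ and $\theta\in(0,1)$ one has $|\hat\eta(\xi)|>0$ for $|\xi|\le\sigma$ and $|\hat\psi(\xi)|>0$ for $\theta\sigma\le|\xi|\le\sigma$, and $\int t^\alpha\psi(t)\,dt=0$ for $|\alpha|\le\lfloor r\rfloor$. The Besov space $B^r_{p,q}$ is the space of all $T\in\mathcal S'(\mathbb R^d)$ with $$\|T*\eta\|_{L^p}+\Big(\int_0^1y^{-qr}\|T*\psi_y\|_{L^p}^q\frac{dy}{y}\Big)^{1/q}<\infty,$$ where $(\eta,\psi)$ is an LP-pair of order $r$; the statements below hold for every choice of this pair. **Theorem.** For $T\in\mathcal D'_{L^p}$ the net $(T*\phi_\varepsilon)_\varepsilon$ belongs to $\mathcal E_{q,L^p}$,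 so that $\iota(T)=[(T*\phi_\varepsilon)_\varepsilon]\in\mathcal G_{q,L^p}$ is defined on $\mathcal D'_{L^p}$, and $\mathcal D'_{L^p}$ contains $\mathcal D_{L^p}$ and every $B^r_{p,q}$, $r\in\mathbb R$. Moreover: (i) $\mathcal G^{k,-s}_{q,L^p}\cap\iota(\mathcal D'_{L^p})=\iota(B^{k-s}_{p,q})$ for every $k\in\mathbb N_0$ and $s>0$. (ii) $\iota(B^r_{p,q})=\mathcal G^{k,r-k}_{q,L^p}\cap\iota(\mathcal D'_{L^p})$ for every $r\in\mathbb R$ and every integer $k\ge0$ with $k>r$. (iii) $\iota(\mathcal D_{L^p})=\mathcal G^\infty_{q,L^p}\cap\iota(\mathcal D'_{L^p})$. -/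

import Mathlib

open MeasureTheory SchwartzMap
open scoped ENNReal NNReal ContDiff LineDeriv FourierTransform

noncomputable section

/-- The Euclidean space `ℝ^d`. -/
abbrev Rd (d : ℕ) : Type := EuclideanSpace ℝ (Fin d)

/-- The parameter interval `(0,1)`, carrying the Lebesgue measure of `ℝ` restricted to it. -/
abbrev Param : Type := Set.Ioo (0 : ℝ) 1

/-- Nets `(f_ε)_{ε ∈ (0,1)}` of complex functions on `ℝ^d`. -/
abbrev Net (d : ℕ) : Type := Param → Rd d → ℂ

/-- The standard basis vectors of `ℝ^d`. -/
def stdVec {d : ℕ} (i : Fin d) : Rd d := EuclideanSpace.single i (1 : ℝ)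

/-- The Sobolev norm `max_{|α| ≤ k} ‖∂^α f‖_{L^p(μ)}` of a smooth function `f`. The derivatives
`∂^α f` with `|α| = m` are written `∂_{a 0} ⋯ ∂_{a (m-1)} f` with `a : Fin m → Fin d`. The norm
over an open set `ω` is obtained for `μ = volume.restrict ω`. -/
def sobNorm {d : ℕ} (k : ℕ) (p : ℝ≥0∞) (μ : Measure (Rd d)) (f : Rd d → ℂ) : ℝ≥0∞ :=
  ⨆ (m : Fin (k + 1)) (a : Fin (m : ℕ) → Fin d),
    eLpNorm (fun x => iteratedFDeriv ℝ (m : ℕ) f x (fun j => stdVec (a j))) p μ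

/-- The weighted norm `(∫_0^1 (ε^{-σ} F(ε))^q dε/ε)^{1/q}`, respectively
`sup_{0<ε<1} ε^{-σ} F(ε)` if `q = ∞`. -/
def epsNorm (q : ℝ≥0∞) (σ : ℝ) (F : Param → ℝ≥0∞) : ℝ≥0∞ :=
  if q = ⊤ then ⨆ ε : Param, ENNReal.ofReal ((ε : ℝ) ^ (-σ)) * F ε
  else (∫⁻ ε : Param, (ENNReal.ofReal ((ε : ℝ) ^ (-σ)) * F ε) ^ q.toReal
    * ENNReal.ofReal ((ε : ℝ)⁻¹)
      ∂(Measure.comap Subtype.val volume)) ^ (1 / q.toReal)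

/-- Nets `ε ↦ f_ε` that belong to `C((0,1); C^∞(ℝ^d))`. -/
def IsContNet {d : ℕ} (f : Net d) : Prop :=
  (∀ ε, ContDiff ℝ ∞ (f ε)) ∧
    ∀ m : ℕ, Continuous (fun z : Param × Rd d => iteratedFDeriv ℝ m (f z.1) z.2)

/-! ### Closure under addition and scalar multiplication -/

lemma measurable_eLpNorm_param {d : ℕ} (p : ℝ≥0∞) (μ : Measure (Rd d)) [SFinite μ]
    {F : Param × Rd d → ℂ} (hF : Continuous F) :
    Measurable (fun ε : Param => eLpNorm (fun x => F (ε, x)) p μ) := by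
  have hm : Measurable (fun z : Param × Rd d => ‖F z‖ₑ) := hF.measurable.enorm
  by_cases h0 : p = 0
  · subst h0; simp
  by_cases htop : p = ⊤
  · subst htop
    simp only [eLpNorm_exponent_top, eLpNormEssSup]
    refine measurable_of_Iic fun a => ?_
    have hs : MeasurableSet {z : Param × Rd d | a < ‖F z‖ₑ} := hm measurableSet_Ioi
    have h1 := measurable_measure_prodMk_left (ν := μ) hs
    have : (fun ε : Param => essSup (fun x => ‖F (ε, x)‖ₑ) μ) ⁻¹' Set.Iic a
        = (fun ε : Param => μ (Prod.mk ε ⁻¹' {z : Param × Rd d | a < ‖F z‖ₑ})) ⁻¹' {0} := by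
      ext ε
      simp only [Set.mem_preimage, Set.mem_Iic, Set.mem_singleton_iff]
      constructor
      · intro h
        have := ae_le_essSup (μ := μ) (f := fun x => ‖F (ε, x)‖ₑ)
        have h2 : ∀ᵐ x ∂μ, ‖F (ε, x)‖ₑ ≤ a := this.mono fun x hx => hx.trans h
        rw [ae_iff] at h2
        simpa [not_le] using h2
      · intro h
        refine essSup_le_of_ae_le a ?_
        rw [Filter.EventuallyLE, ae_iff]
        simpa [not_le] using h
    rw [this]
    exact h1 (measurableSet_singleton 0)
  · simp_rw [eLpNorm_eq_lintegral_rpow_enorm_toReal h0 htop]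
    exact (Measurable.lintegral_prod_right' (f := fun z : Param × Rd d => ‖F z‖ₑ ^ p.toReal)
      (hm.pow_const _)).pow_const _

lemma IsContNet.measurable_sobNorm {d : ℕ} {f : Net d} (hf : IsContNet f) (k : ℕ) (p : ℝ≥0∞)
    (μ : Measure (Rd d)) [SFinite μ] : Measurable (fun ε => sobNorm k p μ (f ε)) := by
  unfold sobNorm
  refine Measurable.iSup fun m => Measurable.iSup fun a => ?_
  refine measurable_eLpNorm_param p μ
    (F := fun z => iteratedFDeriv ℝ (m : ℕ) (f z.1) z.2 (fun j => stdVec (a j))) ?_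
  exact (ContinuousMultilinearMap.apply ℝ (fun _ : Fin (m : ℕ) => Rd d) ℂ
    (fun j => stdVec (a j))).continuous.comp (hf.2 m)

lemma IsContNet.zero {d : ℕ} : IsContNet (0 : Net d) := by
  refine ⟨fun ε => contDiff_const (c := (0 : ℂ)), fun m => ?_⟩
  have : (fun z : Param × Rd d => iteratedFDeriv ℝ m ((0 : Net d) z.1) z.2) = fun _ => 0 := by
    ext1 z
    exact congrFun (iteratedFDeriv_fun_zero (𝕜 := ℝ) (n := m)) z.2
  rw [this]
  exact continuous_const

lemma IsContNet.add {d : ℕ} {f g : Net d} (hf : IsContNet f) (hg : IsContNet g) :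
    IsContNet (f + g) := by
  refine ⟨fun ε => (hf.1 ε).add (hg.1 ε), fun m => ?_⟩
  have : (fun z : Param × Rd d => iteratedFDeriv ℝ m ((f + g) z.1) z.2)
      = fun z => iteratedFDeriv ℝ m (f z.1) z.2 + iteratedFDeriv ℝ m (g z.1) z.2 := by
    ext1 z
    exact iteratedFDeriv_add_apply ((hf.1 z.1).contDiffAt.of_le (by exact_mod_cast le_top))
      ((hg.1 z.1).contDiffAt.of_le (by exact_mod_cast le_top))
  rw [this]
  exact (hf.2 m).add (hg.2 m)

lemma IsContNet.smul {d : ℕ} {f : Net d} (hf : IsContNet f) (c : ℂ) : IsContNet (c • f) := by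
  refine ⟨fun ε => (hf.1 ε).const_smul c, fun m => ?_⟩
  have : (fun z : Param × Rd d => iteratedFDeriv ℝ m ((c • f) z.1) z.2)
      = fun z => c • iteratedFDeriv ℝ m (f z.1) z.2 := by
    ext1 z
    exact iteratedFDeriv_const_smul_apply (𝕜 := ℝ) (a := c) (f := f z.1)
      ((hf.1 z.1).contDiffAt.of_le (by exact_mod_cast le_top))
  rw [this]
  exact (continuous_const (y := c)).fun_smul (hf.2 m)

lemma sobNorm_zero {d : ℕ} (k : ℕ) (p : ℝ≥0∞) (μ : Measure (Rd d)) :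
    sobNorm k p μ (0 : Rd d → ℂ) = 0 := by
  unfold sobNorm
  simp only [ENNReal.iSup_eq_zero]
  intro m a
  have h : (fun x : Rd d => iteratedFDeriv ℝ (m : ℕ) (0 : Rd d → ℂ) x (fun j => stdVec (a j)))
      = 0 := by
    ext1 x
    have := congrFun (iteratedFDeriv_fun_zero (𝕜 := ℝ) (n := (m : ℕ)) (E := Rd d) (F := ℂ)) x
    have h2 : iteratedFDeriv ℝ (m : ℕ) (0 : Rd d → ℂ) x = 0 := this
    rw [h2]; rfl
  rw [h, eLpNorm_zero]

lemma continuous_partial {d : ℕ} {f : Rd d → ℂ} (hf : ContDiff ℝ ∞ f) (m : ℕ)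
    (v : Fin m → Rd d) : Continuous (fun x => iteratedFDeriv ℝ m f x v) :=
  (ContinuousMultilinearMap.apply ℝ (fun _ : Fin m => Rd d) ℂ v).continuous.comp
    (hf.continuous_iteratedFDeriv (by exact_mod_cast le_top))

lemma sobNorm_add_le {d : ℕ} (k : ℕ) (p : ℝ≥0∞) (μ : Measure (Rd d)) {f g : Rd d → ℂ}
    (hf : ContDiff ℝ ∞ f) (hg : ContDiff ℝ ∞ g) :
    sobNorm k p μ (f + g) ≤ ENNReal.LpAddConst p * (sobNorm k p μ f + sobNorm k p μ g) := by
  refine iSup_le fun m => iSup_le fun a => ?_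
  have h : (fun x => iteratedFDeriv ℝ (m : ℕ) (f + g) x (fun j => stdVec (a j)))
      = (fun x => iteratedFDeriv ℝ (m : ℕ) f x (fun j => stdVec (a j)))
        + (fun x => iteratedFDeriv ℝ (m : ℕ) g x (fun j => stdVec (a j))) := by
    ext1 x
    rw [iteratedFDeriv_add_apply (hf.contDiffAt.of_le (by exact_mod_cast le_top))
      (hg.contDiffAt.of_le (by exact_mod_cast le_top))]
    rfl
  rw [h]
  refine (eLpNorm_add_le' (continuous_partial hf _ _).aestronglyMeasurable
    (continuous_partial hg _ _).aestronglyMeasurable p).trans ?_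
  refine mul_le_mul' le_rfl (add_le_add ?_ ?_)
  · exact le_iSup₂ (f := fun (m : Fin (k + 1)) (a : Fin (m : ℕ) → Fin d) =>
      eLpNorm (fun x => iteratedFDeriv ℝ (m : ℕ) f x (fun j => stdVec (a j))) p μ) m a
  · exact le_iSup₂ (f := fun (m : Fin (k + 1)) (a : Fin (m : ℕ) → Fin d) =>
      eLpNorm (fun x => iteratedFDeriv ℝ (m : ℕ) g x (fun j => stdVec (a j))) p μ) m a

lemma sobNorm_smul_le {d : ℕ} (k : ℕ) (p : ℝ≥0∞) (μ : Measure (Rd d)) {f : Rd d → ℂ}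
    (hf : ContDiff ℝ ∞ f) (c : ℂ) : sobNorm k p μ (c • f) ≤ ‖c‖ₑ * sobNorm k p μ f := by
  refine iSup_le fun m => iSup_le fun a => ?_
  have h : (fun x => iteratedFDeriv ℝ (m : ℕ) (c • f) x (fun j => stdVec (a j)))
      = c • (fun x => iteratedFDeriv ℝ (m : ℕ) f x (fun j => stdVec (a j))) := by
    ext1 x
    rw [iteratedFDeriv_const_smul_apply (hf.contDiffAt.of_le (by exact_mod_cast le_top))]
    rfl
  rw [h]
  refine (eLpNorm_const_smul_le).trans ?_
  gcongr
  exact le_iSup₂ (f := fun (m : Fin (k + 1)) (a : Fin (m : ℕ) → Fin d) =>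
      eLpNorm (fun x => iteratedFDeriv ℝ (m : ℕ) f x (fun j => stdVec (a j))) p μ) m a

lemma epsNorm_lt_top_iff {q : ℝ≥0∞} (hq : q ≠ ⊤) (hq0 : q.toReal ≠ 0) (σ : ℝ)
    (F : Param → ℝ≥0∞) : epsNorm q σ F < ⊤ ↔
      ∫⁻ ε : Param, (ENNReal.ofReal ((ε : ℝ) ^ (-σ)) * F ε) ^ q.toReal
        * ENNReal.ofReal ((ε : ℝ)⁻¹) ∂(Measure.comap Subtype.val volume) < ⊤ := by
  have hq' : 0 < q.toReal := lt_of_le_of_ne ENNReal.toReal_nonneg (Ne.symm hq0)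
  rw [epsNorm, if_neg hq, ENNReal.rpow_lt_top_iff_of_pos (by positivity)]

lemma epsNorm_of_toReal_eq_zero {q : ℝ≥0∞} (hq : q ≠ ⊤) (hq0 : q.toReal = 0) (σ : ℝ)
    (F : Param → ℝ≥0∞) : epsNorm q σ F < ⊤ := by
  rw [epsNorm, if_neg hq, hq0]
  simp

lemma epsNorm_zero (q : ℝ≥0∞) (σ : ℝ) : epsNorm q σ (fun _ => 0) < ⊤ := by
  by_cases hq : q = ⊤
  · simp [epsNorm, hq]
  by_cases hq0 : q.toReal = 0
  · exact epsNorm_of_toReal_eq_zero hq hq0 _ _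
  rw [epsNorm_lt_top_iff hq hq0]
  have hq' : 0 < q.toReal := lt_of_le_of_ne ENNReal.toReal_nonneg (Ne.symm hq0)
  simp [ENNReal.zero_rpow_of_pos hq']

lemma epsNorm_mono {q : ℝ≥0∞} {σ τ : ℝ} {F G : Param → ℝ≥0∞} (hστ : τ ≤ σ)
    (hFG : ∀ ε, G ε ≤ F ε) : epsNorm q τ G ≤ epsNorm q σ F := by
  have key : ∀ ε : Param, ENNReal.ofReal ((ε : ℝ) ^ (-τ)) * G ε
      ≤ ENNReal.ofReal ((ε : ℝ) ^ (-σ)) * F ε := fun ε =>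
    mul_le_mul' (ENNReal.ofReal_le_ofReal
      (Real.rpow_le_rpow_of_exponent_ge ε.2.1 ε.2.2.le (by linarith))) (hFG ε)
  unfold epsNorm
  split_ifs
  · exact iSup_mono key
  · refine ENNReal.rpow_le_rpow (lintegral_mono fun ε => ?_) (by positivity)
    exact mul_le_mul' (ENNReal.rpow_le_rpow (key ε) ENNReal.toReal_nonneg) le_rfl

lemma epsNorm_const_mul_lt_top {q : ℝ≥0∞} {σ : ℝ} {F : Param → ℝ≥0∞} {c : ℝ≥0∞} (hc : c ≠ ⊤)
    (hF : epsNorm q σ F < ⊤) : epsNorm q σ (fun ε => c * F ε) < ⊤ := by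
  by_cases hq : q = ⊤
  · subst hq
    simp only [epsNorm, if_true] at hF ⊢
    have : ∀ ε : Param, ENNReal.ofReal ((ε : ℝ) ^ (-σ)) * (c * F ε)
        = c * (ENNReal.ofReal ((ε : ℝ) ^ (-σ)) * F ε) := fun ε => by ring
    simp_rw [this, ← ENNReal.mul_iSup]
    exact ENNReal.mul_lt_top hc.lt_top hF
  by_cases hq0 : q.toReal = 0
  · exact epsNorm_of_toReal_eq_zero hq hq0 _ _
  rw [epsNorm_lt_top_iff hq hq0] at hF ⊢
  have : ∀ ε : Param, (ENNReal.ofReal ((ε : ℝ) ^ (-σ)) * (c * F ε)) ^ q.toReal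
      * ENNReal.ofReal ((ε : ℝ)⁻¹)
      = c ^ q.toReal * ((ENNReal.ofReal ((ε : ℝ) ^ (-σ)) * F ε) ^ q.toReal
      * ENNReal.ofReal ((ε : ℝ)⁻¹)) := fun ε => by
    rw [← mul_assoc (c ^ q.toReal), ← ENNReal.mul_rpow_of_nonneg _ _ ENNReal.toReal_nonneg]
    congr 2
    ring
  simp_rw [this]
  have hcq : c ^ q.toReal ≠ ⊤ := ENNReal.rpow_ne_top_of_nonneg ENNReal.toReal_nonneg hc
  rw [lintegral_const_mul' _ _ hcq]
  exact ENNReal.mul_lt_top hcq.lt_top hF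

lemma epsNorm_add_lt_top {q : ℝ≥0∞} {σ : ℝ} {F G : Param → ℝ≥0∞} (hmF : Measurable F)
    (hF : epsNorm q σ F < ⊤) (hG : epsNorm q σ G < ⊤) :
    epsNorm q σ (fun ε => F ε + G ε) < ⊤ := by
  by_cases hq : q = ⊤
  · subst hq
    simp only [epsNorm, if_true] at hF hG ⊢
    refine lt_of_le_of_lt (iSup_le fun ε => ?_) (ENNReal.add_lt_top.2 ⟨hF, hG⟩)
    rw [mul_add]
    exact add_le_add
      (le_iSup (fun ε : Param => ENNReal.ofReal ((ε : ℝ) ^ (-σ)) * F ε) ε)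
      (le_iSup (fun ε : Param => ENNReal.ofReal ((ε : ℝ) ^ (-σ)) * G ε) ε)
  by_cases hq0 : q.toReal = 0
  · exact epsNorm_of_toReal_eq_zero hq hq0 _ _
  rw [epsNorm_lt_top_iff hq hq0] at hF hG ⊢
  set C : ℝ≥0∞ := 2 ^ q.toReal with hC
  have hCt : C ≠ ⊤ := ENNReal.rpow_ne_top_of_nonneg ENNReal.toReal_nonneg (by simp)
  have key : ∀ a b : ℝ≥0∞, (a + b) ^ q.toReal ≤ C * (a ^ q.toReal + b ^ q.toReal) := by
    intro a b
    calc (a + b) ^ q.toReal ≤ (2 * max a b) ^ q.toReal := by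
          refine ENNReal.rpow_le_rpow ?_ ENNReal.toReal_nonneg
          rw [two_mul]
          exact add_le_add (le_max_left _ _) (le_max_right _ _)
      _ = C * (max a b) ^ q.toReal := ENNReal.mul_rpow_of_nonneg _ _ ENNReal.toReal_nonneg
      _ ≤ C * (a ^ q.toReal + b ^ q.toReal) := by
          refine mul_le_mul' le_rfl ?_
          rcases le_total a b with h | h
          · rw [max_eq_right h]; exact le_add_self
          · rw [max_eq_left h]; exact le_self_add
  have hle : ∀ ε : Param, (ENNReal.ofReal ((ε : ℝ) ^ (-σ)) * (F ε + G ε)) ^ q.toReal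
      * ENNReal.ofReal ((ε : ℝ)⁻¹) ≤ C * ((ENNReal.ofReal ((ε : ℝ) ^ (-σ)) * F ε) ^ q.toReal
      * ENNReal.ofReal ((ε : ℝ)⁻¹) + (ENNReal.ofReal ((ε : ℝ) ^ (-σ)) * G ε) ^ q.toReal
      * ENNReal.ofReal ((ε : ℝ)⁻¹)) := fun ε => by
    rw [mul_add, ← add_mul, ← mul_assoc]
    exact mul_le_mul' (key _ _) le_rfl
  refine lt_of_le_of_lt (lintegral_mono hle) ?_
  have hme : Measurable (fun ε : Param => (ENNReal.ofReal ((ε : ℝ) ^ (-σ)) * F ε) ^ q.toReal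
      * ENNReal.ofReal ((ε : ℝ)⁻¹)) := by
    fun_prop
  rw [lintegral_const_mul' _ _ hCt, lintegral_add_left hme]
  exact ENNReal.mul_lt_top hCt.lt_top (ENNReal.add_lt_top.2 ⟨hF, hG⟩)

lemma epsNorm_sobNorm_add {d : ℕ} {q : ℝ≥0∞} {σ τ : ℝ} {k : ℕ} {p : ℝ≥0∞} {μ : Measure (Rd d)}
    [SFinite μ] {f g : Net d} (hf : IsContNet f) (hg : IsContNet g)
    (hF : epsNorm q σ (fun ε => sobNorm k p μ (f ε)) < ⊤)
    (hG : epsNorm q τ (fun ε => sobNorm k p μ (g ε)) < ⊤) :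
    epsNorm q (min σ τ) (fun ε => sobNorm k p μ ((f + g) ε)) < ⊤ := by
  have h1 := (epsNorm_mono (min_le_left σ τ) fun _ => le_rfl).trans_lt hF
  have h2 := (epsNorm_mono (min_le_right σ τ) fun _ => le_rfl).trans_lt hG
  refine lt_of_le_of_lt (epsNorm_mono le_rfl fun ε =>
    sobNorm_add_le k p μ (hf.1 ε) (hg.1 ε)) ?_
  exact epsNorm_const_mul_lt_top (ENNReal.LpAddConst_lt_top p).ne
    (epsNorm_add_lt_top (hf.measurable_sobNorm k p μ) h1 h2)

lemma epsNorm_sobNorm_smul {d : ℕ} {q : ℝ≥0∞} {σ : ℝ} {k : ℕ} {p : ℝ≥0∞} {μ : Measure (Rd d)}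
    {f : Net d} (hf : IsContNet f) (c : ℂ)
    (hF : epsNorm q σ (fun ε => sobNorm k p μ (f ε)) < ⊤) :
    epsNorm q σ (fun ε => sobNorm k p μ ((c • f) ε)) < ⊤ :=
  lt_of_le_of_lt (epsNorm_mono le_rfl fun ε => sobNorm_smul_le k p μ (hf.1 ε) c)
    (epsNorm_const_mul_lt_top enorm_ne_top hF)

lemma epsNorm_sobNorm_zero {d : ℕ} (q : ℝ≥0∞) (σ : ℝ) (k : ℕ) (p : ℝ≥0∞) (μ : Measure (Rd d)) :
    epsNorm q σ (fun ε => sobNorm k p μ ((0 : Net d) ε)) < ⊤ := by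
  have : (fun ε => sobNorm k p μ ((0 : Net d) ε)) = fun _ => 0 := by
    ext1 ε; exact sobNorm_zero k p μ
  rw [this]
  exact epsNorm_zero q σ

/-! ### Spaces of nets and of generalized functions -/

/-- The space `𝓔_q(ℝ^d)` of nets of smooth functions with locally `L^q`-moderate growth. -/
def locModerateNets (d : ℕ) (q p : ℝ≥0∞) : Submodule ℂ (Net d) where
  carrier := {f | IsContNet f ∧ ∀ (k : ℕ) (U : Set (Rd d)), IsOpen U → IsCompact (closure U) →
    ∃ s : ℝ, epsNorm q (-s) (fun ε => sobNorm k p (volume.restrict U) (f ε)) < ⊤}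
  zero_mem' := ⟨IsContNet.zero, fun k _ _ _ => ⟨0, epsNorm_sobNorm_zero _ _ k p _⟩⟩
  add_mem' := by
    rintro f g ⟨hf, hf'⟩ ⟨hg, hg'⟩
    refine ⟨hf.add hg, fun k U ho hc => ?_⟩
    obtain ⟨s, hs⟩ := hf' k U ho hc
    obtain ⟨t, ht⟩ := hg' k U ho hc
    exact ⟨-min (-s) (-t), by rw [neg_neg]; exact epsNorm_sobNorm_add hf hg hs ht⟩
  smul_mem' := by
    rintro c f ⟨hf, hf'⟩
    refine ⟨hf.smul c, fun k U ho hc => ?_⟩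
    obtain ⟨s, hs⟩ := hf' k U ho hc
    exact ⟨s, epsNorm_sobNorm_smul hf c hs⟩

/-- The space of nets `𝓔^{k,σ}_{q,L^p}(ℝ^d)`: nets in `𝓔_q(ℝ^d)` with
`∫_0^1 ε^{-qσ} ‖f_ε‖_{W^{k,p}(ℝ^d)}^q dε/ε < ∞`. -/
def globalNets (d : ℕ) (q p : ℝ≥0∞) (k : ℕ) (σ : ℝ) : Submodule ℂ (Net d) where
  carrier := {f | f ∈ locModerateNets d q p ∧
    epsNorm q σ (fun ε => sobNorm k p volume (f ε)) < ⊤}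
  zero_mem' := ⟨Submodule.zero_mem _, epsNorm_sobNorm_zero _ _ k p _⟩
  add_mem' := by
    rintro f g ⟨hf, hf'⟩ ⟨hg, hg'⟩
    exact ⟨Submodule.add_mem _ hf hg,
      by simpa only [min_self] using epsNorm_sobNorm_add hf.1 hg.1 hf' hg'⟩
  smul_mem' := by
    rintro c f ⟨hf, hf'⟩
    exact ⟨Submodule.smul_mem _ c hf, epsNorm_sobNorm_smul hf.1 c hf'⟩

lemma globalNets_anti {d : ℕ} {q p : ℝ≥0∞} {k : ℕ} {σ τ : ℝ} (h : τ ≤ σ) :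
    globalNets d q p k σ ≤ globalNets d q p k τ := fun _ hf =>
  ⟨hf.1, (epsNorm_mono h fun _ => le_rfl).trans_lt hf.2⟩

/-- `𝓔_{q,L^p}(ℝ^d) = ⋂_k ⋃_s 𝓔^{k,-s}_{q,L^p}(ℝ^d)`. -/
def moderateNets (d : ℕ) (q p : ℝ≥0∞) : Submodule ℂ (Net d) where
  carrier := ⋂ k : ℕ, ⋃ s : ℝ, (globalNets d q p k (-s) : Set (Net d))
  zero_mem' := Set.mem_iInter.2 fun _ => Set.mem_iUnion.2 ⟨0, Submodule.zero_mem _⟩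
  add_mem' := by
    intro f g hf hg
    refine Set.mem_iInter.2 fun k => ?_
    obtain ⟨s, hs⟩ := Set.mem_iUnion.1 (Set.mem_iInter.1 hf k)
    obtain ⟨t, ht⟩ := Set.mem_iUnion.1 (Set.mem_iInter.1 hg k)
    exact Set.mem_iUnion.2 ⟨max s t, Submodule.add_mem _
      (globalNets_anti (neg_le_neg (le_max_left s t)) hs)
      (globalNets_anti (neg_le_neg (le_max_right s t)) ht)⟩
  smul_mem' := by
    intro c f hf
    refine Set.mem_iInter.2 fun k => ?_
    obtain ⟨s, hs⟩ := Set.mem_iUnion.1 (Set.mem_iInter.1 hf k)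
    exact Set.mem_iUnion.2 ⟨s, Submodule.smul_mem _ c hs⟩

/-- `𝓔^∞_{q,L^p}(ℝ^d) = ⋃_s ⋂_k 𝓔^{k,-s}_{q,L^p}(ℝ^d)`. -/
def regularNets (d : ℕ) (q p : ℝ≥0∞) : Set (Net d) :=
  ⋃ s : ℝ, ⋂ k : ℕ, (globalNets d q p k (-s) : Set (Net d))

/-- `𝓝_{q,L^p}(ℝ^d) = ⋂_{k,s} 𝓔^{k,-s}_{q,L^p}(ℝ^d)`. -/
def nullNets (d : ℕ) (q p : ℝ≥0∞) : Submodule ℂ (Net d) :=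
  ⨅ (k : ℕ) (s : ℝ), globalNets d q p k (-s)

/-- `𝓖_{q,L^p}(ℝ^d) = 𝓔_{q,L^p}(ℝ^d) / 𝓝_{q,L^p}(ℝ^d)`. -/
abbrev GenFun (d : ℕ) (q p : ℝ≥0∞) : Type :=
  moderateNets d q p ⧸ (nullNets d q p).submoduleOf (moderateNets d q p)

/-- The class `[(f_ε)_ε]` of a net in `𝓔_{q,L^p}(ℝ^d)`. -/
def genClass {d : ℕ} {q p : ℝ≥0∞} (f : moderateNets d q p) : GenFun d q p :=
  Submodule.Quotient.mk f

/-- `𝓖^{k,σ}_{q,L^p}(ℝ^d)`: the generalized functions with a representative in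
`𝓔^{k,σ}_{q,L^p}(ℝ^d)`. -/
def GenFunKS (d : ℕ) (q p : ℝ≥0∞) (k : ℕ) (σ : ℝ) : Set (GenFun d q p) :=
  {u | ∃ f : moderateNets d q p, (f : Net d) ∈ globalNets d q p k σ ∧ u = genClass f}

/-- `𝓖^∞_{q,L^p}(ℝ^d) = 𝓔^∞_{q,L^p}(ℝ^d) / 𝓝_{q,L^p}(ℝ^d)`, as a subset of
`𝓖_{q,L^p}(ℝ^d)`. -/
def GenFunRegular (d : ℕ) (q p : ℝ≥0∞) : Set (GenFun d q p) :=
  {u | ∃ f : moderateNets d q p, (f : Net d) ∈ regularNets d q p ∧ u = genClass f}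

/-! ### Convolution of tempered distributions with dilated Schwartz functions -/

/-- The Schwartz function `φ_ε = ε^{-d} φ(· / ε)`. -/
def dilate {d : ℕ} (ε : Param) (φ : 𝓢(Rd d, ℂ)) : 𝓢(Rd d, ℂ) :=
  (((ε : ℝ) ^ d)⁻¹ : ℝ) • SchwartzMap.compCLMOfContinuousLinearEquiv ℝ
    (ContinuousLinearEquiv.smulLeft (Units.mk0 (ε : ℝ)⁻¹ (inv_ne_zero ε.2.1.ne'))) φ

lemma dilate_apply {d : ℕ} (ε : Param) (φ : 𝓢(Rd d, ℂ)) (x : Rd d) :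
    dilate ε φ x = (((ε : ℝ) ^ d)⁻¹ : ℝ) • φ ((ε : ℝ)⁻¹ • x) := rfl

/-- The Schwartz function `y ↦ φ(x - y)`. -/
def reflectTranslate {d : ℕ} (x : Rd d) (φ : 𝓢(Rd d, ℂ)) : 𝓢(Rd d, ℂ) :=
  SchwartzMap.compSubConstCLM ℝ x
    (SchwartzMap.compCLMOfContinuousLinearEquiv ℝ (ContinuousLinearEquiv.neg ℝ) φ)

lemma reflectTranslate_apply {d : ℕ} (x : Rd d) (φ : 𝓢(Rd d, ℂ)) (y : Rd d) :
    reflectTranslate x φ y = φ (x - y) := by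
  have : reflectTranslate x φ y = φ (-(y - x)) := rfl
  rw [this, neg_sub]

/-- The convolution `T * φ` as a function: `(T * φ)(x) = ⟨T(y), φ(x - y)⟩`. -/
def conv {d : ℕ} (T : 𝓢'(Rd d, ℂ)) (φ : 𝓢(Rd d, ℂ)) : Rd d → ℂ :=
  fun x => T (reflectTranslate x φ)

/-- The moment `∫ x^α φ(x) dx`. -/
def moment {d : ℕ} (α : Fin d → ℕ) (φ : 𝓢(Rd d, ℂ)) : ℂ :=
  ∫ x : Rd d, ((∏ i, x i ^ α i : ℝ) : ℂ) * φ x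

/-- Mollifiers: `∫ φ = 1` and all moments of positive order vanish. -/
def IsMollifier {d : ℕ} (φ : 𝓢(Rd d, ℂ)) : Prop :=
  ∫ x : Rd d, φ x = 1 ∧ ∀ α : Fin d → ℕ, α ≠ 0 → moment α φ = 0

/-- The net `(T * φ_ε)_ε`. -/
def mollify {d : ℕ} (φ : 𝓢(Rd d, ℂ)) (T : 𝓢'(Rd d, ℂ)) : Net d :=
  fun ε => conv T (dilate ε φ)

open Classical in
/-- The map `ι(T) = [(T * φ_ε)_ε]`; the value `0` is assigned when `(T * φ_ε)_ε` is not in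
`𝓔_{q,L^p}(ℝ^d)`. -/
def iota {d : ℕ} (q p : ℝ≥0∞) (φ : 𝓢(Rd d, ℂ)) (T : 𝓢'(Rd d, ℂ)) : GenFun d q p :=
  if h : mollify φ T ∈ moderateNets d q p then genClass ⟨mollify φ T, h⟩ else 0

/-! ### Besov spaces and Schwartz' spaces `𝓓_{L^p}`, `𝓓'_{L^p}` -/

/-- `(η, ψ)` is an LP-pair of order `s`. -/
def IsLPPair {d : ℕ} (s : ℝ) (η ψ : 𝓢(Rd d, ℂ)) : Prop :=
  (∃ σ : ℝ, 0 < σ ∧ ∃ θ : ℝ, θ ∈ Set.Ioo (0 : ℝ) 1 ∧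
    (∀ ξ : Rd d, ‖ξ‖ ≤ σ → 0 < ‖𝓕 η ξ‖) ∧
    (∀ ξ : Rd d, θ * σ ≤ ‖ξ‖ → ‖ξ‖ ≤ σ → 0 < ‖𝓕 ψ ξ‖)) ∧
  ∀ α : Fin d → ℕ, ((∑ i, α i : ℕ) : ℤ) ≤ ⌊s⌋ → moment α ψ = 0

/-- The Besov norm `‖T * η‖_{L^p} + (∫_0^1 (y^{-s} ‖T * ψ_y‖_{L^p})^q dy/y)^{1/q}`. -/
def besovNorm {d : ℕ} (η ψ : 𝓢(Rd d, ℂ)) (s : ℝ) (p q : ℝ≥0∞) (T : 𝓢'(Rd d, ℂ)) : ℝ≥0∞ :=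
  eLpNorm (conv T η) p volume + epsNorm q s (fun y => eLpNorm (conv T (dilate y ψ)) p volume)

/-- The Besov space `B^s_{p,q}(ℝ^d)`, computed with the LP-pair `(η, ψ)` of order `s`. -/
def BesovSpace {d : ℕ} (η ψ : 𝓢(Rd d, ℂ)) (s : ℝ) (p q : ℝ≥0∞) : Set 𝓢'(Rd d, ℂ) :=
  {T | besovNorm η ψ s p q T < ⊤}

/-- The Sobolev space `W^{k,p}(ℝ^d)`, as a space of distributions: all distributional derivatives
of order at most `k` are given by functions in `L^p`. -/
def sobolevSpace (d k : ℕ) (p : ℝ≥0∞) : Set 𝓢'(Rd d, ℂ) :=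
  {T | ∀ m ≤ k, ∀ a : Fin m → Fin d, ∃ f : Rd d → ℂ, MemLp f p volume ∧
    ∀ χ : 𝓢(Rd d, ℂ), (∂^{fun j => (stdVec (a j) : Rd d)} T) χ = ∫ x, χ x * f x}

/-- `W_0^{-k,p}(ℝ^d)`: the distributions that are continuous for the norm of `W^{k,p'}(ℝ^d)`,
where `1/p + 1/p' = 1`, that is, the dual space of the closure of the test functions in
`W^{k,p'}(ℝ^d)`. -/
def negSobolevSpace (d k : ℕ) (p : ℝ≥0∞) : Set 𝓢'(Rd d, ℂ) :=
  {T | ∃ C : ℝ≥0, ∀ χ : 𝓢(Rd d, ℂ), ‖T χ‖ₑ ≤ C * sobNorm k p.conjExponent volume χ}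

/-- `𝓓_{L^p}(ℝ^d) = ⋂_k W^{k,p}(ℝ^d)`. -/
def DLp (d : ℕ) (p : ℝ≥0∞) : Set 𝓢'(Rd d, ℂ) := ⋂ k : ℕ, sobolevSpace d k p

/-- `𝓓'_{L^p}(ℝ^d) = ⋃_k W_0^{-k,p}(ℝ^d)`. -/
def DLpDual (d : ℕ) (p : ℝ≥0∞) : Set 𝓢'(Rd d, ℂ) := ⋃ k : ℕ, negSobolevSpace d k p

end

open LineDeriv

/-! ### Minkowski's integral inequality -/

/-! Differentiating the net moves derivatives onto the mollifier: `∂^a (T * φ_ε) = ε^{-|a|} T * (∂^a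
φ)_ε` (`iteratedFDeriv_mollify`). A bound on the `W^{k,p}`-norms of `T * φ_ε` with weight exponent
`σ` therefore amounts to bounds on `‖T * (∂^a φ)_ε‖_{L^p}` with exponent `σ + |a|`, for all `|a| ≤
k`. With `σ = r - k` the derivatives of order `k` carry exactly the Besov exponent `r`. Moreover `φ`
together with all `∂^a φ`, `|a| = k`, is an admissible system of kernels: the Fourier transform of
`φ` is nonzero near the origin, and near the origin but away from it those of the `∂^a φ` have no
common zero (`IsMollifier.isTauberian`). Statements (i) and (ii) thus say that Besov norms do not
depend on the kernels.

This independence is `IsTauberian.epsNorm_conv_dilate_lt_top`. It rests on a Calderón formula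
(`IsTauberian.exists_reproducing`), which recovers `T` from `T * η` and `T * (ψ_i)_z`, `0 < z < 1`,
by means of dual kernels `Λ` and `Ψ_i`, where every moment of `Ψ_i` vanishes. Inserting it into `T *
κ_y`, where `κ` has `M > r` vanishing moments, leaves the `L^1`-norms of `κ_y * (Ψ_i)_z`. These
decay in both ratios `y/z` and `z/y` (`exists_eLpNorm_avg_dilate_le`), and Schur's test for `dz/z`
concludes. For the Besov kernel `κ = ψ` the condition `M > r` is the order of the LP-pair; for `κ =
∂^a φ` with `|a| = m` it reads `r - k + m < m`, that is, `r < k`.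

The Calderón formula has two further uses. Paired with a test function and combined with Hölder's
inequality, it places Besov spaces in `𝓓'_{L^p}` (`IsTauberian.mem_DLpDual`). If `∫ ‖S *
(ψ_i)_z‖_{L^p} dz/z < ∞`, it represents `S` by an `L^p` function (`IsTauberian.exists_memLp`). The
latter gives (iii): a growth exponent that is uniform in the order of differentiation makes this
integral finite for every derivative `S` of `T`, while the converse is Young's inequality.
Moderateness of `T * φ_ε` follows from `exists_eLpNorm_conv_le`, a duality argument. Since null nets
satisfy every global bound, membership of `ι(T)` in the spaces of generalized functions can be read
off the net `T * φ_ε` itself. -/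

lemma measurable_eLpNorm_of_prod {Ω X : Type*} [MeasurableSpace Ω] [MeasurableSpace X]
    (p : ℝ≥0∞) (ν : Measure X) [SFinite ν] {F : Ω × X → ℝ≥0∞} (hF : Measurable F) :
    Measurable (fun t => eLpNorm (fun x => F (t, x)) p ν) := by
  by_cases h0 : p = 0
  · subst h0; simp
  by_cases htop : p = ⊤
  · subst htop
    simp only [eLpNorm_exponent_top, eLpNormEssSup, enorm_eq_self]
    -- The essential supremum is at most `a` exactly when the section of `{F > a}` is null, and the
    -- measure of a section is a measurable function of the parameter.
    refine measurable_of_Iic fun a => ?_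
    have h1 := measurable_measure_prodMk_left (ν := ν) (hF measurableSet_Ioi : MeasurableSet
      {z : Ω × X | a < F z})
    have : (fun t => essSup (fun x => F (t, x)) ν) ⁻¹' Set.Iic a
        = (fun t => ν (Prod.mk t ⁻¹' {z : Ω × X | a < F z})) ⁻¹' {0} := by
      ext t
      simp only [Set.mem_preimage, Set.mem_Iic, Set.mem_singleton_iff]
      constructor
      · intro h
        have h2 : ∀ᵐ x ∂ν, F (t, x) ≤ a :=
          (ae_le_essSup (μ := ν) (f := fun x => F (t, x))).mono fun x hx => hx.trans h
        rw [ae_iff] at h2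
        simpa [not_le] using h2
      · intro h
        refine essSup_le_of_ae_le a ?_
        rw [Filter.EventuallyLE, ae_iff]
        simpa [not_le] using h
    rw [this]
    exact h1 (measurableSet_singleton 0)
  · simp_rw [eLpNorm_eq_lintegral_rpow_enorm_toReal h0 htop, enorm_eq_self]
    exact (Measurable.lintegral_prod_right' (f := fun z : Ω × X => F z ^ p.toReal)
      (hF.pow_const _)).pow_const _

/-- Hölder's inequality is applied to the splitting `F = (F N^{-1/Q}) N^{1/Q}`, where `N` majorizes
the `L^P`-norm of each slice. After Tonelli the inner integral is at most `N^P N^{-(P-1)} = N`. -/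
lemma lintegral_rpow_lintegral_le {Ω X : Type*} [MeasurableSpace Ω] [MeasurableSpace X]
    {P Q : ℝ} (hPQ : P.HolderConjugate Q) (μ : Measure Ω) [SFinite μ] (ν : Measure X) [SFinite ν]
    {F : Ω × X → ℝ≥0∞} (hF : Measurable F) {N : Ω → ℝ≥0∞} (hN : Measurable N)
    (hN0 : ∀ t, N t ≠ 0) (hNi : ∫⁻ t, N t ∂μ ≠ ⊤)
    (hFN : ∀ t, ∫⁻ x, F (t, x) ^ P ∂ν ≤ N t ^ P) :
    ∫⁻ x, (∫⁻ t, F (t, x) ∂μ) ^ P ∂ν ≤ (∫⁻ t, N t ∂μ) ^ P := by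
  have hP := hPQ.pos
  have hQ := hPQ.symm.pos
  have hNt : ∀ᵐ t ∂μ, N t ≠ ⊤ := (ae_lt_top hN hNi).mono fun t h => h.ne
  have hPQ' : P / Q = P - 1 := hPQ.div_conj_eq_sub_one
  have step : ∀ x, (∫⁻ t, F (t, x) ∂μ) ^ P
      ≤ (∫⁻ t, N t ∂μ) ^ (P - 1) * ∫⁻ t, F (t, x) ^ P * N t ^ (-(P - 1)) ∂μ := by
    intro x
    have hFx : Measurable fun t => F (t, x) := hF.comp measurable_prodMk_right
    have h1 : ∫⁻ t, F (t, x) ∂μ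
        = ∫⁻ t, ((fun t => F (t, x) * N t ^ (-(1 / Q))) * fun t => N t ^ (1 / Q)) t ∂μ := by
      refine lintegral_congr_ae (hNt.mono fun t h => ?_)
      simp only [Pi.mul_apply]
      rw [mul_assoc, ← ENNReal.rpow_add _ _ (hN0 t) h]
      simp
    have h2 := ENNReal.lintegral_mul_le_Lp_mul_Lq μ hPQ
      (f := fun t => F (t, x) * N t ^ (-(1 / Q))) (g := fun t => N t ^ (1 / Q))
      (hFx.mul (hN.pow_const _)).aemeasurable (hN.pow_const _).aemeasurable
    rw [← h1] at h2
    refine (ENNReal.rpow_le_rpow h2 hP.le).trans (le_of_eq ?_)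
    rw [ENNReal.mul_rpow_of_nonneg _ _ hP.le, ← ENNReal.rpow_mul, ← ENNReal.rpow_mul,
      one_div_mul_cancel hP.ne', ENNReal.rpow_one, mul_comm]
    congr 1
    · rw [one_div_mul_eq_div, hPQ']
      congr 1
      refine lintegral_congr fun t => ?_
      rw [← ENNReal.rpow_mul, one_div_mul_cancel hQ.ne', ENNReal.rpow_one]
    · refine lintegral_congr fun t => ?_
      rw [ENNReal.mul_rpow_of_nonneg _ _ hP.le, ← ENNReal.rpow_mul, neg_mul, one_div_mul_eq_div,
        hPQ']
  have hm : Measurable fun z : Ω × X => F z ^ P * N z.1 ^ (-(P - 1)) :=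
    (hF.pow_const _).mul ((hN.comp measurable_fst).pow_const _)
  calc ∫⁻ x, (∫⁻ t, F (t, x) ∂μ) ^ P ∂ν
      ≤ ∫⁻ x, (∫⁻ t, N t ∂μ) ^ (P - 1) * ∫⁻ t, F (t, x) ^ P * N t ^ (-(P - 1)) ∂μ ∂ν :=
        lintegral_mono step
    _ = (∫⁻ t, N t ∂μ) ^ (P - 1) * ∫⁻ t, ∫⁻ x, F (t, x) ^ P * N t ^ (-(P - 1)) ∂ν ∂μ := by
        rw [lintegral_const_mul' _ _ (ENNReal.rpow_ne_top_of_nonneg hPQ.sub_one_pos.le hNi),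
          lintegral_lintegral_swap hm.aemeasurable.prod_swap]
    _ ≤ (∫⁻ t, N t ∂μ) ^ (P - 1) * ∫⁻ t, N t ∂μ := by
        refine mul_le_mul' le_rfl ?_
        refine lintegral_mono_ae (hNt.mono fun t h => ?_)
        have hc : N t ^ (-(P - 1)) ≠ ⊤ := ENNReal.rpow_ne_top_of_ne_zero (hN0 t) h
        rw [lintegral_mul_const' _ _ hc]
        calc _ ≤ N t ^ P * N t ^ (-(P - 1)) := by gcongr; exact hFN t
          _ = N t := by
            rw [← ENNReal.rpow_add _ _ (hN0 t) h]; simp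
    _ = (∫⁻ t, N t ∂μ) ^ P := by
        nth_rw 2 [← ENNReal.rpow_one (∫⁻ t, N t ∂μ)]
        rw [← ENNReal.rpow_add_of_nonneg _ _ hPQ.sub_one_pos.le zero_le_one]
        simp

/-- Minkowski's integral inequality. -/
lemma eLpNorm_lintegral_le {Ω X : Type*} [MeasurableSpace Ω] [MeasurableSpace X]
    {p : ℝ≥0∞} (hp : 1 ≤ p) (μ : Measure Ω) [SigmaFinite μ] (ν : Measure X) [SFinite ν]
    {F : Ω × X → ℝ≥0∞} (hF : Measurable F) :
    eLpNorm (fun x => ∫⁻ t, F (t, x) ∂μ) p ν ≤ ∫⁻ t, eLpNorm (fun x => F (t, x)) p ν ∂μ := by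
  have hmN := measurable_eLpNorm_of_prod p ν hF
  by_cases htop : p = ⊤
  · subst htop
    simp only [eLpNorm_exponent_top, eLpNormEssSup, enorm_eq_self] at hmN ⊢
    refine essSup_le_of_ae_le _ ?_
    have h1 : ∀ᵐ t ∂μ, ∀ᵐ x ∂ν, F (t, x) ≤ essSup (fun x => F (t, x)) ν :=
      Filter.Eventually.of_forall fun t => ae_le_essSup
    have h2 := (Measure.ae_ae_comm (p := fun t x => F (t, x) ≤ essSup (fun x => F (t, x)) ν)
      (measurableSet_le hF (hmN.comp measurable_fst))).1 h1
    exact h2.mono fun x hx => lintegral_mono_ae hx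
  have h0 : p ≠ 0 := (zero_lt_one.trans_le hp).ne'
  rcases eq_or_lt_of_le hp with rfl | hp1
  · simp only [eLpNorm_one_eq_lintegral_enorm, enorm_eq_self]
    rw [lintegral_lintegral_swap hF.aemeasurable.prod_swap]
  have hP1 : 1 < p.toReal := by
    rw [← ENNReal.toReal_one]
    exact (ENNReal.toReal_lt_toReal (by simp) htop).2 hp1
  have hPQ := Real.HolderConjugate.conjExponent hP1
  refine ENNReal.le_of_forall_pos_le_add fun ε hε hA => ?_
  -- The slice norms may vanish, but the weighted Hölder argument uses negative powers of the
  -- weight. Adding a strictly positive function of small integral repairs this.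
  obtain ⟨ρ, hρ0, hρm, hρ⟩ := exists_pos_lintegral_lt_of_sigmaFinite μ
    (ε := (ε : ℝ≥0∞)) (by exact_mod_cast hε.ne')
  set N : Ω → ℝ≥0∞ := fun t => eLpNorm (fun x => F (t, x)) p ν + ρ t with hN
  have hNm : Measurable N := hmN.add (by fun_prop)
  have hNi : ∫⁻ t, N t ∂μ ≤ ∫⁻ t, eLpNorm (fun x => F (t, x)) p ν ∂μ + ε := by
    rw [lintegral_add_left hmN]
    gcongr
  have key := lintegral_rpow_lintegral_le hPQ μ ν hF hNm
    (fun t => by simp [hN, (hρ0 t).ne'])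
    (ne_top_of_le_ne_top (by simp [hA.ne]) hNi) (fun t => by
      calc ∫⁻ x, F (t, x) ^ p.toReal ∂ν = (eLpNorm (fun x => F (t, x)) p ν) ^ p.toReal := by
            rw [eLpNorm_eq_lintegral_rpow_enorm_toReal h0 htop, ← ENNReal.rpow_mul,
              one_div_mul_cancel (by positivity), ENNReal.rpow_one]
            simp
        _ ≤ _ := ENNReal.rpow_le_rpow le_self_add (by positivity))
  refine le_trans ?_ hNi
  rw [eLpNorm_eq_lintegral_rpow_enorm_toReal h0 htop]
  simp only [enorm_eq_self]
  refine (ENNReal.rpow_le_rpow key (by positivity)).trans (le_of_eq ?_)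
  rw [← ENNReal.rpow_mul, mul_one_div_cancel (by positivity), ENNReal.rpow_one]

/-- Minkowski's inequality for Bochner integrals. -/
lemma eLpNorm_integral_le {Ω X E : Type*} [MeasurableSpace Ω] [MeasurableSpace X]
    [NormedAddCommGroup E] [NormedSpace ℝ E]
    {p : ℝ≥0∞} (hp : 1 ≤ p) (μ : Measure Ω) [SigmaFinite μ] (ν : Measure X) [SFinite ν]
    {F : Ω → X → E} (hF : Measurable fun z : Ω × X => ‖F z.1 z.2‖ₑ) :
    eLpNorm (fun x => ∫ t, F t x ∂μ) p ν ≤ ∫⁻ t, eLpNorm (F t) p ν ∂μ := by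
  calc eLpNorm (fun x => ∫ t, F t x ∂μ) p ν
      ≤ eLpNorm (fun x => ∫⁻ t, ‖F t x‖ₑ ∂μ) p ν :=
        eLpNorm_mono_enorm fun x => by
          simpa using enorm_integral_le_lintegral_enorm (μ := μ) fun t => F t x
    _ ≤ ∫⁻ t, eLpNorm (fun x => ‖F t x‖ₑ) p ν ∂μ :=
        eLpNorm_lintegral_le hp μ ν (F := fun z => ‖F z.1 z.2‖ₑ) hF
    _ = _ := by simp_rw [eLpNorm_enorm]

/-! ### Partial derivatives in the standard directions -/

lemma norm_stdVec {d : ℕ} (i : Fin d) : ‖(stdVec i : Rd d)‖ = 1 := by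
  simp [stdVec]

lemma sum_smul_stdVec {d : ℕ} (v : Rd d) : ∑ i, v i • (stdVec i : Rd d) = v := by
  ext j
  simp [stdVec, Pi.single_apply]

lemma ContinuousMultilinearMap.apply_eq_sum_stdVec {d l : ℕ}
    (D : ContinuousMultilinearMap ℝ (fun _ : Fin l => Rd d) ℂ) (v : Fin l → Rd d) :
    D v = ∑ a : Fin l → Fin d, (∏ j, v j (a j)) • D fun j => stdVec (a j) := by
  conv_lhs => rw [show v = fun j => ∑ i, v j i • (stdVec i : Rd d) from
    funext fun j => (sum_smul_stdVec (v j)).symm]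
  rw [D.map_sum]
  refine Finset.sum_congr rfl fun a _ => ?_
  rw [D.map_smul_univ]

lemma ContinuousMultilinearMap.norm_le_sum_stdVec {d l : ℕ}
    (D : ContinuousMultilinearMap ℝ (fun _ : Fin l => Rd d) ℂ) :
    ‖D‖ ≤ ∑ a : Fin l → Fin d, ‖D fun j => stdVec (a j)‖ := by
  refine D.opNorm_le_bound (Finset.sum_nonneg fun a _ => norm_nonneg _) fun v => ?_
  rw [D.apply_eq_sum_stdVec v, Finset.sum_mul]
  refine (norm_sum_le _ _).trans (Finset.sum_le_sum fun a _ => ?_)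
  rw [norm_smul, mul_comm, norm_prod]
  gcongr with j
  exact PiLp.norm_apply_le (v j) (a j)

lemma ContinuousMultilinearMap.norm_apply_stdVec_le {d l : ℕ}
    (D : ContinuousMultilinearMap ℝ (fun _ : Fin l => Rd d) ℂ) (a : Fin l → Fin d) :
    ‖D fun j => stdVec (a j)‖ ≤ ‖D‖ := by
  refine (D.le_opNorm _).trans_eq ?_
  simp [norm_stdVec]

lemma ContinuousMultilinearMap.continuous_of_stdVec {d l : ℕ} {X : Type*} [TopologicalSpace X]
    {D : X → ContinuousMultilinearMap ℝ (fun _ : Fin l => Rd d) ℂ}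
    (hD : ∀ a : Fin l → Fin d, Continuous fun x => D x fun j => stdVec (a j)) : Continuous D := by
  refine continuous_iff_continuousAt.2 fun x₀ => tendsto_iff_norm_sub_tendsto_zero.2 ?_
  have h : Filter.Tendsto (fun x => ∑ a : Fin l → Fin d,
      ‖D x (fun j => stdVec (a j)) - D x₀ (fun j => stdVec (a j))‖) (nhds x₀) (nhds 0) := by
    rw [← Finset.sum_const_zero (s := (Finset.univ : Finset (Fin l → Fin d)))]
    exact tendsto_finsetSum _ fun a _ =>
      tendsto_iff_norm_sub_tendsto_zero.1 ((hD a).tendsto x₀)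
  exact squeeze_zero (fun x => norm_nonneg _) (fun x => (D x - D x₀).norm_le_sum_stdVec) h

/-! ### Integrals of Schwartz functions depending on a parameter -/

section WeakIntegral

open scoped BoundedContinuousFunction

/-- The map `χ ↦ ‖x‖ ^ k • ∂^a χ(x)` into the bounded continuous functions. -/
noncomputable def weightedDerivCLM {d : ℕ} (k : ℕ) {l : ℕ} (a : Fin l → Fin d) :
    𝓢(Rd d, ℂ) →L[ℂ] Rd d →ᵇ ℂ :=
  SchwartzMap.mkCLMtoNormedSpace (𝕜 := ℂ) (𝕜' := ℂ) (σ := RingHom.id ℂ)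
    (fun f => BoundedContinuousFunction.ofNormedAddCommGroup
      (fun x => ‖x‖ ^ k • (∂^{fun j => (stdVec (a j) : Rd d)} f) x)
      ((continuous_norm.pow k).smul (SchwartzMap.continuous _))
      (SchwartzMap.seminorm ℂ k l f) (fun x => by
        rw [norm_smul, norm_pow, norm_norm, SchwartzMap.iteratedLineDerivOp_eq_iteratedFDeriv]
        refine le_trans ?_ (SchwartzMap.le_seminorm ℂ k l f x)
        gcongr
        exact ContinuousMultilinearMap.norm_apply_stdVec_le _ a))
    (fun f g => by
      ext1 x
      simp only [iteratedLineDerivOp_add, BoundedContinuousFunction.coe_ofNormedAddCommGroup,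
        BoundedContinuousFunction.coe_add, Pi.add_apply, _root_.add_apply, smul_add])
    (fun c f => by
      ext1 x
      simp only [iteratedLineDerivOp_smul, BoundedContinuousFunction.coe_ofNormedAddCommGroup,
        BoundedContinuousFunction.coe_smul, RingHom.id_apply, _root_.smul_apply]
      rw [smul_comm])
    ⟨{(k, l)}, 1, zero_le_one, fun f => by
      rw [one_mul, Finset.sup_singleton, schwartzSeminormFamily_apply]
      exact BoundedContinuousFunction.norm_ofNormedAddCommGroup_le _ (apply_nonneg _ _) _⟩

lemma weightedDerivCLM_apply {d : ℕ} (k : ℕ) {l : ℕ} (a : Fin l → Fin d) (χ : 𝓢(Rd d, ℂ))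
    (x : Rd d) :
    weightedDerivCLM k a χ x = ‖x‖ ^ k • (∂^{fun j => (stdVec (a j) : Rd d)} χ) x := rfl

lemma norm_weightedDerivCLM_le {d : ℕ} (k : ℕ) {l : ℕ} (a : Fin l → Fin d) (χ : 𝓢(Rd d, ℂ)) :
    ‖weightedDerivCLM k a χ‖ ≤ SchwartzMap.seminorm ℝ k l χ := by
  refine (BoundedContinuousFunction.norm_le (apply_nonneg _ _)).2 fun x => ?_
  rw [weightedDerivCLM_apply, norm_smul, norm_pow, norm_norm,
    SchwartzMap.iteratedLineDerivOp_eq_iteratedFDeriv]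
  refine le_trans ?_ (SchwartzMap.le_seminorm ℝ k l χ x)
  gcongr
  exact ContinuousMultilinearMap.norm_apply_stdVec_le _ a

lemma seminorm_le_sum_weightedDerivCLM {d : ℕ} (k l : ℕ) (χ : 𝓢(Rd d, ℂ)) :
    SchwartzMap.seminorm ℂ k l χ ≤ ∑ a : Fin l → Fin d, ‖weightedDerivCLM k a χ‖ := by
  refine SchwartzMap.seminorm_le_bound ℂ k l χ (Finset.sum_nonneg fun a _ => norm_nonneg _)
    fun x => ?_
  calc ‖x‖ ^ k * ‖iteratedFDeriv ℝ l χ x‖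
      ≤ ‖x‖ ^ k * ∑ a : Fin l → Fin d, ‖iteratedFDeriv ℝ l χ x fun j => stdVec (a j)‖ := by
        gcongr
        exact ContinuousMultilinearMap.norm_le_sum_stdVec _
    _ ≤ _ := by
        rw [Finset.mul_sum]
        refine Finset.sum_le_sum fun a _ => ?_
        have := (weightedDerivCLM k a χ).norm_coe_le_norm x
        rwa [weightedDerivCLM_apply, norm_smul, norm_pow, norm_norm,
          SchwartzMap.iteratedLineDerivOp_eq_iteratedFDeriv] at this

/-! ### Factorization of tempered distributions through a Banach space -/

/-- The estimate makes `T` vanish on the kernel of `J`, so `T` descends to a bounded functional on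
the range of `J`. Hahn–Banach extends it to `B`. -/
lemma LinearMap.exists_factorization {S B : Type*} [AddCommGroup S] [Module ℂ S]
    [NormedAddCommGroup B] [NormedSpace ℂ B] (T : S →ₗ[ℂ] ℂ) (J : S →ₗ[ℂ] B) {K : ℝ}
    (hT : ∀ χ, ‖T χ‖ ≤ K * ‖J χ‖) : ∃ Λ : B →L[ℂ] ℂ, ∀ χ, T χ = Λ (J χ) := by
  obtain ⟨g, hg⟩ := LinearMap.exists_rightInverse_of_surjective
    J.rangeRestrict (LinearMap.range_rangeRestrict _)
  have hg' : ∀ y, J (g y) = y := fun y => congrArg Subtype.val (LinearMap.congr_fun hg y)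
  let f : StrongDual ℂ (LinearMap.range J) :=
    LinearMap.mkContinuous (T ∘ₗ g) K fun y => by
      refine (hT (g y)).trans_eq ?_
      rw [hg']
      rfl
  obtain ⟨Λ, hΛ, -⟩ := exists_extension_norm_eq _ f
  refine ⟨Λ, fun χ => ?_⟩
  have h1 := hΛ ⟨J χ, LinearMap.mem_range_self J χ⟩
  have h2 : f ⟨J χ, LinearMap.mem_range_self J χ⟩ = T χ := by
    -- The linear section `g` need not return `χ`, but it returns another preimage of `J χ`, on
    -- which `T` takes the same value.
    have h3 : ‖T (g ⟨J χ, LinearMap.mem_range_self J χ⟩ - χ)‖ ≤ 0 := by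
      refine (hT _).trans_eq ?_
      rw [map_sub, hg']
      simp
    rw [map_sub, norm_le_zero_iff, sub_eq_zero] at h3
    exact h3
  rw [← h2, ← h1]

lemma LinearMap.exists_factorization_sum {ι S B : Type*} [Fintype ι] [DecidableEq ι]
    [AddCommGroup S] [Module ℂ S] [NormedAddCommGroup B] [NormedSpace ℂ B] (T : S →ₗ[ℂ] ℂ)
    (J : ι → S →ₗ[ℂ] B) {K : ℝ} (hK : 0 ≤ K) (hT : ∀ χ, ‖T χ‖ ≤ K * ∑ i, ‖J i χ‖) :
    ∃ Λ : ι → B →L[ℂ] ℂ, ∀ χ, T χ = ∑ i, Λ i (J i χ) := by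
  obtain ⟨Λ, hΛ⟩ := T.exists_factorization (LinearMap.pi J) (K := K * Fintype.card ι) fun χ => by
    refine (hT χ).trans ?_
    rw [mul_assoc]
    refine mul_le_mul_of_nonneg_left ?_ hK
    calc ∑ i, ‖J i χ‖ ≤ ∑ _i : ι, ‖LinearMap.pi J χ‖ :=
          Finset.sum_le_sum fun i _ => norm_le_pi_norm (LinearMap.pi J χ) i
      _ = _ := by simp
  refine ⟨fun i => Λ.comp (ContinuousLinearMap.single ℂ (fun _ : ι => B) i), fun χ => ?_⟩
  rw [hΛ]
  have : LinearMap.pi J χ = ∑ i, Pi.single i (J i χ) := by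
    rw [Finset.univ_sum_single]; rfl
  rw [this, map_sum]
  rfl

/-- A tempered distribution factors through finitely many weighted derivatives. -/
lemma TemperedDistribution.exists_factorization {d : ℕ} (T : 𝓢'(Rd d, ℂ)) :
    ∃ (ι : Type) (_ : Fintype ι) (k l : ι → ℕ) (a : (i : ι) → Fin (l i) → Fin d)
      (Λ : ι → (Rd d →ᵇ ℂ) →L[ℂ] ℂ),
        ∀ χ, T χ = ∑ i, Λ i (weightedDerivCLM (k i) (a i) χ) := by
  let q : Seminorm ℂ 𝓢(Rd d, ℂ) := (normSeminorm ℂ ℂ).comp (T : 𝓢(Rd d, ℂ) →ₗ[ℂ] ℂ)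
  have hq : Continuous q := continuous_norm.comp T.continuous
  obtain ⟨s, C, -, hC⟩ := Seminorm.bound_of_continuous (schwartz_withSeminorms ℂ (Rd d) ℂ) q hq
  have hT : ∀ χ, ‖T χ‖ ≤ C * ∑ i : (i : s) × (Fin i.1.2 → Fin d),
      ‖weightedDerivCLM i.1.1.1 i.2 χ‖ := by
    intro χ
    refine (hC χ).trans ?_
    rw [_root_.smul_apply, NNReal.smul_def, smul_eq_mul]
    refine mul_le_mul_of_nonneg_left ?_ C.2
    rw [Fintype.sum_sigma]
    refine Seminorm.finset_sup_apply_le (by positivity) fun i hi => ?_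
    refine (seminorm_le_sum_weightedDerivCLM _ _ _).trans ?_
    exact Finset.single_le_sum (f := fun i : s => ∑ a : Fin i.1.2 → Fin d,
      ‖weightedDerivCLM i.1.1 a χ‖) (fun i _ => Finset.sum_nonneg fun _ _ => norm_nonneg _)
      (Finset.mem_univ (⟨i, hi⟩ : s))
  classical
  obtain ⟨Λ, hΛ⟩ := LinearMap.exists_factorization_sum (T : 𝓢(Rd d, ℂ) →ₗ[ℂ] ℂ)
    (fun i : (i : s) × (Fin i.1.2 → Fin d) =>
      (weightedDerivCLM i.1.1.1 i.2 : 𝓢(Rd d, ℂ) →ₗ[ℂ] (Rd d →ᵇ ℂ))) C.2 hT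
  exact ⟨(i : s) × (Fin i.1.2 → Fin d), inferInstance, fun i => i.1.1.1, fun i => i.1.1.2,
    fun i => i.2, Λ, hΛ⟩

/-! ### Differentiation under the integral sign and the pairing with distributions -/

variable {Ω : Type*} [TopologicalSpace Ω] [SecondCountableTopology Ω] [MeasurableSpace Ω]
  [OpensMeasurableSpace Ω]

section Smooth

variable {E V : Type} [NormedAddCommGroup E] [NormedSpace ℝ E] [NormedAddCommGroup V]
  [NormedSpace ℝ V] [NormedSpace ℂ V] [SMulCommClass ℝ ℂ V]

lemma SchwartzMap.seminorm_fderivCLM (k l : ℕ) (f : 𝓢(E, V)) :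
    SchwartzMap.seminorm ℝ k l (fderivCLM ℝ E V f) ≤ SchwartzMap.seminorm ℝ k (l + 1) f := by
  refine SchwartzMap.seminorm_le_bound ℝ k l _ (apply_nonneg _ _) fun x => ?_
  have : (fderivCLM ℝ E V f : E → E →L[ℝ] V) = fderiv ℝ f := rfl
  rw [this, norm_iteratedFDeriv_fderiv]
  exact SchwartzMap.le_seminorm ℝ k (l + 1) f x

lemma integrable_smul_apply {μ : Measure Ω} {c : Ω → ℂ} {κ : Ω → 𝓢(E, V)}
    (hc : AEStronglyMeasurable c μ) (hκ : Continuous κ)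
    (hi : ∀ k l, Integrable (fun t => ‖c t‖ * SchwartzMap.seminorm ℝ k l (κ t)) μ) (x : E) :
    Integrable (fun t => c t • κ t x) μ := by
  have hev : Continuous fun f : 𝓢(E, V) => f x :=
    ((BoundedContinuousFunction.evalCLM ℝ x).continuous.comp
      (toBoundedContinuousFunctionCLM ℝ E V).continuous)
  refine (hi 0 0).mono' (hc.smul (hev.comp hκ).aestronglyMeasurable)
    (Filter.Eventually.of_forall fun t => ?_)
  rw [norm_smul]
  gcongr
  exact SchwartzMap.norm_le_seminorm ℝ _ _

lemma integrable_seminorm_fderivCLM {μ : Measure Ω} {c : Ω → ℂ} {κ : Ω → 𝓢(E, V)}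
    (hc : AEStronglyMeasurable c μ) (hκ : Continuous κ)
    (hi : ∀ k l, Integrable (fun t => ‖c t‖ * SchwartzMap.seminorm ℝ k l (κ t)) μ) (k l : ℕ) :
    Integrable (fun t => ‖c t‖ * SchwartzMap.seminorm ℝ k l (fderivCLM ℝ E V (κ t))) μ := by
  have hs : Continuous (SchwartzMap.seminorm ℝ k l : 𝓢(E, E →L[ℝ] V) → ℝ) :=
    (schwartz_withSeminorms ℝ E (E →L[ℝ] V)).continuous_seminorm (k, l)
  refine (hi k (l + 1)).mono' (hc.norm.mul
    (hs.comp ((fderivCLM ℝ E V).continuous.comp hκ)).aestronglyMeasurable)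
    (Filter.Eventually.of_forall fun t => ?_)
  rw [norm_mul, norm_norm, Real.norm_of_nonneg (apply_nonneg _ _)]
  gcongr
  exact seminorm_fderivCLM _ _ _

lemma hasFDerivAt_integral_smul_apply {μ : Measure Ω} {c : Ω → ℂ} {κ : Ω → 𝓢(E, V)}
    (hc : AEStronglyMeasurable c μ) (hκ : Continuous κ)
    (hi : ∀ k l, Integrable (fun t => ‖c t‖ * SchwartzMap.seminorm ℝ k l (κ t)) μ) (x : E) :
    HasFDerivAt (fun x => ∫ t, c t • κ t x ∂μ) (∫ t, c t • fderivCLM ℝ E V (κ t) x ∂μ) x := by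
  refine hasFDerivAt_integral_of_dominated_of_fderiv_le (𝕜 := ℝ) (μ := μ)
    (F := fun x t => c t • κ t x) (F' := fun x t => c t • fderivCLM ℝ E V (κ t) x)
    (x₀ := x) (s := Set.univ)
    (bound := fun t => ‖c t‖ * SchwartzMap.seminorm ℝ 0 0 (fderivCLM ℝ E V (κ t)))
    Filter.univ_mem
    (Filter.Eventually.of_forall fun y => (integrable_smul_apply hc hκ hi y).1)
    (integrable_smul_apply hc hκ hi x)
    (integrable_smul_apply hc ((fderivCLM ℝ E V).continuous.comp hκ)
      (integrable_seminorm_fderivCLM hc hκ hi) x).1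
    (Filter.Eventually.of_forall fun t y _ => ?_)
    (integrable_seminorm_fderivCLM hc hκ hi 0 0)
    (Filter.Eventually.of_forall fun t y _ => ((κ t).hasFDerivAt y).const_smul (c t))
  rw [norm_smul]
  gcongr
  exact SchwartzMap.norm_le_seminorm ℝ _ _

end Smooth

/-- The target space is quantified inside the induction, because each derivative replaces `V` by `E
→L[ℝ] V`. -/
lemma contDiff_integral_smul_apply {E : Type} [NormedAddCommGroup E] [NormedSpace ℝ E]
    {μ : Measure Ω} {c : Ω → ℂ} (hc : AEStronglyMeasurable c μ) (n : ℕ) :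
    ∀ {V : Type} [NormedAddCommGroup V] [NormedSpace ℝ V] [NormedSpace ℂ V] [SMulCommClass ℝ ℂ V]
      {κ : Ω → 𝓢(E, V)} (_ : Continuous κ)
      (_ : ∀ k l, Integrable (fun t => ‖c t‖ * SchwartzMap.seminorm ℝ k l (κ t)) μ),
      ContDiff ℝ n fun x => ∫ t, c t • κ t x ∂μ := by
  induction n with
  | zero =>
    intro V _ _ _ _ κ hκ hi
    exact contDiff_zero.2 (continuous_iff_continuousAt.2 fun x =>
      (hasFDerivAt_integral_smul_apply hc hκ hi x).continuousAt)
  | succ n ih =>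
    intro V _ _ _ _ κ hκ hi
    rw [show ((n + 1 : ℕ) : ℕ∞ω) = (n : ℕ∞ω) + 1 by norm_cast, contDiff_succ_iff_fderiv]
    refine ⟨fun x => (hasFDerivAt_integral_smul_apply hc hκ hi x).differentiableAt,
      fun h => absurd h (by simp), ?_⟩
    rw [funext fun x => (hasFDerivAt_integral_smul_apply hc hκ hi x).fderiv]
    exact ih ((fderivCLM ℝ E V).continuous.comp hκ) (integrable_seminorm_fderivCLM hc hκ hi)

lemma norm_iteratedFDeriv_integral_le {E : Type} [NormedAddCommGroup E] [NormedSpace ℝ E]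
    {μ : Measure Ω} {c : Ω → ℂ} (hc : AEStronglyMeasurable c μ) (k l : ℕ) :
    ∀ {V : Type} [NormedAddCommGroup V] [NormedSpace ℝ V] [NormedSpace ℂ V] [SMulCommClass ℝ ℂ V]
      {κ : Ω → 𝓢(E, V)} (_ : Continuous κ)
      (_ : ∀ k l, Integrable (fun t => ‖c t‖ * SchwartzMap.seminorm ℝ k l (κ t)) μ) (x : E),
      ‖x‖ ^ k * ‖iteratedFDeriv ℝ l (fun x => ∫ t, c t • κ t x ∂μ) x‖
        ≤ ∫ t, ‖c t‖ * SchwartzMap.seminorm ℝ k l (κ t) ∂μ := by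
  induction l with
  | zero =>
    intro V _ _ _ _ κ hκ hi x
    rw [norm_iteratedFDeriv_zero]
    calc ‖x‖ ^ k * ‖∫ t, c t • κ t x ∂μ‖ ≤ ‖x‖ ^ k * ∫ t, ‖c t • κ t x‖ ∂μ := by
          gcongr
          exact norm_integral_le_integral_norm _
      _ = ∫ t, ‖x‖ ^ k * ‖c t • κ t x‖ ∂μ := (integral_const_mul _ _).symm
      _ ≤ _ := by
          refine integral_mono ((integrable_smul_apply hc hκ hi x).norm.const_mul _) (hi k 0)
            fun t => ?_
          dsimp only
          rw [norm_smul, mul_left_comm]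
          gcongr
          exact SchwartzMap.norm_pow_mul_le_seminorm ℝ _ _ _
  | succ l ih =>
    intro V _ _ _ _ κ hκ hi x
    rw [← norm_iteratedFDeriv_fderiv,
      funext fun x => (hasFDerivAt_integral_smul_apply hc hκ hi x).fderiv]
    refine (ih ((fderivCLM ℝ E V).continuous.comp hκ)
      (integrable_seminorm_fderivCLM hc hκ hi) x).trans ?_
    refine integral_mono (integrable_seminorm_fderivCLM hc hκ hi k l) (hi k (l + 1)) fun t => ?_
    dsimp only
    gcongr
    exact seminorm_fderivCLM _ _ _

/-- The integral `∫ c(t) κ_t dμ(t)` as a Schwartz function. -/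
noncomputable def weakIntegral {E : Type} [NormedAddCommGroup E] [NormedSpace ℝ E]
    (μ : Measure Ω) {c : Ω → ℂ} {κ : Ω → 𝓢(E, ℂ)}
    (hc : AEStronglyMeasurable c μ) (hκ : Continuous κ)
    (hi : ∀ k l, Integrable (fun t => ‖c t‖ * SchwartzMap.seminorm ℝ k l (κ t)) μ) : 𝓢(E, ℂ) where
  toFun := fun x => ∫ t, c t • κ t x ∂μ
  smooth' := contDiff_infty.2 fun n => contDiff_integral_smul_apply hc n hκ hi
  decay' := fun k l => ⟨_, norm_iteratedFDeriv_integral_le hc k l hκ hi⟩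

lemma weakIntegral_apply {E : Type} [NormedAddCommGroup E] [NormedSpace ℝ E]
    {μ : Measure Ω} {c : Ω → ℂ} {κ : Ω → 𝓢(E, ℂ)}
    (hc : AEStronglyMeasurable c μ) (hκ : Continuous κ)
    (hi : ∀ k l, Integrable (fun t => ‖c t‖ * SchwartzMap.seminorm ℝ k l (κ t)) μ) (x : E) :
    weakIntegral μ hc hκ hi x = ∫ t, c t * κ t x ∂μ := rfl

lemma SchwartzMap.continuous_lineDerivOp {E : Type} [NormedAddCommGroup E] [NormedSpace ℝ E]
    (v : E) : Continuous fun f : 𝓢(E, ℂ) => ∂_{v} f :=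
  (lineDerivOpCLM ℝ 𝓢(E, ℂ) v).continuous

lemma SchwartzMap.seminorm_lineDerivOp_le {E : Type} [NormedAddCommGroup E] [NormedSpace ℝ E]
    (k l : ℕ) (v : E) (f : 𝓢(E, ℂ)) :
    SchwartzMap.seminorm ℝ k l (∂_{v} f) ≤ ‖v‖ * SchwartzMap.seminorm ℝ k (l + 1) f := by
  refine SchwartzMap.seminorm_le_bound ℝ k l _ (by positivity) fun x => ?_
  have h1 : ((∂_{v} f : 𝓢(E, ℂ)) : E → ℂ) = fun x => fderiv ℝ f x v := rfl
  have h2 : ‖iteratedFDeriv ℝ l (fun x => fderiv ℝ f x v) x‖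
      ≤ ‖v‖ * ‖iteratedFDeriv ℝ l (fderiv ℝ f) x‖ := by
    have hcd : ContDiffAt ℝ l (fderiv ℝ f) x := 
      (((f.smooth ⊤).fderiv_right (m := l) (by exact_mod_cast le_top))).contDiffAt
    refine ((ContinuousLinearMap.apply ℝ ℂ v).norm_iteratedFDeriv_comp_left hcd le_rfl).trans ?_
    gcongr
    refine ContinuousLinearMap.opNorm_le_bound _ (norm_nonneg _) fun L => ?_
    rw [mul_comm]
    exact L.le_opNorm v
  rw [h1]
  calc _ ≤ ‖x‖ ^ k * (‖v‖ * ‖iteratedFDeriv ℝ l (fderiv ℝ f) x‖) := by gcongr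
    _ = ‖v‖ * (‖x‖ ^ k * ‖iteratedFDeriv ℝ (l + 1) f x‖) := by
        rw [norm_iteratedFDeriv_fderiv]; ring
    _ ≤ _ := by
        gcongr
        exact SchwartzMap.le_seminorm ℝ k (l + 1) f x

lemma integrable_seminorm_lineDerivOp {E : Type} [NormedAddCommGroup E] [NormedSpace ℝ E]
    {μ : Measure Ω} {c : Ω → ℂ} {κ : Ω → 𝓢(E, ℂ)}
    (hc : AEStronglyMeasurable c μ) (hκ : Continuous κ)
    (hi : ∀ k l, Integrable (fun t => ‖c t‖ * SchwartzMap.seminorm ℝ k l (κ t)) μ) (v : E)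
    (k l : ℕ) : Integrable (fun t => ‖c t‖ * SchwartzMap.seminorm ℝ k l (∂_{v} (κ t))) μ := by
  have hs : Continuous (SchwartzMap.seminorm ℝ k l : 𝓢(E, ℂ) → ℝ) :=
    (schwartz_withSeminorms ℝ E ℂ).continuous_seminorm (k, l)
  refine ((hi k (l + 1)).const_mul ‖v‖).mono' (hc.norm.mul
    (hs.comp ((continuous_lineDerivOp v).comp hκ)).aestronglyMeasurable)
    (Filter.Eventually.of_forall fun t => ?_)
  rw [norm_mul, norm_norm, Real.norm_of_nonneg (apply_nonneg _ _), mul_left_comm]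
  gcongr
  exact seminorm_lineDerivOp_le _ _ _ _

lemma lineDerivOp_weakIntegral {E : Type} [NormedAddCommGroup E] [NormedSpace ℝ E]
    {μ : Measure Ω} {c : Ω → ℂ} {κ : Ω → 𝓢(E, ℂ)}
    (hc : AEStronglyMeasurable c μ) (hκ : Continuous κ)
    (hi : ∀ k l, Integrable (fun t => ‖c t‖ * SchwartzMap.seminorm ℝ k l (κ t)) μ) (v : E) :
    ∂_{v} (weakIntegral μ hc hκ hi) = weakIntegral μ hc ((continuous_lineDerivOp v).comp hκ)
      (integrable_seminorm_lineDerivOp hc hκ hi v) := by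
  ext x
  have h := hasFDerivAt_integral_smul_apply hc hκ hi x
  have h1 : ∂_{v} (weakIntegral μ hc hκ hi) x
      = (∫ t, c t • fderivCLM ℝ E ℂ (κ t) x ∂μ) v := by
    rw [← h.fderiv]; rfl
  rw [h1]
  exact ContinuousLinearMap.integral_apply (integrable_smul_apply hc
    ((fderivCLM ℝ E ℂ).continuous.comp hκ) (integrable_seminorm_fderivCLM hc hκ hi) x) v

lemma iteratedLineDerivOp_weakIntegral {E : Type} [NormedAddCommGroup E] [NormedSpace ℝ E]
    {μ : Measure Ω} {c : Ω → ℂ} (hc : AEStronglyMeasurable c μ) {m : ℕ} :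
    ∀ {κ : Ω → 𝓢(E, ℂ)} (hκ : Continuous κ)
    (hi : ∀ k l, Integrable (fun t => ‖c t‖ * SchwartzMap.seminorm ℝ k l (κ t)) μ)
    (v : Fin m → E) (x : E), (∂^{v} (weakIntegral μ hc hκ hi)) x = ∫ t, c t * (∂^{v} (κ t)) x ∂μ := by
  induction m with
  | zero => intros; simp [weakIntegral_apply]
  | succ m ih =>
    intro κ hκ hi v x
    rw [iteratedLineDerivOp_succ_right, lineDerivOp_weakIntegral, ih]
    simp_rw [iteratedLineDerivOp_succ_right]
    rfl

lemma integrable_smul_weightedDerivCLM {d : ℕ} {μ : Measure Ω} {c : Ω → ℂ}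
    {κ : Ω → 𝓢(Rd d, ℂ)} (hc : AEStronglyMeasurable c μ) (hκ : Continuous κ)
    (hi : ∀ k l, Integrable (fun t => ‖c t‖ * SchwartzMap.seminorm ℝ k l (κ t)) μ)
    (k : ℕ) {l : ℕ} (a : Fin l → Fin d) :
    Integrable (fun t => c t • weightedDerivCLM k a (κ t)) μ := by
  refine (hi k l).mono' (hc.smul ((weightedDerivCLM k a).continuous.comp hκ).aestronglyMeasurable)
    (Filter.Eventually.of_forall fun t => ?_)
  rw [norm_smul]
  gcongr
  exact norm_weightedDerivCLM_le _ _ _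

lemma weightedDerivCLM_weakIntegral {d : ℕ} {μ : Measure Ω} {c : Ω → ℂ}
    {κ : Ω → 𝓢(Rd d, ℂ)} (hc : AEStronglyMeasurable c μ) (hκ : Continuous κ)
    (hi : ∀ k l, Integrable (fun t => ‖c t‖ * SchwartzMap.seminorm ℝ k l (κ t)) μ)
    (k : ℕ) {l : ℕ} (a : Fin l → Fin d) :
    weightedDerivCLM k a (weakIntegral μ hc hκ hi)
      = ∫ t, c t • weightedDerivCLM k a (κ t) ∂μ := by
  ext x
  have h1 := (BoundedContinuousFunction.evalCLM ℂ x : (Rd d →ᵇ ℂ) →L[ℂ] ℂ).integral_comp_comm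
    (integrable_smul_weightedDerivCLM hc hκ hi k a)
  refine Eq.trans ?_ h1
  rw [weightedDerivCLM_apply, iteratedLineDerivOp_weakIntegral, ← integral_smul]
  refine integral_congr_ae (Filter.Eventually.of_forall fun t => ?_)
  exact (mul_smul_comm _ _ _).symm

/-- After factorization, `T` is a finite sum of bounded functionals composed with weighted
derivatives. These derivatives turn the weak integral into a Bochner integral in a Banach space,
which commutes with bounded functionals. -/
lemma TemperedDistribution.apply_weakIntegral {d : ℕ} {μ : Measure Ω} {c : Ω → ℂ}
    {κ : Ω → 𝓢(Rd d, ℂ)} (hc : AEStronglyMeasurable c μ) (hκ : Continuous κ)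
    (hi : ∀ k l, Integrable (fun t => ‖c t‖ * SchwartzMap.seminorm ℝ k l (κ t)) μ)
    (T : 𝓢'(Rd d, ℂ)) : T (weakIntegral μ hc hκ hi) = ∫ t, c t * T (κ t) ∂μ := by
  obtain ⟨ι, _, k, l, a, Λ, hΛ⟩ := T.exists_factorization
  simp_rw [hΛ, Finset.mul_sum]
  rw [integral_finsetSum _ fun i _ => ?_]
  · refine Finset.sum_congr rfl fun i _ => ?_
    rw [weightedDerivCLM_weakIntegral,
      ← (Λ i).integral_comp_comm (integrable_smul_weightedDerivCLM hc hκ hi _ _)]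
    simp
  · simpa using (Λ i).integrable_comp (integrable_smul_weightedDerivCLM hc hκ hi (k i) (a i))

end WeakIntegral

/-! ### Continuity of families of Schwartz functions -/

/-- A local bound on the seminorm with one more power of the weight makes the tails uniformly small,
and on a large ball compactness upgrades joint continuity to uniform convergence. -/
lemma SchwartzMap.continuous_of_locally_bounded {X E : Type*} [TopologicalSpace X]
    [NormedAddCommGroup E] [NormedSpace ℝ E] [ProperSpace E] {f : X → 𝓢(E, ℂ)}
    (hf : ∀ l, Continuous fun z : X × E => iteratedFDeriv ℝ l (f z.1) z.2)
    (hb : ∀ k l x₀, ∃ C, ∀ᶠ x in nhds x₀, SchwartzMap.seminorm ℝ k l (f x) ≤ C) :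
    Continuous f := by
  refine continuous_iff_continuousAt.2 fun x₀ => ?_
  refine ((schwartz_withSeminorms ℝ E ℂ).tendsto_nhds f (f x₀)).2 fun ⟨k, l⟩ ε hε => ?_
  rw [schwartzSeminormFamily_apply]
  obtain ⟨C, hC⟩ := hb (k + 1) l x₀
  have hC0 : 0 ≤ C := (apply_nonneg _ _).trans hC.self_of_nhds
  -- The radius satisfies `R * (ε / 2) > 2 * C`, where `2 * C` bounds the difference weighted with
  -- the power `k + 1`. Outside the ball the power `k` therefore leaves less than `ε / 2`.
  set R : ℝ := 4 * C / ε + 1 with hR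
  have hRpos : 0 < R := by positivity
  have hev : ∀ᶠ x in nhds x₀, ∀ u ∈ Metric.closedBall (0 : E) R,
      ‖u‖ ^ k * ‖iteratedFDeriv ℝ l (f x) u - iteratedFDeriv ℝ l (f x₀) u‖ < ε / 2 := by
    refine (isCompact_closedBall (0 : E) R).eventually_forall_of_forall_eventually fun u _ => ?_
    have hc : Continuous fun z : X × E =>
        ‖z.2‖ ^ k * ‖iteratedFDeriv ℝ l (f z.1) z.2 - iteratedFDeriv ℝ l (f x₀) z.2‖ :=
      (continuous_snd.norm.pow k).mul ((hf l).sub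
        ((hf l).comp (continuous_const.prodMk continuous_snd))).norm
    exact hc.continuousAt.eventually (gt_mem_nhds (by simpa using half_pos hε))
  filter_upwards [hC, hev] with x hx hxe
  refine lt_of_le_of_lt (SchwartzMap.seminorm_le_bound ℝ k l _ (half_pos hε).le fun u => ?_)
    (half_lt_self hε)
  have hsub : iteratedFDeriv ℝ l (f x - f x₀) u
      = iteratedFDeriv ℝ l (f x) u - iteratedFDeriv ℝ l (f x₀) u :=
    iteratedFDeriv_sub_apply (((f x).smooth ⊤).contDiffAt.of_le (mod_cast le_top))
      (((f x₀).smooth ⊤).contDiffAt.of_le (mod_cast le_top))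
  rw [hsub]
  by_cases hu : ‖u‖ ≤ R
  · exact (hxe u (by simpa using hu)).le
  · push Not at hu
    have h1 := SchwartzMap.le_seminorm ℝ (k + 1) l (f x) u
    have h2 := SchwartzMap.le_seminorm ℝ (k + 1) l (f x₀) u
    have h3 : ‖u‖ * (‖u‖ ^ k * ‖iteratedFDeriv ℝ l (f x) u - iteratedFDeriv ℝ l (f x₀) u‖)
        ≤ 2 * C := by
      calc _ = ‖u‖ ^ (k + 1) * ‖iteratedFDeriv ℝ l (f x) u - iteratedFDeriv ℝ l (f x₀) u‖ := by
            ring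
        _ ≤ ‖u‖ ^ (k + 1) * (‖iteratedFDeriv ℝ l (f x) u‖ + ‖iteratedFDeriv ℝ l (f x₀) u‖) := by
            gcongr; exact norm_sub_le _ _
        _ ≤ 2 * C := by
            rw [mul_add, two_mul]
            exact add_le_add (h1.trans hx) (h2.trans hC.self_of_nhds)
    by_contra hcon
    push Not at hcon
    have h4 : R * (ε / 2) ≤ 2 * C := by
      refine le_trans ?_ h3
      gcongr
    rw [hR] at h4
    have h5 : (4 * C / ε + 1) * (ε / 2) = 2 * C + ε / 2 := by field_simp; ring
    linarith

lemma SchwartzMap.iteratedFDeriv_of_affine {d : ℕ} {F φ : 𝓢(Rd d, ℂ)} {c a : ℝ} {x : Rd d}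
    (h : ∀ u, F u = c • φ (a • (x - u))) (l : ℕ) (u : Rd d) :
    iteratedFDeriv ℝ l F u = c • ((-a) ^ l • iteratedFDeriv ℝ l φ (a • (x - u))) := by
  have h1 : (F : Rd d → ℂ) = c • fun u => (fun w => φ ((-a) • w)) (u - x) := by
    ext u
    simp only [Pi.smul_apply]
    rw [h, neg_smul, ← smul_neg, neg_sub]
  have hcd : ContDiff ℝ l fun w => φ ((-a) • w) :=
    (φ.smooth l).comp (contDiff_const_smul (-a))
  have hcd' : ContDiffAt ℝ l (fun u => (fun w => φ ((-a) • w)) (u - x)) u :=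
    (hcd.comp (contDiff_id.sub contDiff_const)).contDiffAt
  rw [h1, iteratedFDeriv_const_smul_apply hcd',
    show _ = _ from iteratedFDeriv_comp_sub (f := fun w => φ ((-a) • w)) l x u,
    iteratedFDeriv_comp_const_smul _ (φ.smooth l)]
  dsimp only
  rw [show (-a) • (u - x) = a • (x - u) by rw [neg_smul, ← smul_neg, neg_sub]]

/-- This covers all reflected, translated and dilated kernels at once, with `c = z^{-d}` and `a =
z^{-1}`. The explicit growth in `a` and `x` is what vanishing moments and decay of the averages have
to absorb later. The assumption `1 ≤ a` enters through `‖x - u‖ ≤ ‖a • (x - u)‖`. -/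
lemma SchwartzMap.exists_seminorm_le_of_affine {d : ℕ} (φ : 𝓢(Rd d, ℂ)) (k l : ℕ) :
    ∃ Q : ℝ, 0 ≤ Q ∧ ∀ (F : 𝓢(Rd d, ℂ)) (c a : ℝ) (x : Rd d), 0 ≤ c → 1 ≤ a →
      (∀ u, F u = c • φ (a • (x - u))) →
      SchwartzMap.seminorm ℝ k l F ≤ Q * (c * a ^ l * (1 + ‖x‖) ^ k) := by
  refine ⟨2 ^ k * ((Finset.Iic (k, l)).sup fun m => SchwartzMap.seminorm ℝ m.1 m.2) φ,
    by positivity, fun F c a x hc ha hF => ?_⟩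
  set Q := 2 ^ k * ((Finset.Iic (k, l)).sup fun m => SchwartzMap.seminorm ℝ m.1 m.2) φ
  have hQ0 : 0 ≤ Q := by positivity
  refine SchwartzMap.seminorm_le_bound ℝ k l F (by positivity) fun u => ?_
  rw [iteratedFDeriv_of_affine hF, norm_smul, norm_smul, Real.norm_of_nonneg hc, norm_pow,
    norm_neg, Real.norm_of_nonneg (by linarith : (0 : ℝ) ≤ a)]
  have hw := SchwartzMap.one_add_le_sup_seminorm_apply (𝕜 := ℝ) (m := (k, l)) (k := k) (n := l)
    le_rfl le_rfl φ (a • (x - u))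
  have hu : ‖u‖ ≤ (1 + ‖x‖) * (1 + ‖a • (x - u)‖) := by
    have h1 : ‖x - u‖ ≤ ‖a • (x - u)‖ := by
      rw [norm_smul, Real.norm_of_nonneg (by linarith)]
      nlinarith [norm_nonneg (x - u)]
    have h2 : ‖u‖ ≤ ‖x‖ + ‖x - u‖ := by
      calc ‖u‖ = ‖x - (x - u)‖ := by rw [sub_sub_cancel]
        _ ≤ _ := norm_sub_le _ _
    nlinarith [norm_nonneg x, norm_nonneg (a • (x - u)), mul_nonneg (norm_nonneg x) (norm_nonneg (a • (x - u)))]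
  calc ‖u‖ ^ k * (c * (a ^ l * ‖iteratedFDeriv ℝ l φ (a • (x - u))‖))
      ≤ ((1 + ‖x‖) * (1 + ‖a • (x - u)‖)) ^ k
          * (c * (a ^ l * ‖iteratedFDeriv ℝ l φ (a • (x - u))‖)) := by gcongr
    _ = ((1 + ‖a • (x - u)‖) ^ k * ‖iteratedFDeriv ℝ l φ (a • (x - u))‖)
          * (c * a ^ l * (1 + ‖x‖) ^ k) := by rw [mul_pow]; ring
    _ ≤ Q * (c * a ^ l * (1 + ‖x‖) ^ k) := by gcongr

lemma SchwartzMap.continuous_of_affine {d : ℕ} {X : Type*} [TopologicalSpace X] (φ : 𝓢(Rd d, ℂ))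
    {f : X → 𝓢(Rd d, ℂ)} {c a : X → ℝ} {x : X → Rd d} (hc : Continuous c) (ha : Continuous a)
    (hx : Continuous x) (hc0 : ∀ t, 0 ≤ c t) (ha1 : ∀ t, 1 ≤ a t)
    (hf : ∀ t u, f t u = c t • φ (a t • (x t - u))) : Continuous f := by
  refine continuous_of_locally_bounded (fun l => ?_) fun k l t₀ => ?_
  · simp_rw [iteratedFDeriv_of_affine (hf _)]
    have hφ := (φ.smooth ⊤).continuous_iteratedFDeriv (m := l) (mod_cast le_top)
    exact (hc.comp continuous_fst).smul (((ha.comp continuous_fst).neg.pow l).smul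
      (hφ.comp ((ha.comp continuous_fst).smul ((hx.comp continuous_fst).sub continuous_snd))))
  · obtain ⟨Q, -, hQ⟩ := exists_seminorm_le_of_affine φ k l
    have hcont : Continuous fun t => Q * (c t * a t ^ l * (1 + ‖x t‖) ^ k) := by fun_prop
    refine ⟨Q * (c t₀ * a t₀ ^ l * (1 + ‖x t₀‖) ^ k) + 1, ?_⟩
    filter_upwards [hcont.continuousAt.eventually (gt_mem_nhds (lt_add_one _))] with t ht
    exact (hQ (f t) (c t) (a t) (x t) (hc0 t) (ha1 t) (hf t)).trans ht.le

lemma continuous_reflectTranslate {d : ℕ} (φ : 𝓢(Rd d, ℂ)) :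
    Continuous fun x : Rd d => reflectTranslate x φ :=
  SchwartzMap.continuous_of_affine φ (c := fun _ => 1) (a := fun _ => 1) continuous_const
    continuous_const continuous_id (fun _ => zero_le_one) (fun _ => le_rfl)
    (fun x u => by simp [reflectTranslate_apply])

lemma reflectTranslate_dilate_apply {d : ℕ} (φ : 𝓢(Rd d, ℂ)) (z : Param) (x u : Rd d) :
    reflectTranslate x (dilate z φ) u = ((z : ℝ) ^ d)⁻¹ • φ ((z : ℝ)⁻¹ • (x - u)) := by
  rw [reflectTranslate_apply, dilate_apply]

lemma one_le_inv_param (z : Param) : 1 ≤ (z : ℝ)⁻¹ :=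
  (one_le_inv₀ z.2.1).2 z.2.2.le

lemma continuous_reflectTranslate_dilate {d : ℕ} (φ : 𝓢(Rd d, ℂ)) :
    Continuous fun z : Param × Rd d => reflectTranslate z.2 (dilate z.1 φ) := by
  have hc : Continuous fun z : Param × Rd d => ((z.1 : ℝ))⁻¹ :=
    (continuous_subtype_val.comp continuous_fst).inv₀ fun z => z.1.2.1.ne'
  refine SchwartzMap.continuous_of_affine φ (c := fun z => ((z.1 : ℝ) ^ d)⁻¹)
    (a := fun z => (z.1 : ℝ)⁻¹) ?_ hc continuous_snd
    (fun z => by have := z.1.2.1; positivity) (fun z => one_le_inv_param z.1)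
    (fun z u => reflectTranslate_dilate_apply φ z.1 z.2 u)
  exact (hc.pow d).congr fun z => by simp

/-! ### Convolution of a tempered distribution with a Schwartz function -/

lemma continuous_conv {d : ℕ} (T : 𝓢'(Rd d, ℂ)) (φ : 𝓢(Rd d, ℂ)) : Continuous (conv T φ) :=
  T.continuous.comp (continuous_reflectTranslate φ)

lemma continuous_conv_dilate {d : ℕ} (T : 𝓢'(Rd d, ℂ)) (φ : 𝓢(Rd d, ℂ)) :
    Continuous fun z : Param × Rd d => conv T (dilate z.1 φ) z.2 :=
  T.continuous.comp (continuous_reflectTranslate_dilate φ)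

lemma conv_sum_smul {d : ℕ} {ι : Type*} (T : 𝓢'(Rd d, ℂ)) (s : Finset ι) (c : ι → ℝ)
    (φ : ι → 𝓢(Rd d, ℂ)) (x : Rd d) :
    conv T (∑ i ∈ s, c i • φ i) x = ∑ i ∈ s, c i • conv T (φ i) x := by
  have h : reflectTranslate x (∑ i ∈ s, c i • φ i)
      = ∑ i ∈ s, (c i : ℂ) • reflectTranslate x (φ i) := by
    ext u
    simp [reflectTranslate_apply]
  rw [conv, h, map_sum]
  refine Finset.sum_congr rfl fun i _ => ?_
  rw [map_smul, conv, smul_eq_mul, Complex.real_smul]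

lemma conv_smul {d : ℕ} (T : 𝓢'(Rd d, ℂ)) (c : ℝ) (φ : 𝓢(Rd d, ℂ)) :
    conv T (c • φ) = c • conv T φ := by
  ext x
  simpa using conv_sum_smul T {()} (fun _ => c) (fun _ => φ) x

lemma lineDerivOp_eq_sum_stdVec {d : ℕ} (h : Rd d) (φ : 𝓢(Rd d, ℂ)) :
    ∂_{h} φ = ∑ i, h i • ∂_{(stdVec i : Rd d)} φ := by
  conv_lhs => rw [← sum_smul_stdVec h]
  rw [lineDerivOp_left_sum]
  refine Finset.sum_congr rfl fun i _ => ?_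
  rw [lineDerivOp_left_smul]

/-- The fundamental theorem of calculus for the kernel is an identity between Schwartz functions,
with a weak integral on one side. Applying `T` to it gives the formula. -/
lemma conv_add_sub_conv {d : ℕ} (T : 𝓢'(Rd d, ℂ)) (φ : 𝓢(Rd d, ℂ)) (x h : Rd d) :
    conv T φ (x + h) - conv T φ x = ∫ t in (0 : ℝ)..1, conv T (∂_{h} φ) (x + t • h) := by
  have hκ : Continuous fun t : ℝ => reflectTranslate (x + t • h) (∂_{h} φ) :=
    (continuous_reflectTranslate (∂_{h} φ)).comp (by fun_prop)
  have hi : ∀ k l, Integrable (fun t : ℝ => ‖(1 : ℂ)‖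
      * SchwartzMap.seminorm ℝ k l (reflectTranslate (x + t • h) (∂_{h} φ)))
      (volume.restrict (Set.Ioc 0 1)) := fun k l => by
    have hs : Continuous (SchwartzMap.seminorm ℝ k l : 𝓢(Rd d, ℂ) → ℝ) :=
      (schwartz_withSeminorms ℝ (Rd d) ℂ).continuous_seminorm (k, l)
    have : Continuous fun t : ℝ => ‖(1 : ℂ)‖
      * SchwartzMap.seminorm ℝ k l (reflectTranslate (x + t • h) (∂_{h} φ)) :=
      continuous_const.mul (hs.comp hκ)
    exact this.integrableOn_Ioc
  have key : weakIntegral (volume.restrict (Set.Ioc (0 : ℝ) 1))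
      (aestronglyMeasurable_const (b := (1 : ℂ))) hκ hi
      = reflectTranslate (x + h) φ - reflectTranslate x φ := by
    ext u
    rw [weakIntegral_apply, _root_.sub_apply, reflectTranslate_apply, reflectTranslate_apply,
      ← intervalIntegral.integral_of_le zero_le_one]
    have hd : ∀ t ∈ Set.uIcc (0 : ℝ) 1, HasDerivAt (fun t : ℝ => φ (x + t • h - u))
        (1 * reflectTranslate (x + t • h) (∂_{h} φ) u) t := fun t _ => by
      rw [one_mul, reflectTranslate_apply]
      have h1 : HasDerivAt (fun t : ℝ => x + t • h - u) h t := by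
        simpa using (((hasDerivAt_id t).smul_const h).const_add x).sub_const u
      exact (φ.hasFDerivAt (x + t • h - u)).comp_hasDerivAt t h1
    rw [intervalIntegral.integral_eq_sub_of_hasDerivAt hd]
    · simp
    · refine Continuous.intervalIntegrable ?_ _ _
      simp_rw [one_mul, reflectTranslate_apply]
      exact (∂_{h} φ).continuous.comp (by fun_prop)
  have h1 := T.apply_weakIntegral (aestronglyMeasurable_const (b := (1 : ℂ))) hκ hi
  rw [key, map_sub] at h1
  rw [intervalIntegral.integral_of_le zero_le_one]
  simpa [conv] using h1

/-- By `conv_add_sub_conv` the linearization error is an average of increments of `conv T (∂_{h}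
φ)`. This is linear in `h`, so continuity of the `d` partial derivatives suffices. -/
lemma hasFDerivAt_conv {d : ℕ} (T : 𝓢'(Rd d, ℂ)) (φ : 𝓢(Rd d, ℂ)) (x : Rd d) :
    HasFDerivAt (conv T φ)
      (∑ i, (EuclideanSpace.proj i : Rd d →L[ℝ] ℝ).smulRight (conv T (∂_{(stdVec i : Rd d)} φ) x))
      x := by
  have hlin : ∀ h y : Rd d, conv T (∂_{h} φ) y = ∑ i, h i • conv T (∂_{(stdVec i : Rd d)} φ) y :=
    fun h y => by rw [lineDerivOp_eq_sum_stdVec, conv_sum_smul]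
  rw [hasFDerivAt_iff_isLittleO_nhds_zero, Asymptotics.isLittleO_iff]
  intro c hc
  -- The `d` components add up to at most `d / (d + 1)` times `c ‖h‖`; the summand `1` keeps the
  -- denominator positive when `d = 0`.
  have hev : ∀ᶠ w in nhds (0 : Rd d), ∀ i, ‖conv T (∂_{(stdVec i : Rd d)} φ) (x + w)
      - conv T (∂_{(stdVec i : Rd d)} φ) x‖ < c / (d + 1) := by
    refine Filter.eventually_all.2 fun i => ?_
    have hcont : Continuous fun w => ‖conv T (∂_{(stdVec i : Rd d)} φ) (x + w)
      - conv T (∂_{(stdVec i : Rd d)} φ) x‖ :=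
      (((continuous_conv T _).comp (by fun_prop)).sub continuous_const).norm
    refine hcont.continuousAt.eventually (gt_mem_nhds ?_)
    simp only [add_zero, sub_self, norm_zero]
    positivity
  obtain ⟨δ, hδ, hball⟩ := Metric.eventually_nhds_iff.1 hev
  filter_upwards [Metric.ball_mem_nhds (0 : Rd d) hδ] with h hh
  rw [mem_ball_zero_iff] at hh
  have e : conv T φ (x + h) - conv T φ x
      - (∑ i, (EuclideanSpace.proj i : Rd d →L[ℝ] ℝ).smulRight
          (conv T (∂_{(stdVec i : Rd d)} φ) x)) h
      = ∫ t in (0 : ℝ)..1, (conv T (∂_{h} φ) (x + t • h) - conv T (∂_{h} φ) x) := by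
    rw [conv_add_sub_conv, intervalIntegral.integral_sub]
    · simp only [intervalIntegral.integral_const, sub_zero, one_smul]
      rw [hlin h x, _root_.sum_apply]
      rfl
    · exact ((continuous_conv T _).comp (by fun_prop)).intervalIntegrable _ _
    · exact continuous_const.intervalIntegrable _ _
  rw [e]
  have hb := intervalIntegral.norm_integral_le_of_norm_le_const (a := (0 : ℝ)) (b := 1)
    (C := c * ‖h‖) (f := fun t : ℝ => conv T (∂_{h} φ) (x + t • h) - conv T (∂_{h} φ) x) ?_
  · simpa using hb
  intro t ht
  rw [Set.uIoc_of_le zero_le_one] at ht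
  rw [hlin, hlin, ← Finset.sum_sub_distrib]
  have hth : ‖t • h‖ < δ := by
    rw [norm_smul, Real.norm_of_nonneg ht.1.le]
    nlinarith [norm_nonneg h, ht.1, ht.2]
  have hb := hball (y := t • h) (by simpa using hth)
  calc ‖∑ i, (h i • conv T (∂_{(stdVec i : Rd d)} φ) (x + t • h)
        - h i • conv T (∂_{(stdVec i : Rd d)} φ) x)‖
      ≤ ∑ _i : Fin d, ‖h‖ * (c / (d + 1)) := by
        refine (norm_sum_le _ _).trans (Finset.sum_le_sum fun i _ => ?_)
        rw [← smul_sub, norm_smul]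
        gcongr
        · exact PiLp.norm_apply_le h i
        · exact (hb i).le
    _ = d / (d + 1) * (c * ‖h‖) := by simp; ring
    _ ≤ 1 * (c * ‖h‖) := by
        gcongr
        rw [div_le_one (by positivity)]
        linarith
    _ = c * ‖h‖ := one_mul _

lemma contDiff_conv {d : ℕ} (T : 𝓢'(Rd d, ℂ)) (φ : 𝓢(Rd d, ℂ)) : ContDiff ℝ ∞ (conv T φ) := by
  refine contDiff_infty.2 fun n => ?_
  induction n generalizing φ with
  | zero => exact contDiff_zero.2 (continuous_conv T φ)
  | succ n ih =>
    rw [show ((n + 1 : ℕ) : ℕ∞ω) = (n : ℕ∞ω) + 1 by norm_cast, contDiff_succ_iff_fderiv]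
    refine ⟨fun x => (hasFDerivAt_conv T φ x).differentiableAt, fun h => absurd h (by simp), ?_⟩
    rw [funext fun x => (hasFDerivAt_conv T φ x).fderiv]
    exact ContDiff.sum fun i _ => contDiff_const.smulRight (ih _)

lemma fderiv_conv_apply {d : ℕ} (T : 𝓢'(Rd d, ℂ)) (φ : 𝓢(Rd d, ℂ)) (x v : Rd d) :
    fderiv ℝ (conv T φ) x v = conv T (∂_{v} φ) x := by
  rw [(hasFDerivAt_conv T φ x).fderiv, lineDerivOp_eq_sum_stdVec, conv_sum_smul,
    _root_.sum_apply]
  rfl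

lemma iteratedFDeriv_conv_apply {d m : ℕ} (T : 𝓢'(Rd d, ℂ)) (φ : 𝓢(Rd d, ℂ)) (x : Rd d)
    (v : Fin m → Rd d) : iteratedFDeriv ℝ m (conv T φ) x v = conv T (∂^{v} φ) x := by
  induction m generalizing x with
  | zero => simp
  | succ n ih =>
    rw [iteratedLineDerivOp_succ_left, iteratedFDeriv_succ_apply_left,
      ← fderiv_continuousMultilinear_apply_const_apply]
    · rw [show (fun y => iteratedFDeriv ℝ n (conv T φ) y (Fin.tail v))
        = conv T (∂^{Fin.tail v} φ) from funext fun y => ih y _, fderiv_conv_apply]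
    · exact (contDiff_conv T φ).differentiable_iteratedFDeriv
        (mod_cast ENat.natCast_lt_top n) x

lemma lineDerivOp_dilate {d : ℕ} (ε : Param) (φ : 𝓢(Rd d, ℂ)) (v : Rd d) :
    ∂_{v} (dilate ε φ) = (ε : ℝ)⁻¹ • dilate ε (∂_{v} φ) := by
  ext x
  have h1 : HasFDerivAt (fun x => φ ((ε : ℝ)⁻¹ • x))
      ((fderiv ℝ φ ((ε : ℝ)⁻¹ • x)).comp ((ε : ℝ)⁻¹ • ContinuousLinearMap.id ℝ (Rd d))) x :=
    (φ.hasFDerivAt _).comp x ((hasFDerivAt_id x).const_smul (ε : ℝ)⁻¹)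
  have h2 : fderiv ℝ (fun x => (((ε : ℝ) ^ d)⁻¹ : ℝ) • φ ((ε : ℝ)⁻¹ • x)) x = _ :=
    (h1.const_smul (((ε : ℝ) ^ d)⁻¹ : ℝ)).fderiv
  have h3 : ∂_{v} (dilate ε φ) x
      = fderiv ℝ (fun x => (((ε : ℝ) ^ d)⁻¹ : ℝ) • φ ((ε : ℝ)⁻¹ • x)) x v := rfl
  rw [h3, h2]
  simp [dilate_apply, SchwartzMap.lineDerivOp_apply_eq_fderiv]
  ring

lemma iteratedLineDerivOp_dilate {d m : ℕ} (ε : Param) (φ : 𝓢(Rd d, ℂ)) (v : Fin m → Rd d) :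
    ∂^{v} (dilate ε φ) = ((ε : ℝ)⁻¹) ^ m • dilate ε (∂^{v} φ) := by
  induction m with
  | zero => simp
  | succ m ih =>
    rw [iteratedLineDerivOp_succ_left, ih, iteratedLineDerivOp_succ_left, lineDerivOp_smul,
      lineDerivOp_dilate, smul_smul, pow_succ]

/-- Each derivative costs one factor `ε⁻¹` and turns the mollifier into a kernel with one more
vanishing moment. This links Sobolev bounds on the net with Littlewood–Paley bounds on `T`. -/
lemma iteratedFDeriv_mollify {d m : ℕ} (T : 𝓢'(Rd d, ℂ)) (φ : 𝓢(Rd d, ℂ)) (ε : Param) (x : Rd d)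
    (v : Fin m → Rd d) : iteratedFDeriv ℝ m (mollify φ T ε) x v
      = ((ε : ℝ)⁻¹) ^ m • conv T (dilate ε (∂^{v} φ)) x := by
  rw [mollify, iteratedFDeriv_conv_apply, iteratedLineDerivOp_dilate, conv_smul]
  rfl

lemma isContNet_mollify {d : ℕ} (φ : 𝓢(Rd d, ℂ)) (T : 𝓢'(Rd d, ℂ)) :
    IsContNet (mollify φ T) := by
  refine ⟨fun ε => contDiff_conv T _, fun m => ?_⟩
  refine ContinuousMultilinearMap.continuous_of_stdVec fun a => ?_
  simp_rw [iteratedFDeriv_mollify]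
  have hc : Continuous fun z : Param × Rd d => ((z.1 : ℝ))⁻¹ :=
    (continuous_subtype_val.comp continuous_fst).inv₀ fun z => z.1.2.1.ne'
  exact (hc.pow m).smul (continuous_conv_dilate T _)

/-! ### Vanishing moments -/

/-- Multiplication by the coordinate `x i`. -/
noncomputable def coordMul {d : ℕ} (i : Fin d) : 𝓢(Rd d, ℂ) →L[ℝ] 𝓢(Rd d, ℂ) :=
  SchwartzMap.smulLeftCLM ℂ fun x : Rd d => (inner ℝ x (stdVec i) : ℝ)

lemma inner_stdVec {d : ℕ} (x : Rd d) (i : Fin d) : (inner ℝ x (stdVec i) : ℝ) = x i := by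
  simp [stdVec, EuclideanSpace.inner_single_right]

lemma hasTemperateGrowth_inner_stdVec {d : ℕ} (i : Fin d) :
    (fun x : Rd d => (inner ℝ x (stdVec i) : ℝ)).HasTemperateGrowth :=
  ((innerSL ℝ).flip (stdVec i : Rd d)).hasTemperateGrowth

lemma coordMul_apply {d : ℕ} (i : Fin d) (κ : 𝓢(Rd d, ℂ)) (x : Rd d) :
    coordMul i κ x = x i • κ x := by
  rw [coordMul, SchwartzMap.smulLeftCLM_apply_apply (hasTemperateGrowth_inner_stdVec i),
    inner_stdVec]

/-- All moments of `κ` of order less than `M` vanish. -/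
def VanishMoments {d : ℕ} : ℕ → 𝓢(Rd d, ℂ) → Prop
  | 0, _ => True
  | M + 1, κ => ∫ x, κ x = 0 ∧ ∀ i, VanishMoments M (coordMul i κ)

/-- Multiplying by `x i` raises one exponent by one, so moments of `κ` of order below `M + 1`
control those of `x i • κ` below `M`. The recursive form of `VanishMoments` matches a Taylor
expansion carried out one order at a time. -/
lemma VanishMoments.of_moment {d M : ℕ} {κ : 𝓢(Rd d, ℂ)}
    (h : ∀ α : Fin d → ℕ, ∑ i, α i < M → moment α κ = 0) : VanishMoments M κ := by
  induction M generalizing κ with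
  | zero => trivial
  | succ M ih =>
    refine ⟨?_, fun i => ih fun α hα => ?_⟩
    · have := h 0 (by simp)
      simpa [moment] using this
    · have h1 := h (α + Pi.single i 1) (by
        simp only [Pi.add_apply, Finset.sum_add_distrib, Finset.sum_pi_single', Finset.mem_univ,
          if_true]
        omega)
      rw [← h1, moment, moment]
      refine integral_congr_ae (Filter.Eventually.of_forall fun x => ?_)
      simp only [coordMul_apply, Pi.add_apply, pow_add, Finset.prod_mul_distrib]
      have : ∏ j, x j ^ (Pi.single i 1 : Fin d → ℕ) j = x i := by
        rw [Finset.prod_eq_single i]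
        · simp
        · intro j _ hj; simp [hj]
        · simp
      rw [this, Complex.real_smul]
      push_cast
      ring

lemma VanishMoments.sub {d M : ℕ} {κ κ' : 𝓢(Rd d, ℂ)} (h : VanishMoments M κ)
    (h' : VanishMoments M κ') : VanishMoments M (κ - κ') := by
  induction M generalizing κ κ' with
  | zero => trivial
  | succ M ih =>
    refine ⟨?_, fun i => ?_⟩
    · simp only [_root_.sub_apply]
      rw [integral_sub κ.integrable κ'.integrable, h.1, h'.1, sub_zero]
    · rw [map_sub]; exact ih (h.2 i) (h'.2 i)

lemma VanishMoments.smul {d M : ℕ} {κ : 𝓢(Rd d, ℂ)} (h : VanishMoments M κ) (c : ℝ) :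
    VanishMoments M (c • κ) := by
  induction M generalizing κ with
  | zero => trivial
  | succ M ih =>
    refine ⟨?_, fun i => ?_⟩
    · simp only [_root_.smul_apply]
      rw [integral_smul, h.1, smul_zero]
    · rw [map_smul]; exact ih (h.2 i)

lemma integral_lineDerivOp {d : ℕ} (κ : 𝓢(Rd d, ℂ)) (v : Rd d) : ∫ x, (∂_{v} κ) x = 0 := by
  have h1 : 𝓕 (∂_{v} κ) 0 = ∫ x, (∂_{v} κ) x := by
    rw [SchwartzMap.fourier_coe, Real.fourier_eq]
    simp
  have h2 := congrArg (fun f : 𝓢(Rd d, ℂ) => f 0) (SchwartzMap.fourier_lineDerivOp_eq κ v)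
  rw [← h1]
  refine h2.trans ?_
  rw [_root_.smul_apply, SchwartzMap.smulLeftCLM_apply_apply (by fun_prop)]
  simp

lemma coordMul_lineDerivOp {d : ℕ} (κ : 𝓢(Rd d, ℂ)) (i : Fin d) (v : Rd d) :
    coordMul i (∂_{v} κ) = ∂_{v} (coordMul i κ) - v i • κ := by
  ext x
  have h1 : (coordMul i κ : Rd d → ℂ) = fun x => x i • κ x := funext fun x => coordMul_apply i κ x
  have hp : HasFDerivAt (fun x : Rd d => x i) (EuclideanSpace.proj i : Rd d →L[ℝ] ℝ) x :=
    (EuclideanSpace.proj i : Rd d →L[ℝ] ℝ).hasFDerivAt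
  have h2 := (hp.smul (κ.hasFDerivAt x)).fderiv
  have h3 : (∂_{v} (coordMul i κ)) x = fderiv ℝ (fun x => x i • κ x) x v := by
    rw [lineDerivOp_apply_eq_fderiv, h1]
  rw [_root_.sub_apply, h3, coordMul_apply, lineDerivOp_apply_eq_fderiv]
  have h4 : fderiv ℝ (fun x : Rd d => x i • κ x) x = _ := h2
  rw [h4]
  simp

/-- The Leibniz rule `x_i ∂_v κ = ∂_v (x_i κ) - v_i κ` reduces moments of `∂_v κ` to the induction
hypothesis for `x_i κ` and to the moments of `κ` itself. -/
lemma VanishMoments.lineDerivOp {d M : ℕ} {κ : 𝓢(Rd d, ℂ)} (h : VanishMoments M κ) (v : Rd d) :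
    VanishMoments (M + 1) (∂_{v} κ) := by
  induction M generalizing κ with
  | zero => exact ⟨integral_lineDerivOp κ v, fun _ => trivial⟩
  | succ M ih =>
    refine ⟨integral_lineDerivOp κ v, fun i => ?_⟩
    rw [coordMul_lineDerivOp]
    exact (ih (h.2 i)).sub (h.smul _)

lemma VanishMoments.iteratedLineDerivOp {d m : ℕ} (κ : 𝓢(Rd d, ℂ)) (v : Fin m → Rd d) :
    VanishMoments m (∂^{v} κ) := by
  induction m with
  | zero => trivial
  | succ m ih =>
    rw [iteratedLineDerivOp_succ_left]
    exact (ih _).lineDerivOp _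

/-- Multiplication by a coordinate becomes, up to a nonzero constant, a derivative of the Fourier
transform, which again vanishes on the open set `U`. -/
lemma VanishMoments.of_fourier {d : ℕ} (M : ℕ) {κ : 𝓢(Rd d, ℂ)} {U : Set (Rd d)} (hU : IsOpen U)
    (h0 : (0 : Rd d) ∈ U) (h : ∀ ξ ∈ U, 𝓕 κ ξ = 0) : VanishMoments M κ := by
  induction M generalizing κ with
  | zero => trivial
  | succ M ih =>
    refine ⟨?_, fun i => ih fun ξ hξ => ?_⟩
    · have := h 0 h0
      rw [SchwartzMap.fourier_coe, Real.fourier_eq] at this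
      simpa using this
    · have h1 := SchwartzMap.lineDerivOp_fourier_eq κ (stdVec i : Rd d)
      have h2 : (∂_{(stdVec i : Rd d)} (𝓕 κ)) ξ = 0 := by
        rw [lineDerivOp_apply_eq_fderiv]
        have : (𝓕 κ : 𝓢(Rd d, ℂ)) =ᶠ[nhds ξ] fun _ => (0 : ℂ) := by
          filter_upwards [hU.mem_nhds hξ] with y hy using h y hy
        rw [this.fderiv_eq]
        simp
      have h3 : 𝓕 (-(2 * Real.pi * Complex.I) • coordMul i κ)
          = -(2 * Real.pi * Complex.I) • 𝓕 (coordMul i κ) := FourierTransform.fourier_smul _ _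
      have h4 : ∂_{(stdVec i : Rd d)} (𝓕 κ) = 𝓕 (-(2 * Real.pi * Complex.I) • coordMul i κ) := h1
      rw [h4, h3, _root_.smul_apply, smul_eq_zero] at h2
      refine h2.resolve_left ?_
      simp [Real.pi_ne_zero]

/-! ### Averages of a Schwartz function against a kernel -/

/-- The convolution `x ↦ ∫ χ(x - ρ v) κ(v) dv`. -/
noncomputable def avg {d : ℕ} (χ κ : 𝓢(Rd d, ℂ)) (ρ : ℝ) (x : Rd d) : ℂ :=
  ∫ v, χ (x - ρ • v) * κ v

lemma measurable_avg {d : ℕ} (χ κ : 𝓢(Rd d, ℂ)) :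
    Measurable fun z : ℝ × Rd d => avg χ κ z.1 z.2 := by
  have hc : Continuous fun y : (ℝ × Rd d) × Rd d => χ (y.1.2 - y.1.1 • y.2) * κ y.2 :=
    (χ.continuous.comp (by fun_prop)).mul (κ.continuous.comp continuous_snd)
  exact hc.stronglyMeasurable.integral_prod_right.measurable

lemma sub_eq_integral_lineDerivOp {d : ℕ} (χ : 𝓢(Rd d, ℂ)) (ρ : ℝ) (x v : Rd d) :
    χ (x - ρ • v) - χ x = ∑ i, (-ρ) • ∫ t in Set.Ioc (0 : ℝ) 1,
      (∂_{(stdVec i : Rd d)} χ) (x - (t * ρ) • v) * (v i : ℂ) := by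
  have hcont : ∀ w : Rd d, Continuous fun t : ℝ => (∂_{w} χ) (x - (t * ρ) • v) :=
    fun w => (SchwartzMap.continuous _).comp (by fun_prop)
  have hd : ∀ t ∈ Set.uIcc (0 : ℝ) 1, HasDerivAt (fun t : ℝ => χ (x - (t * ρ) • v))
      ((-ρ) • (∂_{v} χ) (x - (t * ρ) • v)) t := fun t _ => by
    have h1 : HasDerivAt (fun t : ℝ => x - (t * ρ) • v) ((-ρ) • v) t := by
      have := (((hasDerivAt_id t).mul_const ρ).smul_const v).const_sub x
      simpa using this
    have h2 := (χ.hasFDerivAt (x - (t * ρ) • v)).comp_hasDerivAt t h1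
    rw [map_smul, ← lineDerivOp_apply_eq_fderiv] at h2
    exact h2
  have h3 := intervalIntegral.integral_eq_sub_of_hasDerivAt hd
    (Continuous.intervalIntegrable ((hcont v).const_smul (-ρ)) _ _)
  simp only [one_mul, zero_mul, zero_smul, sub_zero] at h3
  rw [← h3, intervalIntegral.integral_of_le zero_le_one, integral_smul, ← Finset.smul_sum,
    ← integral_finsetSum]
  · congr 1
    refine integral_congr_ae (Filter.Eventually.of_forall fun t => ?_)
    simp only [lineDerivOp_eq_sum_stdVec v χ, _root_.sum_apply, _root_.smul_apply,
      Complex.real_smul]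
    exact Finset.sum_congr rfl fun i _ => mul_comm _ _
  · exact fun i _ => ((hcont (stdVec i)).mul continuous_const).integrableOn_Ioc

lemma integrable_mul_avg_kernel {d : ℕ} (χ κ : 𝓢(Rd d, ℂ)) (ρ : ℝ) (x : Rd d) :
    Integrable (fun y : Rd d × ℝ => χ (x - (y.2 * ρ) • y.1) * κ y.1)
      (volume.prod (volume.restrict (Set.Ioc (0 : ℝ) 1))) := by
  refine Integrable.bdd_mul (c := SchwartzMap.seminorm ℝ 0 0 χ)
    (κ.integrable.comp_fst _) ?_ ?_
  · exact (χ.continuous.comp (by fun_prop)).aestronglyMeasurable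
  · exact Filter.Eventually.of_forall fun y => SchwartzMap.norm_le_seminorm ℝ _ _

lemma integrable_avg_kernel {d : ℕ} (χ κ : 𝓢(Rd d, ℂ)) (ρ : ℝ) (x : Rd d) :
    Integrable fun v => χ (x - ρ • v) * κ v :=
  Integrable.bdd_mul (c := SchwartzMap.seminorm ℝ 0 0 χ) κ.integrable
    (χ.continuous.comp (by fun_prop)).aestronglyMeasurable
    (Filter.Eventually.of_forall fun y => SchwartzMap.norm_le_seminorm ℝ _ _)

/-- As `κ` has integral zero, `χ x` may be subtracted from `χ (x - ρ • v)`. The mean value formula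
then produces one factor `ρ`, one derivative on `χ` and one coordinate on `κ`. -/
lemma avg_eq_integral_lineDerivOp {d : ℕ} (χ κ : 𝓢(Rd d, ℂ)) (hκ : ∫ v, κ v = 0) (ρ : ℝ)
    (x : Rd d) : avg χ κ ρ x = ∑ i, (-ρ) • ∫ t in Set.Ioc (0 : ℝ) 1,
      avg (∂_{(stdVec i : Rd d)} χ) (coordMul i κ) (t * ρ) x := by
  have hint := fun i => integrable_mul_avg_kernel (∂_{(stdVec i : Rd d)} χ) (coordMul i κ) ρ x
  have hpt : ∀ v, (χ (x - ρ • v) - χ x) * κ v = ∑ i, (-ρ) • ∫ t in Set.Ioc (0 : ℝ) 1,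
      (∂_{(stdVec i : Rd d)} χ) (x - (t * ρ) • v) * coordMul i κ v := by
    intro v
    rw [sub_eq_integral_lineDerivOp, Finset.sum_mul]
    refine Finset.sum_congr rfl fun i _ => ?_
    rw [smul_mul_assoc, ← integral_mul_const]
    congr 1
    refine integral_congr_ae (Filter.Eventually.of_forall fun t => ?_)
    simp only [coordMul_apply, Complex.real_smul, mul_assoc]
  have h0 : avg χ κ ρ x = ∫ v, (χ (x - ρ • v) - χ x) * κ v := by
    simp_rw [sub_mul]
    rw [integral_sub (integrable_avg_kernel χ κ ρ x) (κ.integrable.const_mul _),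
      integral_const_mul, hκ, mul_zero, sub_zero]
    rfl
  rw [h0]
  simp_rw [hpt]
  rw [integral_finsetSum _ fun i _ => ((hint i).integral_prod_left).fun_smul (-ρ)]
  refine Finset.sum_congr rfl fun i _ => ?_
  rw [integral_smul, integral_integral_swap (hint i)]
  rfl

lemma lintegral_weight_mul_lt_top {d : ℕ} (k : ℕ) (κ : 𝓢(Rd d, ℂ)) :
    ∫⁻ v, ‖(1 + ‖v‖) ^ k • κ v‖ₑ < ⊤ := by
  have hi : Integrable (fun v : Rd d => (1 + ‖v‖) ^ k • κ v) volume := by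
    have h1 : (fun v : Rd d => (1 + ‖v‖) ^ k • κ v)
        = fun v => ∑ j ∈ Finset.range (k + 1), (k.choose j : ℝ) • (‖v‖ ^ j • κ v) := by
      ext v
      rw [add_comm, add_pow, Finset.sum_smul]
      refine Finset.sum_congr rfl fun j _ => ?_
      rw [smul_smul]
      congr 1
      ring
    rw [h1]
    refine integrable_finsetSum _ fun j _ => Integrable.fun_smul _ ?_
    refine (κ.integrable_pow_mul volume j).mono'
      ((continuous_norm.pow j).smul κ.continuous).aestronglyMeasurable
      (Filter.Eventually.of_forall fun v => ?_)
    rw [norm_smul, norm_pow, norm_norm]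
  exact hi.2

/-- Minkowski's inequality, together with the submultiplicativity `1 + ‖x‖ ≤ (1 + ‖x - ρ • v‖) (1 +
‖v‖)` for `|ρ| ≤ 1`, which splits the weight between `χ` and `κ`. -/
lemma eLpNorm_weight_avg_le {d : ℕ} (k : ℕ) (χ κ : 𝓢(Rd d, ℂ)) {p : ℝ≥0∞} (hp : 1 ≤ p) {ρ : ℝ}
    (hρ : |ρ| ≤ 1) : eLpNorm (fun x => (1 + ‖x‖) ^ k • avg χ κ ρ x) p volume
      ≤ (∫⁻ v, ‖(1 + ‖v‖) ^ k • κ v‖ₑ) * eLpNorm (fun x => (1 + ‖x‖) ^ k • χ x) p volume := by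
  have hw : ∀ x v : Rd d, 1 + ‖x‖ ≤ (1 + ‖x - ρ • v‖) * (1 + ‖v‖) := fun x v => by
    have h1 : ‖ρ • v‖ ≤ ‖v‖ := by
      rw [norm_smul, Real.norm_eq_abs]
      exact mul_le_of_le_one_left (norm_nonneg _) hρ
    have h2 : ‖x‖ ≤ ‖x - ρ • v‖ + ‖ρ • v‖ := by
      simpa using norm_add_le (x - ρ • v) (ρ • v)
    nlinarith [norm_nonneg (x - ρ • v), norm_nonneg v,
      mul_nonneg (norm_nonneg (x - ρ • v)) (norm_nonneg v)]
  have hsm : ∀ x, (1 + ‖x‖) ^ k • avg χ κ ρ x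
      = ∫ v, (1 + ‖x‖) ^ k • (χ (x - ρ • v) * κ v) := fun x => by rw [integral_smul]; rfl
  simp_rw [hsm]
  refine (eLpNorm_integral_le hp volume volume (F := fun v x =>
    (1 + ‖x‖) ^ k • (χ (x - ρ • v) * κ v)) ?_).trans ?_
  · have hw' : Continuous fun z : Rd d × Rd d => (1 + ‖z.2‖) ^ k := by fun_prop
    have hc : Continuous fun z : Rd d × Rd d =>
        (1 + ‖z.2‖) ^ k • (χ (z.2 - ρ • z.1) * κ z.1) :=
      hw'.smul ((χ.continuous.comp (by fun_prop)).mul (κ.continuous.comp continuous_fst))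
    exact hc.measurable.enorm
  have hw' : Continuous fun x : Rd d => (1 + ‖x‖) ^ k := by fun_prop
  have hcχ : Continuous fun x : Rd d => (1 + ‖x‖) ^ k • χ x := hw'.smul χ.continuous
  have hcκ : Continuous fun x : Rd d => (1 + ‖x‖) ^ k • κ x := hw'.smul κ.continuous
  rw [← lintegral_mul_const _ hcκ.measurable.enorm]
  refine lintegral_mono fun v => ?_
  have htr : eLpNorm (fun x => (1 + ‖x - ρ • v‖) ^ k • χ (x - ρ • v)) p volume
      = eLpNorm (fun x => (1 + ‖x‖) ^ k • χ x) p volume := by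
    exact eLpNorm_comp_measurePreserving (f := fun x : Rd d => x - ρ • v)
      (g := fun x : Rd d => (1 + ‖x‖) ^ k • χ x) hcχ.aestronglyMeasurable
      (measurePreserving_sub_right volume (ρ • v))
  rw [← htr, ← enorm_norm, ← eLpNorm_const_smul]
  refine eLpNorm_mono fun x => ?_
  have hpow : (1 + ‖x‖) ^ k ≤ (1 + ‖x - ρ • v‖) ^ k * (1 + ‖v‖) ^ k := by
    rw [← mul_pow]
    exact pow_le_pow_left₀ (by positivity) (hw x v) k
  have e : ∀ y : Rd d, ‖(1 + ‖y‖) ^ k‖ = (1 + ‖y‖) ^ k := fun y =>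
    Real.norm_of_nonneg (by positivity)
  simp only [norm_smul, norm_mul, Pi.smul_apply, norm_norm, e]
  calc (1 + ‖x‖) ^ k * (‖χ (x - ρ • v)‖ * ‖κ v‖)
      ≤ ((1 + ‖x - ρ • v‖) ^ k * (1 + ‖v‖) ^ k) * (‖χ (x - ρ • v)‖ * ‖κ v‖) := by gcongr
    _ = _ := by ring

/-- The derivative `∂_{a 0} ⋯ ∂_{a (m-1)} χ`. -/
noncomputable abbrev derivWord {d m : ℕ} (a : Fin m → Fin d) (χ : 𝓢(Rd d, ℂ)) : 𝓢(Rd d, ℂ) :=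
  ∂^{fun j => (stdVec (a j) : Rd d)} χ

lemma derivWord_snoc {d m : ℕ} (a : Fin m → Fin d) (i : Fin d) (χ : 𝓢(Rd d, ℂ)) :
    derivWord (Fin.snoc a i : Fin (m + 1) → Fin d) χ = derivWord a (∂_{(stdVec i : Rd d)} χ) := by
  rw [derivWord, iteratedLineDerivOp_succ_right, Fin.snoc_last]
  congr 1
  ext j : 1
  simp only [Fin.init, Fin.snoc_castSucc]

/-- The weighted `L^p`-norm `‖(1 + |x|)^k f‖_{L^p}`. -/
noncomputable def wNorm {d : ℕ} (k : ℕ) (p : ℝ≥0∞) (f : Rd d → ℂ) : ℝ≥0∞ :=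
  eLpNorm (fun x => (1 + ‖x‖) ^ k • f x) p volume

/-- The basic gain: `M` vanishing moments yield `|ρ|^M` at the price of `M` derivatives on `χ`. Each
induction step uses `avg_eq_integral_lineDerivOp` once; the scales `t * ρ` that arise do not exceed
`|ρ|` in modulus. The constant is uniform in `χ`, `p` and `ρ`. Positive `k` with `p = 1` serves to
integrate families of Schwartz functions, and `k = 0` serves the `L^p` estimates. -/
lemma wNorm_avg_le {d : ℕ} (k : ℕ) (M : ℕ) {κ : 𝓢(Rd d, ℂ)} (hκ : VanishMoments M κ) :
    ∃ C : ℝ≥0∞, C ≠ ⊤ ∧ ∀ (χ : 𝓢(Rd d, ℂ)) (p : ℝ≥0∞) (ρ : ℝ), 1 ≤ p → |ρ| ≤ 1 →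
      wNorm k p (avg χ κ ρ) ≤ C * ‖ρ‖ₑ ^ M *
        ⨆ a : Fin M → Fin d, wNorm k p (derivWord a χ) := by
  induction M generalizing κ with
  | zero =>
    refine ⟨_, (lintegral_weight_mul_lt_top k κ).ne, fun χ p ρ hp hρ => ?_⟩
    refine (eLpNorm_weight_avg_le k χ κ hp hρ).trans ?_
    rw [pow_zero, mul_one]
    gcongr
    exact le_iSup (fun a : Fin 0 → Fin d =>
      wNorm k p (derivWord a χ)) Fin.elim0
  | succ M ih =>
    choose C hC hb using fun i => ih (hκ.2 i)
    refine ⟨∑ i, C i, (ENNReal.sum_lt_top.2 fun i _ => (hC i).lt_top).ne,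
      fun χ p ρ hp hρ => ?_⟩
    set S := ⨆ a : Fin (M + 1) → Fin d, wNorm k p (derivWord a χ) with hS
    have hw' : Continuous fun x : Rd d => (1 + ‖x‖) ^ k := by fun_prop
    have hsup : ∀ i, (⨆ a : Fin M → Fin d, wNorm k p
        (derivWord a (∂_{(stdVec i : Rd d)} χ))) ≤ S := by
      refine fun i => iSup_le fun a => ?_
      have h1 := le_iSup (fun a : Fin (M + 1) → Fin d =>
        wNorm k p (derivWord a χ)) (Fin.snoc a i)
      rwa [derivWord_snoc] at h1
    have hm : ∀ i, Measurable fun z : ℝ × Rd d => (1 + ‖z.2‖) ^ k •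
        avg (∂_{(stdVec i : Rd d)} χ) (coordMul i κ) (z.1 * ρ) z.2 := fun i =>
      (hw'.measurable.comp measurable_snd).smul ((measurable_avg _ _).comp
        ((measurable_fst.mul_const ρ).prodMk measurable_snd))
    have hterm : ∀ i, eLpNorm (fun x => ∫ t in Set.Ioc (0 : ℝ) 1, (1 + ‖x‖) ^ k •
        avg (∂_{(stdVec i : Rd d)} χ) (coordMul i κ) (t * ρ) x) p volume
        ≤ C i * ‖ρ‖ₑ ^ M * S := fun i => by
      refine (eLpNorm_integral_le hp _ volume (F := fun t x => (1 + ‖x‖) ^ k •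
        avg (∂_{(stdVec i : Rd d)} χ) (coordMul i κ) (t * ρ) x) (hm i).enorm).trans ?_
      calc _ ≤ ∫⁻ t in Set.Ioc (0 : ℝ) 1, C i * ‖ρ‖ₑ ^ M * S := by
            refine setLIntegral_mono' measurableSet_Ioc fun t ht => ?_
            have ht' : |t| ≤ 1 := abs_le.2 ⟨by linarith [ht.1], ht.2⟩
            have htρ : |t * ρ| ≤ |ρ| := by
              rw [abs_mul]; exact mul_le_of_le_one_left (abs_nonneg _) ht'
            refine (hb i _ p (t * ρ) hp (htρ.trans hρ)).trans ?_
            have : ‖t * ρ‖ₑ ≤ ‖ρ‖ₑ := by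
              exact enorm_le_iff_norm_le.2 htρ
            gcongr
            exact hsup i
        _ = _ := by simp
    have heq : (fun x => (1 + ‖x‖) ^ k • avg χ κ ρ x) = ∑ i, (-ρ) • fun x =>
        ∫ t in Set.Ioc (0 : ℝ) 1, (1 + ‖x‖) ^ k •
        avg (∂_{(stdVec i : Rd d)} χ) (coordMul i κ) (t * ρ) x := by
      ext x
      rw [avg_eq_integral_lineDerivOp χ κ hκ.1, Finset.sum_apply, Finset.smul_sum]
      refine Finset.sum_congr rfl fun i _ => ?_
      rw [Pi.smul_apply, integral_smul, smul_comm]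
    have hms : ∀ i, AEStronglyMeasurable ((-ρ) • fun x =>
        ∫ t in Set.Ioc (0 : ℝ) 1, (1 + ‖x‖) ^ k •
        avg (∂_{(stdVec i : Rd d)} χ) (coordMul i κ) (t * ρ) x) volume := fun i =>
      (StronglyMeasurable.integral_prod_left' (f := fun z : ℝ × Rd d => (1 + ‖z.2‖) ^ k •
        avg (∂_{(stdVec i : Rd d)} χ) (coordMul i κ) (z.1 * ρ) z.2) (hm i).stronglyMeasurable
        (μ := volume.restrict (Set.Ioc (0 : ℝ) 1))).aestronglyMeasurable.const_smul _
    unfold wNorm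
    rw [heq]
    refine (eLpNorm_sum_le (fun i _ => hms i) hp).trans ?_
    rw [Finset.sum_mul, Finset.sum_mul]
    refine Finset.sum_le_sum fun i _ => ?_
    rw [eLpNorm_const_smul, enorm_neg]
    refine (mul_le_mul' le_rfl (hterm i)).trans (le_of_eq ?_)
    ring

/-! ### The measure `dε/ε` -/

/-- The measure `dε/ε` on `(0,1)`. -/
noncomputable def parMeas : Measure Param :=
  (Measure.comap Subtype.val volume).withDensity fun ε => ENNReal.ofReal ((ε : ℝ)⁻¹)

instance : SigmaFinite (Measure.comap (Subtype.val : Param → ℝ) volume) := by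
  refine SigmaFinite.of_map _ measurable_subtype_coe.aemeasurable ?_
  rw [(MeasurableEmbedding.subtype_coe measurableSet_Ioo).map_comap]
  infer_instance

instance : SigmaFinite parMeas :=
  SigmaFinite.withDensity_ofReal fun ε : Param => (ε : ℝ)⁻¹

lemma lintegral_parMeas_eq (F : Param → ℝ≥0∞) : ∫⁻ ε, F ε ∂parMeas
    = ∫⁻ ε, F ε * ENNReal.ofReal ((ε : ℝ)⁻¹) ∂(Measure.comap Subtype.val volume) := by
  rw [parMeas, lintegral_withDensity_eq_lintegral_mul_non_measurable _ (by fun_prop)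
    (Filter.Eventually.of_forall fun _ => ENNReal.ofReal_lt_top)]
  exact lintegral_congr fun ε => mul_comm _ _

lemma lintegral_parMeas (f : ℝ → ℝ≥0∞) : ∫⁻ ε : Param, f ε ∂parMeas
    = ∫⁻ x in Set.Ioo (0 : ℝ) 1, f x * ENNReal.ofReal x⁻¹ := by
  rw [lintegral_parMeas_eq]
  exact lintegral_subtype_comap measurableSet_Ioo (fun x => f x * ENNReal.ofReal x⁻¹)

lemma integral_parMeas (f : ℝ → ℂ) : ∫ ε : Param, f ε ∂parMeas
    = ∫ x in Set.Ioo (0 : ℝ) 1, x⁻¹ • f x := by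
  rw [parMeas, integral_withDensity_eq_integral_toReal_smul (by fun_prop)
    (Filter.Eventually.of_forall fun _ => ENNReal.ofReal_lt_top)]
  rw [← integral_subtype_comap measurableSet_Ioo (fun x : ℝ => x⁻¹ • f x)]
  refine integral_congr_ae (Filter.Eventually.of_forall fun ε => ?_)
  simp only
  rw [ENNReal.toReal_ofReal (inv_nonneg.2 ε.2.1.le)]

/-- Split at `z = y`: against `dz/z`, the function `(z/y)^δ` on `(0, y]` and the function `(y/z)^δ`
on `(y, ∞)` each integrate to `1/δ`. -/
lemma lintegral_min_rpow_le {δ : ℝ} (hδ : 0 < δ) (y : Param) :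
    ∫⁻ z : Param, ENNReal.ofReal (min ((y : ℝ) / z) (z / y) ^ δ) ∂parMeas
      ≤ ENNReal.ofReal (2 / δ) := by
  have hy : (0 : ℝ) < y := y.2.1
  rw [lintegral_parMeas (fun x => ENNReal.ofReal (min ((y : ℝ) / x) (x / y) ^ δ))]
  have h1 : ∫⁻ x in Set.Ioc (0 : ℝ) y, ENNReal.ofReal ((y : ℝ) ^ (-δ) * x ^ (δ - 1))
      = ENNReal.ofReal (1 / δ) := by
    rw [← ofReal_integral_eq_lintegral_ofReal]
    · congr 1
      rw [integral_const_mul, ← intervalIntegral.integral_of_le hy.le,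
        integral_rpow (Or.inl (by linarith))]
      simp only [sub_add_cancel]
      rw [Real.zero_rpow hδ.ne', sub_zero, mul_div_assoc', ← Real.rpow_add hy]
      simp
    · exact ((intervalIntegral.intervalIntegrable_rpow' (by linarith)).1).const_mul _
    · filter_upwards [ae_restrict_mem measurableSet_Ioc] with x hx
      exact mul_nonneg (Real.rpow_nonneg hy.le _) (Real.rpow_nonneg hx.1.le _)
  have h2 : ∫⁻ x in Set.Ioi (y : ℝ), ENNReal.ofReal ((y : ℝ) ^ δ * x ^ (-δ - 1))
      = ENNReal.ofReal (1 / δ) := by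
    rw [← ofReal_integral_eq_lintegral_ofReal]
    · congr 1
      rw [integral_const_mul, integral_Ioi_rpow_of_lt (by linarith) hy]
      simp only [sub_add_cancel]
      rw [neg_div_neg_eq, mul_div_assoc', ← Real.rpow_add hy]
      simp
    · exact (integrableOn_Ioi_rpow_of_lt (by linarith) hy).const_mul _
    · filter_upwards [ae_restrict_mem measurableSet_Ioi] with x hx
      exact mul_nonneg (Real.rpow_nonneg hy.le _) (Real.rpow_nonneg (hy.trans hx).le _)
  calc _ ≤ ∫⁻ x in Set.Ioc (0 : ℝ) y ∪ Set.Ioi (y : ℝ),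
          ENNReal.ofReal (min ((y : ℝ) / x) (x / y) ^ δ) * ENNReal.ofReal x⁻¹ := by
        refine lintegral_mono_set fun x hx => ?_
        rcases le_or_gt x y with h | h
        · exact Or.inl ⟨hx.1, h⟩
        · exact Or.inr h
    _ ≤ _ := lintegral_union_le _ _ _
    _ ≤ ENNReal.ofReal (1 / δ) + ENNReal.ofReal (1 / δ) := by
        rw [← h1]
        nth_rewrite 2 [h1]
        rw [← h2]
        refine add_le_add (setLIntegral_mono' measurableSet_Ioc fun x hx => ?_)
          (setLIntegral_mono' measurableSet_Ioi fun x hx => ?_)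
        · have hx0 : 0 < x := hx.1
          rw [← ENNReal.ofReal_mul (by positivity)]
          refine ENNReal.ofReal_le_ofReal ?_
          calc min ((y : ℝ) / x) (x / y) ^ δ * x⁻¹ ≤ (x / y) ^ δ * x⁻¹ := by
                gcongr
                exact min_le_right _ _
            _ = _ := by
                rw [Real.div_rpow hx0.le hy.le, Real.rpow_sub hx0, Real.rpow_one,
                  Real.rpow_neg hy.le]
                ring
        · have hx0 : 0 < x := hy.trans hx
          rw [← ENNReal.ofReal_mul (by positivity)]
          refine ENNReal.ofReal_le_ofReal ?_
          calc min ((y : ℝ) / x) (x / y) ^ δ * x⁻¹ ≤ (y / x) ^ δ * x⁻¹ := by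
                gcongr
                exact min_le_left _ _
            _ = _ := by
                rw [Real.div_rpow hy.le hx0.le, Real.rpow_sub hx0, Real.rpow_one,
                  Real.rpow_neg hx0.le]
                ring
    _ = _ := by
        rw [← ENNReal.ofReal_add (by positivity) (by positivity)]
        congr 1
        ring

lemma lintegral_rpow_parMeas_lt_top {a : ℝ} (ha : 0 < a) :
    ∫⁻ z : Param, ENNReal.ofReal ((z : ℝ) ^ a) ∂parMeas < ⊤ := by
  rw [lintegral_parMeas (fun x => ENNReal.ofReal (x ^ a))]
  have hi : IntegrableOn (fun x : ℝ => x ^ (a - 1)) (Set.Ioc 0 1) :=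
    (intervalIntegral.intervalIntegrable_rpow' (by linarith)).1
  refine lt_of_le_of_lt ((setLIntegral_mono' measurableSet_Ioo fun x hx => ?_).trans
    (lintegral_mono_set Set.Ioo_subset_Ioc_self)) hi.lintegral_lt_top
  rw [← ENNReal.ofReal_mul (Real.rpow_nonneg hx.1.le _), Real.rpow_sub hx.1, Real.rpow_one,
    div_eq_mul_inv]

/-! ### A smooth partition in the frequency variable -/

/-- A smooth function that vanishes on `(-∞, a]` and equals `1` on `[b, ∞)`. -/
noncomputable def smoothStep (a b t : ℝ) : ℝ := Real.smoothTransition ((t - a) / (b - a))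

lemma contDiff_smoothStep (a b : ℝ) : ContDiff ℝ ∞ (smoothStep a b) :=
  Real.smoothTransition.contDiff.comp ((contDiff_id.sub contDiff_const).div_const _)

lemma smoothStep_of_le {a b t : ℝ} (hab : a < b) (h : t ≤ a) : smoothStep a b t = 0 :=
  Real.smoothTransition.zero_of_nonpos (div_nonpos_of_nonpos_of_nonneg (by linarith) (by linarith))

lemma smoothStep_of_ge {a b t : ℝ} (hab : a < b) (h : b ≤ t) : smoothStep a b t = 1 :=
  Real.smoothTransition.one_of_one_le ((one_le_div (by linarith)).2 (by linarith))

lemma deriv_smoothStep_of_lt {a b t : ℝ} (hab : a < b) (h : t < a) :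
    deriv (smoothStep a b) t = 0 := by
  have : smoothStep a b =ᶠ[nhds t] fun _ => 0 := by
    filter_upwards [Iio_mem_nhds h] with s hs using smoothStep_of_le hab hs.le
  rw [this.deriv_eq, deriv_const]

lemma deriv_smoothStep_of_gt {a b t : ℝ} (hab : a < b) (h : b < t) :
    deriv (smoothStep a b) t = 0 := by
  have : smoothStep a b =ᶠ[nhds t] fun _ => 1 := by
    filter_upwards [Ioi_mem_nhds h] with s hs using smoothStep_of_ge hab hs.le
  rw [this.deriv_eq, deriv_const]

lemma contDiff_deriv_smoothStep (a b : ℝ) : ContDiff ℝ ∞ (deriv (smoothStep a b)) :=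
  (contDiff_infty_iff_deriv.1 (contDiff_smoothStep a b)).2

/-- The norm fails to be smooth only at the origin, where the composition is locally constant. -/
lemma contDiff_comp_norm {d : ℕ} {f : ℝ → ℂ} (hf : ContDiff ℝ ∞ f) {a : ℝ} (ha : 0 < a) {c : ℂ}
    (h : ∀ t < a, f t = c) : ContDiff ℝ ∞ fun ξ : Rd d => f ‖ξ‖ := by
  refine contDiff_iff_contDiffAt.2 fun ξ => ?_
  by_cases hξ : ξ = 0
  · refine (contDiffAt_const (c := c)).congr_of_eventuallyEq ?_
    filter_upwards [Metric.ball_mem_nhds ξ ha] with y hy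
    exact h _ (by simpa [hξ] using hy)
  · exact hf.contDiffAt.comp ξ (contDiffAt_norm ℝ hξ)

/-- The function `ξ ↦ |ξ| G'(|ξ|)` with `G = smoothStep a b`. -/
noncomputable def annulusBump {d : ℕ} (a b : ℝ) (ξ : Rd d) : ℂ :=
  ((‖ξ‖ * deriv (smoothStep a b) ‖ξ‖ : ℝ) : ℂ)

lemma contDiff_annulusBump {d : ℕ} {a b : ℝ} (ha : 0 < a) (hab : a < b) :
    ContDiff ℝ ∞ (annulusBump a b : Rd d → ℂ) := by
  refine contDiff_comp_norm (f := fun t => ((t * deriv (smoothStep a b) t : ℝ) : ℂ)) (c := 0) ?_ ha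
    fun t ht => ?_
  · exact Complex.ofRealCLM.contDiff.comp (contDiff_id.mul (contDiff_deriv_smoothStep a b))
  · simp [deriv_smoothStep_of_lt hab ht]

lemma annulusBump_of_lt {d : ℕ} {a b : ℝ} (hab : a < b) {ξ : Rd d} (h : ‖ξ‖ < a) :
    annulusBump a b ξ = 0 := by
  simp [annulusBump, deriv_smoothStep_of_lt hab h]

lemma annulusBump_of_gt {d : ℕ} {a b : ℝ} (hab : a < b) {ξ : Rd d} (h : b < ‖ξ‖) :
    annulusBump a b ξ = 0 := by
  simp [annulusBump, deriv_smoothStep_of_gt hab h]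

/-- The integrand `z⁻¹ (z‖ξ‖) G'(z‖ξ‖)` is the derivative of `G(z‖ξ‖)` in `z`, and `G(0) = 0`.
Integrating only over `z < 1` leaves the low-frequency remainder `1 - G(‖ξ‖)`, which the kernel `η`
has to cover. -/
lemma integral_annulusBump {d : ℕ} {a b : ℝ} (ha : 0 < a) (hab : a < b) (ξ : Rd d) :
    ∫ z : Param, annulusBump a b ((z : ℝ) • ξ) ∂parMeas = (smoothStep a b ‖ξ‖ : ℂ) := by
  rw [integral_parMeas (fun x => annulusBump a b (x • ξ)), ← integral_Ioc_eq_integral_Ioo,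
    ← intervalIntegral.integral_of_le zero_le_one]
  have hd : ∀ t ∈ Set.uIcc (0 : ℝ) 1, HasDerivAt (fun t : ℝ => smoothStep a b (t * ‖ξ‖))
      (deriv (smoothStep a b) (t * ‖ξ‖) * ‖ξ‖) t := fun t _ => by
    have h1 : HasDerivAt (fun t : ℝ => t * ‖ξ‖) ‖ξ‖ t := by
      simpa using (hasDerivAt_id t).mul_const ‖ξ‖
    exact (((contDiff_smoothStep a b).differentiable (by simp)).differentiableAt.hasDerivAt).comp
      t h1
  have h2 := intervalIntegral.integral_eq_sub_of_hasDerivAt hd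
    (Continuous.intervalIntegrable (((contDiff_deriv_smoothStep a b).continuous.comp
      (by fun_prop)).mul continuous_const) _ _)
  simp only [one_mul, zero_mul, smoothStep_of_le hab ha.le, sub_zero] at h2
  rw [← h2, ← intervalIntegral.integral_ofReal]
  rw [intervalIntegral.integral_of_le zero_le_one, intervalIntegral.integral_of_le zero_le_one]
  refine setIntegral_congr_fun measurableSet_Ioc fun t ht => ?_
  simp only [annulusBump, norm_smul, Real.norm_of_nonneg ht.1.le, Complex.real_smul]
  rw [← Complex.ofReal_mul]
  congr 1
  field_simp [ht.1.ne']

/-- Near a zero of `D` the numerator vanishes identically, and there the quotient is zero under the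
convention for division by zero. The quotient is thus smooth with compact support. -/
lemma exists_fourier_eq_div {d : ℕ} {h D : Rd d → ℂ} (hh : ContDiff ℝ ∞ h) (hD : ContDiff ℝ ∞ D)
    (hs : HasCompactSupport h) (h0 : ∀ ξ, D ξ = 0 → h =ᶠ[nhds ξ] 0) :
    ∃ Θ : 𝓢(Rd d, ℂ), ∀ ξ, 𝓕 Θ ξ = h ξ / D ξ := by
  have hc : ContDiff ℝ ∞ fun ξ => h ξ / D ξ := contDiff_iff_contDiffAt.2 fun ξ => by
    by_cases hξ : D ξ = 0
    · refine (contDiffAt_const (c := (0 : ℂ))).congr_of_eventuallyEq ?_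
      filter_upwards [h0 ξ hξ] with y hy
      simp [hy]
    · simp_rw [div_eq_mul_inv]
      exact hh.contDiffAt.mul (hD.contDiffAt.inv hξ)
  have hs' : HasCompactSupport fun ξ => h ξ / D ξ := by
    simp_rw [div_eq_mul_inv]
    exact hs.mul_right
  refine ⟨𝓕⁻ (hs'.toSchwartzMap hc), fun ξ => ?_⟩
  rw [FourierTransform.fourier_fourierInv_eq]
  rfl

/-- The Tauberian condition on a function `η` and a finite family `ψ i`: `η̂` does not vanish on
a ball, and the `ψ̂ i` have no common zero in a neighbourhood of its boundary. -/
def IsTauberian {d : ℕ} {ι : Type} (η : 𝓢(Rd d, ℂ)) (ψ : ι → 𝓢(Rd d, ℂ)) : Prop :=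
  ∃ a b : ℝ, 0 < a ∧ a < b ∧ (∀ ξ : Rd d, ‖ξ‖ ≤ b → 𝓕 η ξ ≠ 0) ∧
    ∀ ξ : Rd d, a ≤ ‖ξ‖ → ‖ξ‖ ≤ b → ∃ i, 𝓕 (ψ i) ξ ≠ 0

/-- With `G = smoothStep a b`, put `Λ̂(ξ) = (1 - G(‖ξ‖)) / η̂(-ξ)` and `Ψ̂_i(ξ) = ‖ξ‖ G'(‖ξ‖)
conj(ψ̂_i(-ξ)) / ∑_j |ψ̂_j(-ξ)|²`. The denominators are nonzero where the numerators live, by the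
Tauberian condition. All moments of `Ψ_i` vanish because `Ψ̂_i` is zero on a ball about the origin.
The argument `-ξ` appears because `T * ψ` pairs `T` with reflected kernels. -/
lemma IsTauberian.exists_dual {d : ℕ} {ι : Type} [Fintype ι] {η : 𝓢(Rd d, ℂ)}
    {ψ : ι → 𝓢(Rd d, ℂ)} (h : IsTauberian η ψ) :
    ∃ (a b : ℝ) (Λ : 𝓢(Rd d, ℂ)) (Ψ : ι → 𝓢(Rd d, ℂ)), 0 < a ∧ a < b ∧
      (∀ i M, VanishMoments M (Ψ i)) ∧
      (∀ ξ, 𝓕 η (-ξ) * 𝓕 Λ ξ = 1 - (smoothStep a b ‖ξ‖ : ℂ)) ∧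
      ∀ ξ, ∑ i, 𝓕 (ψ i) (-ξ) * 𝓕 (Ψ i) ξ = annulusBump a b ξ := by
  obtain ⟨a, b, ha, hab, hη, hψ⟩ := h
  have hcomp : ∀ f : Rd d → ℂ, (∀ ξ, b < ‖ξ‖ → f ξ = 0) → HasCompactSupport f := fun f hf =>
    HasCompactSupport.intro (isCompact_closedBall (0 : Rd d) b) fun ξ hξ => hf ξ (by simpa using hξ)
  have hneg : ∀ f : 𝓢(Rd d, ℂ), ContDiff ℝ ∞ fun ξ : Rd d => 𝓕 f (-ξ) := fun f =>
    ((𝓕 f).smooth ⊤).comp contDiff_neg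
  obtain ⟨Λ, hΛ⟩ := exists_fourier_eq_div (d := d) (h := fun ξ => 1 - (smoothStep a b ‖ξ‖ : ℂ))
    (D := fun ξ => 𝓕 η (-ξ))
    (contDiff_const.sub (contDiff_comp_norm (f := fun t => (smoothStep a b t : ℂ)) (c := 0)
      (Complex.ofRealCLM.contDiff.comp (contDiff_smoothStep a b)) ha fun t ht => by
        simp [smoothStep_of_le hab ht.le])) (hneg η)
    (hcomp _ fun ξ hξ => by simp [smoothStep_of_ge hab hξ.le])
    (fun ξ hξ => by
      have h1 : b < ‖ξ‖ := by
        by_contra! h2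
        exact hη (-ξ) (by simpa using h2) hξ
      filter_upwards [(isOpen_lt continuous_const continuous_norm).mem_nhds h1] with y hy
      simp [smoothStep_of_ge hab (le_of_lt hy)])
  have hD : ∀ ξ : Rd d, (∑ j, 𝓕 (ψ j) (-ξ) * (starRingEnd ℂ) (𝓕 (ψ j) (-ξ))) = 0 →
      ∀ j, 𝓕 (ψ j) (-ξ) = 0 := fun ξ hξ j => by
    simp_rw [Complex.mul_conj] at hξ
    rw [← Complex.ofReal_sum, Complex.ofReal_eq_zero,
      Finset.sum_eq_zero_iff_of_nonneg fun _ _ => Complex.normSq_nonneg _] at hξ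
    exact Complex.normSq_eq_zero.1 (hξ j (Finset.mem_univ j))
  have hout : ∀ ξ : Rd d, (∑ j, 𝓕 (ψ j) (-ξ) * (starRingEnd ℂ) (𝓕 (ψ j) (-ξ))) = 0 →
      (annulusBump a b : Rd d → ℂ) =ᶠ[nhds ξ] 0 := fun ξ hξ => by
    rcases lt_or_ge ‖ξ‖ a with h1 | h1
    · filter_upwards [(isOpen_lt continuous_norm continuous_const).mem_nhds h1] with y hy
      exact annulusBump_of_lt hab hy
    rcases lt_or_ge b ‖ξ‖ with h2 | h2
    · filter_upwards [(isOpen_lt continuous_const continuous_norm).mem_nhds h2] with y hy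
      exact annulusBump_of_gt hab hy
    · obtain ⟨i, hi⟩ := hψ (-ξ) (by simpa using h1) (by simpa using h2)
      exact absurd (hD ξ hξ i) hi
  have hconj : ∀ i, ContDiff ℝ ∞ fun ξ : Rd d => (starRingEnd ℂ) (𝓕 (ψ i) (-ξ)) := fun i =>
    Complex.conjCLE.contDiff.comp (hneg (ψ i))
  choose Ψ hΨ using fun i => exists_fourier_eq_div (d := d)
    (h := fun ξ => annulusBump a b ξ * (starRingEnd ℂ) (𝓕 (ψ i) (-ξ)))
    (D := fun ξ => ∑ j, 𝓕 (ψ j) (-ξ) * (starRingEnd ℂ) (𝓕 (ψ j) (-ξ)))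
    ((contDiff_annulusBump ha hab).mul (hconj i))
    (ContDiff.sum fun j _ => (hneg (ψ j)).mul (hconj j))
    (hcomp _ fun ξ hξ => by simp [annulusBump_of_gt hab hξ])
    (fun ξ hξ => by
      filter_upwards [hout ξ hξ] with y hy
      simp [hy])
  refine ⟨a, b, Λ, Ψ, ha, hab, fun i M => ?_, fun ξ => ?_, fun ξ => ?_⟩
  · refine VanishMoments.of_fourier M (Metric.isOpen_ball (x := (0 : Rd d)) (ε := a))
      (Metric.mem_ball_self ha) fun ξ hξ => ?_
    rw [hΨ, annulusBump_of_lt hab (by simpa using hξ)]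
    simp
  · rw [hΛ]
    by_cases h0 : 𝓕 η (-ξ) = 0
    · have h1 : b < ‖ξ‖ := by
        by_contra! h2
        exact hη (-ξ) (by simpa using h2) h0
      simp [smoothStep_of_ge hab h1.le]
    · field_simp
  · simp_rw [hΨ]
    by_cases h0 : ∑ j, 𝓕 (ψ j) (-ξ) * (starRingEnd ℂ) (𝓕 (ψ j) (-ξ)) = 0
    · have := (hout ξ h0).self_of_nhds
      simp only [Pi.zero_apply] at this
      simp [this]
    · have : ∀ i, 𝓕 (ψ i) (-ξ) * (annulusBump a b ξ * (starRingEnd ℂ) (𝓕 (ψ i) (-ξ)) /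
          ∑ j, 𝓕 (ψ j) (-ξ) * (starRingEnd ℂ) (𝓕 (ψ j) (-ξ)))
          = (𝓕 (ψ i) (-ξ) * (starRingEnd ℂ) (𝓕 (ψ i) (-ξ))) * (annulusBump a b ξ /
          ∑ j, 𝓕 (ψ j) (-ξ) * (starRingEnd ℂ) (𝓕 (ψ j) (-ξ))) := fun i => by ring
      simp_rw [this]
      rw [← Finset.sum_mul, mul_div_cancel₀ _ h0]

/-! ### Calderón's reproducing formula -/

lemma wNorm_one_lt_top {d : ℕ} (k : ℕ) (χ : 𝓢(Rd d, ℂ)) : wNorm k 1 χ < ⊤ := by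
  rw [wNorm, eLpNorm_one_eq_lintegral_enorm]
  exact lintegral_weight_mul_lt_top k χ

lemma iSup_lt_top_of_finite {ι : Type*} [Fintype ι] {f : ι → ℝ≥0∞} (hf : ∀ i, f i < ⊤) :
    ⨆ i, f i < ⊤ :=
  lt_of_le_of_lt (iSup_le fun i => Finset.single_le_sum (f := f) (fun _ _ => bot_le)
    (Finset.mem_univ i)) (ENNReal.sum_lt_top.2 fun i _ => hf i)

lemma iSup_wNorm_one_lt_top {d : ℕ} (k M : ℕ) (χ : 𝓢(Rd d, ℂ)) :
    ⨆ a : Fin M → Fin d, wNorm k 1 (derivWord a χ) < ⊤ :=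
  iSup_lt_top_of_finite fun _ => wNorm_one_lt_top k _

lemma continuous_seminorm {d : ℕ} (k l : ℕ) :
    Continuous (SchwartzMap.seminorm ℝ k l : 𝓢(Rd d, ℂ) → ℝ) :=
  (schwartz_withSeminorms ℝ (Rd d) ℂ).continuous_seminorm (k, l)

lemma measurable_avg_right {d : ℕ} (χ κ : 𝓢(Rd d, ℂ)) (ρ : ℝ) : Measurable (avg χ κ ρ) :=
  (measurable_avg χ κ).comp (measurable_const.prodMk measurable_id)

lemma measurable_avg_param {d : ℕ} (χ κ : 𝓢(Rd d, ℂ)) :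
    Measurable fun z : Param × Rd d => avg χ κ z.1 z.2 :=
  (measurable_avg χ κ).comp ((measurable_subtype_coe.comp measurable_fst).prodMk measurable_snd)

lemma integrable_avg_mul_seminorm {d : ℕ} (χ Λ η : 𝓢(Rd d, ℂ)) (k l : ℕ) :
    Integrable fun x => ‖avg χ Λ 1 x‖ * SchwartzMap.seminorm ℝ k l (reflectTranslate x η) := by
  obtain ⟨Q, hQ0, hQ⟩ := SchwartzMap.exists_seminorm_le_of_affine η k l
  obtain ⟨C, hC, hb⟩ := wNorm_avg_le k 0 (κ := Λ) trivial
  have hfin : wNorm k 1 (avg χ Λ 1) < ⊤ := by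
    refine (hb χ 1 1 le_rfl (by simp)).trans_lt ?_
    rw [pow_zero, mul_one]
    exact ENNReal.mul_lt_top hC.lt_top (iSup_wNorm_one_lt_top k 0 χ)
  have hi : Integrable fun x => (1 + ‖x‖) ^ k • avg χ Λ 1 x := by
    refine ⟨((show Measurable fun x : Rd d => (1 + ‖x‖) ^ k by fun_prop).smul
      (measurable_avg_right χ Λ 1)).aestronglyMeasurable, ?_⟩
    rwa [wNorm, eLpNorm_one_eq_lintegral_enorm] at hfin
  refine (hi.norm.const_mul Q).mono' ?_ (Filter.Eventually.of_forall fun x => ?_)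
  · exact ((measurable_avg_right χ Λ 1).norm.mul ((continuous_seminorm k l).comp
      (continuous_reflectTranslate η)).measurable).aestronglyMeasurable
  · have h1 := hQ (reflectTranslate x η) 1 1 x zero_le_one le_rfl
      (fun u => by simp [reflectTranslate_apply])
    rw [norm_mul, norm_norm, Real.norm_of_nonneg (apply_nonneg _ _), norm_smul,
      Real.norm_of_nonneg (by positivity)]
    calc _ ≤ ‖avg χ Λ 1 x‖ * (Q * (1 * 1 ^ l * (1 + ‖x‖) ^ k)) := by gcongr
      _ = _ := by ring

/-- The seminorm of the kernel grows like `z^{-(d + l)} (1 + ‖x‖)^k`. Using `d + l + 1` vanishing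
moments of `Ψ`, the average is `O(z^{d + l + 1})` in the weighted `L^1`-norm, and the surplus factor
`z` is integrable against `dz/z`. -/
lemma integrable_avg_mul_seminorm_dilate {d : ℕ} (χ ψ : 𝓢(Rd d, ℂ)) {Ψ : 𝓢(Rd d, ℂ)}
    (hΨ : ∀ M, VanishMoments M Ψ) (k l : ℕ) :
    Integrable (fun z : Param × Rd d => ‖avg χ Ψ z.1 z.2‖ *
      SchwartzMap.seminorm ℝ k l (reflectTranslate z.2 (dilate z.1 ψ)))
      (parMeas.prod volume) := by
  obtain ⟨Q, hQ0, hQ⟩ := SchwartzMap.exists_seminorm_le_of_affine ψ k l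
  obtain ⟨C, hC, hb⟩ := wNorm_avg_le k (d + l + 1) (hΨ (d + l + 1))
  have hm : Measurable fun z : Param × Rd d =>
      (((z.1 : ℝ) ^ (d + l))⁻¹) • ((1 + ‖z.2‖) ^ k • avg χ Ψ z.1 z.2) := by
    have hm1 : Measurable fun z : Param × Rd d => (((z.1 : ℝ) ^ (d + l))⁻¹) := by fun_prop
    have hm2 : Measurable fun z : Param × Rd d => (1 + ‖z.2‖) ^ k := by fun_prop
    exact hm1.smul (hm2.smul (measurable_avg_param χ Ψ))
  set S := ⨆ a : Fin (d + l + 1) → Fin d, wNorm k 1 (derivWord a χ)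
  have hS : S < ⊤ := iSup_wNorm_one_lt_top k _ χ
  have hi : Integrable (fun z : Param × Rd d =>
      (((z.1 : ℝ) ^ (d + l))⁻¹) • ((1 + ‖z.2‖) ^ k • avg χ Ψ z.1 z.2)) (parMeas.prod volume) := by
    refine ⟨hm.aestronglyMeasurable, ?_⟩
    rw [HasFiniteIntegral, lintegral_prod _ hm.enorm.aemeasurable]
    have hz : ∀ z : Param, ∫⁻ x : Rd d, ‖(((z : ℝ) ^ (d + l))⁻¹) •
        ((1 + ‖x‖) ^ k • avg χ Ψ z x)‖ₑ ≤ C * S * ENNReal.ofReal ((z : ℝ) ^ (1 : ℝ)) := fun z => by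
      have hz0 : (0 : ℝ) < z := z.2.1
      simp_rw [enorm_smul _ (_ • _)]
      rw [lintegral_const_mul' _ _ enorm_ne_top]
      have h1 := hb χ 1 z le_rfl (by rw [abs_of_pos hz0]; exact z.2.2.le)
      rw [wNorm, eLpNorm_one_eq_lintegral_enorm] at h1
      refine (mul_le_mul' le_rfl h1).trans (le_of_eq ?_)
      rw [Real.enorm_of_nonneg (by positivity), Real.enorm_of_nonneg hz0.le,
        ← ENNReal.ofReal_pow hz0.le]
      calc _ = (ENNReal.ofReal (((z : ℝ) ^ (d + l))⁻¹) * ENNReal.ofReal ((z : ℝ) ^ (d + l + 1)))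
            * (C * S) := by ring
        _ = _ := by
          rw [← ENNReal.ofReal_mul (by positivity), mul_comm, Real.rpow_one]
          rw [pow_succ, ← mul_assoc, inv_mul_cancel₀ (by positivity), one_mul]
    refine (lintegral_mono hz).trans_lt ?_
    rw [lintegral_const_mul' _ _ (ENNReal.mul_lt_top hC.lt_top hS).ne]
    exact ENNReal.mul_lt_top (ENNReal.mul_lt_top hC.lt_top hS)
      (lintegral_rpow_parMeas_lt_top one_pos)
  refine (hi.norm.const_mul Q).mono' ?_ (Filter.Eventually.of_forall fun z => ?_)
  · exact ((measurable_avg_param χ Ψ).norm.mul ((continuous_seminorm k l).comp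
      (continuous_reflectTranslate_dilate ψ)).measurable).aestronglyMeasurable
  · have hz0 : (0 : ℝ) < z.1 := z.1.2.1
    have h1 := hQ (reflectTranslate z.2 (dilate z.1 ψ)) ((z.1 : ℝ) ^ d)⁻¹ (z.1 : ℝ)⁻¹ z.2
      (by positivity) (one_le_inv_param z.1) (reflectTranslate_dilate_apply ψ z.1 z.2)
    rw [norm_mul, norm_norm, Real.norm_of_nonneg (apply_nonneg _ _), norm_smul, norm_smul,
      Real.norm_of_nonneg (by positivity), Real.norm_of_nonneg (by positivity)]
    calc _ ≤ ‖avg χ Ψ z.1 z.2‖ * (Q * (((z.1 : ℝ) ^ d)⁻¹ * ((z.1 : ℝ)⁻¹) ^ l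
            * (1 + ‖z.2‖) ^ k)) := by gcongr
      _ = _ := by
        rw [pow_add, mul_inv, inv_pow]
        ring

lemma avg_param_eq {d : ℕ} (χ κ : 𝓢(Rd d, ℂ)) (z : Param) (x : Rd d) :
    avg χ κ z x = ∫ v, χ (x - v) * dilate z κ v := by
  have hz0 : (0 : ℝ) < z := z.2.1
  have h := Measure.integral_comp_inv_smul_of_nonneg volume
    (fun v => χ (x - (z : ℝ) • v) * κ v) hz0.le
  simp only [finrank_euclideanSpace_fin, smul_inv_smul₀ hz0.ne'] at h
  simp_rw [dilate_apply, mul_smul_comm]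
  rw [integral_smul, h, smul_smul, inv_mul_cancel₀ (by positivity), one_smul]
  rfl

lemma fourier_dilate {d : ℕ} (κ : 𝓢(Rd d, ℂ)) (z : Param) (ξ : Rd d) :
    𝓕 (dilate z κ) ξ = 𝓕 κ ((z : ℝ) • ξ) := by
  have hz0 : (0 : ℝ) < z := z.2.1
  have h := Measure.integral_comp_inv_smul_of_nonneg volume
    (fun v => Real.fourierChar (-inner ℝ v ((z : ℝ) • ξ)) • κ v) hz0.le
  rw [SchwartzMap.fourier_coe, SchwartzMap.fourier_coe, Real.fourier_eq, Real.fourier_eq]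
  simp_rw [dilate_apply, smul_comm _ (((z : ℝ) ^ d)⁻¹)]
  rw [integral_smul, eq_comm, eq_inv_smul_iff₀ (by positivity)]
  simp only [finrank_euclideanSpace_fin, inner_smul_left, inner_smul_right] at h
  rw [eq_comm]
  simp only [inner_smul_right]
  rw [← h]
  refine integral_congr_ae (Filter.Eventually.of_forall fun v => ?_)
  simp only
  congr 3
  rw [conj_trivial]
  field_simp

lemma fourier_reflectTranslate_zero {d : ℕ} (κ : 𝓢(Rd d, ℂ)) (ξ : Rd d) :
    𝓕 (reflectTranslate 0 κ) ξ = 𝓕 κ (-ξ) := by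
  rw [SchwartzMap.fourier_coe, SchwartzMap.fourier_coe, Real.fourier_eq, Real.fourier_eq,
    ← integral_neg_eq_self]
  simp [reflectTranslate_apply]

/-- The left side is the convolution of `B * χ` with the reflection of `A`, evaluated at `u`; the
right side is its Fourier inversion. -/
lemma integral_avg_mul {d : ℕ} (A B χ : 𝓢(Rd d, ℂ)) (u : Rd d) :
    ∫ x, (∫ v, χ (x - v) * B v) * A (x - u)
      = ∫ ξ, Real.fourierChar (inner ℝ ξ u) • (𝓕 A (-ξ) * 𝓕 B ξ * 𝓕 χ ξ) := by
  let mulL := ContinuousLinearMap.mul ℂ ℂ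
  let F := SchwartzMap.convolution mulL (reflectTranslate 0 A) (SchwartzMap.convolution mulL B χ)
  have h1 : F u = ∫ x, (∫ v, χ (x - v) * B v) * A (x - u) := by
    rw [SchwartzMap.convolution_apply, convolution_def]
    simp_rw [SchwartzMap.convolution_apply, convolution_def]
    rw [← integral_sub_left_eq_self _ volume u]
    refine integral_congr_ae (Filter.Eventually.of_forall fun x => ?_)
    simp only [mulL, ContinuousLinearMap.mul_apply', reflectTranslate_apply, zero_sub, neg_sub,
      sub_sub_cancel]
    rw [mul_comm]
    congr 1
    exact integral_congr_ae (Filter.Eventually.of_forall fun v => mul_comm _ _)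
  have h2 : F u = 𝓕⁻ (𝓕 F) u := by rw [FourierTransform.fourierInv_fourier_eq]
  rw [← h1, h2, SchwartzMap.fourierInv_coe, Real.fourierInv_eq]
  refine integral_congr_ae (Filter.Eventually.of_forall fun ξ => ?_)
  simp only [F, SchwartzMap.fourier_convolution, SchwartzMap.pairing_apply_apply, mulL,
    ContinuousLinearMap.mul_apply', fourier_reflectTranslate_zero, mul_assoc]

/-- The linear bound supplies a factor `z` at the frequency `z • ξ`, which justifies Fubini for the
measure `dz/z`. -/
lemma exists_norm_annulusBump_le {d : ℕ} {a b : ℝ} (hab : a < b) :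
    ∃ K : ℝ, 0 ≤ K ∧ ∀ ξ : Rd d, ‖annulusBump a b ξ‖ ≤ K * ‖ξ‖ := by
  obtain ⟨K, hK⟩ := (isCompact_Icc (a := a) (b := b)).exists_bound_of_continuousOn
    (contDiff_deriv_smoothStep a b).continuous.continuousOn
  refine ⟨max K 0, le_max_right _ _, fun ξ => ?_⟩
  have : ‖deriv (smoothStep a b) ‖ξ‖‖ ≤ max K 0 := by
    by_cases h : ‖ξ‖ ∈ Set.Icc a b
    · exact (hK _ h).trans (le_max_left _ _)
    · rw [Set.mem_Icc, not_and_or, not_le, not_le] at h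
      rcases h with h | h
      · simp [deriv_smoothStep_of_lt hab h]
      · simp [deriv_smoothStep_of_gt hab h]
  rw [annulusBump, Complex.norm_real, norm_mul, norm_norm, mul_comm]
  gcongr

lemma integral_annulusBump_mul {d : ℕ} {a b : ℝ} (ha : 0 < a) (hab : a < b) (χ : 𝓢(Rd d, ℂ))
    (u : Rd d) : ∫ z : Param, (∫ ξ, Real.fourierChar (inner ℝ ξ u) •
        (annulusBump a b ((z : ℝ) • ξ) * 𝓕 χ ξ)) ∂parMeas
      = ∫ ξ, Real.fourierChar (inner ℝ ξ u) • ((smoothStep a b ‖ξ‖ : ℂ) * 𝓕 χ ξ) := by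
  obtain ⟨K, hK0, hK⟩ := exists_norm_annulusBump_le (d := d) hab
  have hcont : Continuous fun y : Param × Rd d => Real.fourierChar (inner ℝ y.2 u) •
      (annulusBump a b ((y.1 : ℝ) • y.2) * 𝓕 χ y.2) := by
    have hin : Continuous fun y : Param × Rd d => (inner ℝ y.2 u : ℝ) := by fun_prop
    refine Continuous.fun_smul (f := fun y : Param × Rd d => Real.fourierChar (inner ℝ y.2 u))
      (Real.continuous_fourierChar.comp hin) (Continuous.mul ?_
      ((𝓕 χ).continuous.comp continuous_snd))
    have hs : Continuous fun y : Param × Rd d => (y.1 : ℝ) • y.2 := by fun_prop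
    exact (contDiff_annulusBump ha hab).continuous.comp hs
  have hz : Integrable (fun z : Param => (z : ℝ)) parMeas := by
    refine ⟨by fun_prop, ?_⟩
    refine lt_of_le_of_lt (lintegral_mono fun z => ?_) (lintegral_rpow_parMeas_lt_top one_pos)
    rw [Real.rpow_one, Real.enorm_of_nonneg z.2.1.le]
  rw [integral_integral_swap]
  · refine integral_congr_ae (Filter.Eventually.of_forall fun ξ => ?_)
    simp only [Circle.smul_def]
    rw [integral_smul, integral_mul_const, integral_annulusBump ha hab]
  · refine ((hz.mul_prod ((𝓕 χ).integrable_pow_mul volume 1)).const_mul K).mono'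
      hcont.aestronglyMeasurable (Filter.Eventually.of_forall fun y => ?_)
    simp only [Function.uncurry, Circle.norm_smul, norm_mul, pow_one]
    calc _ ≤ (K * ‖(y.1 : ℝ) • y.2‖) * ‖𝓕 χ y.2‖ := by gcongr; exact hK _
      _ = _ := by
        rw [norm_smul, Real.norm_of_nonneg y.1.2.1.le]
        ring

/-- Calderón's reproducing formula for tempered distributions. -/
theorem IsTauberian.exists_reproducing {d : ℕ} {ι : Type} [Fintype ι] {η : 𝓢(Rd d, ℂ)}
    {ψ : ι → 𝓢(Rd d, ℂ)} (h : IsTauberian η ψ) :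
    ∃ (Λ : 𝓢(Rd d, ℂ)) (Ψ : ι → 𝓢(Rd d, ℂ)), (∀ i M, VanishMoments M (Ψ i)) ∧
      ∀ (T : 𝓢'(Rd d, ℂ)) (χ : 𝓢(Rd d, ℂ)), T χ = (∫ x, avg χ Λ 1 x * conv T η x) +
        ∑ i, ∫ z : Param × Rd d, avg χ (Ψ i) z.1 z.2 * conv T (dilate z.1 (ψ i)) z.2
          ∂(parMeas.prod volume) := by
  obtain ⟨a, b, Λ, Ψ, ha, hab, hΨ, h1, h2⟩ := h.exists_dual
  refine ⟨Λ, Ψ, hΨ, fun T χ => ?_⟩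
  let X₀ := weakIntegral volume (measurable_avg_right χ Λ 1).aestronglyMeasurable
    (continuous_reflectTranslate η) (integrable_avg_mul_seminorm χ Λ η)
  let X := fun i => weakIntegral (parMeas.prod volume)
    (measurable_avg_param χ (Ψ i)).aestronglyMeasurable
    (continuous_reflectTranslate_dilate (ψ i))
    (integrable_avg_mul_seminorm_dilate χ (ψ i) (hΨ i))
  -- The formula is proved for the test function: `X₀` has the Fourier multiplier `1 - G(‖ξ‖)`, the
  -- sum of the `X i` has the multiplier `G(‖ξ‖)`, and the two add up to `1`. Since all terms are
  -- weak integrals of Schwartz functions, `T` can then be applied under the integral signs.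
  have key : χ = X₀ + ∑ i, X i := by
    ext u
    rw [_root_.add_apply, _root_.sum_apply]
    have e0 : X₀ u = ∫ ξ, Real.fourierChar (inner ℝ ξ u) •
        ((1 - (smoothStep a b ‖ξ‖ : ℂ)) * 𝓕 χ ξ) := by
      simp_rw [← h1]
      rw [← integral_avg_mul]
      simp only [X₀, weakIntegral_apply, reflectTranslate_apply, avg, one_smul]
    let A : ι → Param → ℂ := fun i z => ∫ ξ, Real.fourierChar (inner ℝ ξ u) •
        (𝓕 (ψ i) (-((z : ℝ) • ξ)) * 𝓕 (Ψ i) ((z : ℝ) • ξ) * 𝓕 χ ξ)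
    have hA : ∀ i (z : Param), ∫ x, avg χ (Ψ i) z x • reflectTranslate x (dilate z (ψ i)) u
        = A i z := fun i z => by
      have := integral_avg_mul (dilate z (ψ i)) (dilate z (Ψ i)) χ u
      simp only [fourier_dilate, smul_neg, ← avg_param_eq] at this
      simpa only [reflectTranslate_apply, smul_eq_mul] using this
    have hint := fun i => integrable_smul_apply
      (measurable_avg_param χ (Ψ i)).aestronglyMeasurable
      (continuous_reflectTranslate_dilate (ψ i))
      (integrable_avg_mul_seminorm_dilate χ (ψ i) (hΨ i)) u
    have hAi : ∀ i, Integrable (A i) parMeas := fun i => by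
      simpa only [hA] using (hint i).integral_prod_left
    have ei : ∀ i, X i u = ∫ z, A i z ∂parMeas := fun i => by
      have hx : X i u = ∫ z : Param × Rd d, avg χ (Ψ i) z.1 z.2 •
        reflectTranslate z.2 (dilate z.1 (ψ i)) u ∂(parMeas.prod volume) := rfl
      rw [hx, integral_prod _ (hint i)]
      simp only [hA]
    have hsum : ∀ z, ∑ i, A i z = ∫ ξ, Real.fourierChar (inner ℝ ξ u) •
        (annulusBump a b ((z : ℝ) • ξ) * 𝓕 χ ξ) := fun z => by
      simp only [A]
      rw [← integral_finsetSum]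
      · refine integral_congr_ae (Filter.Eventually.of_forall fun ξ => ?_)
        simp only
        rw [← Finset.smul_sum, ← Finset.sum_mul, h2]
      · intro i _
        have hs : Continuous fun ξ : Rd d => (z : ℝ) • ξ := by fun_prop
        have hc : Continuous fun ξ : Rd d => Real.fourierChar (inner ℝ ξ u) •
            (𝓕 (ψ i) (-((z : ℝ) • ξ)) * 𝓕 (Ψ i) ((z : ℝ) • ξ) * 𝓕 χ ξ) :=
          (Real.continuous_fourierChar.comp (by fun_prop)).smul
            ((((𝓕 (ψ i)).continuous.comp hs.neg).mul ((𝓕 (Ψ i)).continuous.comp hs)).mul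
              (𝓕 χ).continuous)
        refine ((𝓕 χ).integrable.norm.const_mul (SchwartzMap.seminorm ℝ 0 0 (𝓕 (ψ i)) *
          SchwartzMap.seminorm ℝ 0 0 (𝓕 (Ψ i)))).mono' hc.aestronglyMeasurable
          (Filter.Eventually.of_forall fun ξ => ?_)
        rw [Circle.norm_smul, norm_mul, norm_mul]
        gcongr
        · exact SchwartzMap.norm_le_seminorm ℝ _ _
        · exact SchwartzMap.norm_le_seminorm ℝ _ _
    have hbase : ∀ f : Rd d → ℂ, Continuous f → (∃ K : ℝ, ∀ ξ, ‖f ξ‖ ≤ K) →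
        Integrable fun ξ => Real.fourierChar (inner ℝ ξ u) • (f ξ * 𝓕 χ ξ) := by
      rintro f hf ⟨K, hK⟩
      refine ((𝓕 χ).integrable.norm.const_mul K).mono' ((Real.continuous_fourierChar.comp
        (by fun_prop)).smul (hf.mul (𝓕 χ).continuous)).aestronglyMeasurable
        (Filter.Eventually.of_forall fun ξ => ?_)
      rw [Circle.norm_smul, norm_mul]
      gcongr
      exact hK ξ
    have hst : Continuous fun ξ : Rd d => (smoothStep a b ‖ξ‖ : ℂ) :=
      Complex.continuous_ofReal.comp ((contDiff_smoothStep a b).continuous.comp continuous_norm)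
    have hstb : ∀ ξ : Rd d, ‖(smoothStep a b ‖ξ‖ : ℂ)‖ ≤ 1 := fun ξ => by
      rw [Complex.norm_real, smoothStep, Real.norm_of_nonneg (Real.smoothTransition.nonneg _)]
      exact Real.smoothTransition.le_one _
    have hχ : χ u = 𝓕⁻ (𝓕 χ) u := by rw [FourierTransform.fourierInv_fourier_eq]
    simp_rw [ei]
    rw [← integral_finsetSum _ fun i _ => hAi i]
    simp_rw [hsum]
    rw [integral_annulusBump_mul ha hab, e0, ← integral_add, hχ, SchwartzMap.fourierInv_coe,
      Real.fourierInv_eq]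
    · refine integral_congr_ae (Filter.Eventually.of_forall fun ξ => ?_)
      simp only
      rw [← smul_add, ← add_mul, sub_add_cancel, one_mul]
    · refine hbase _ (continuous_const.sub hst) ⟨1 + 1, fun ξ => (norm_sub_le _ _).trans ?_⟩
      rw [norm_one]
      gcongr
      exact hstb ξ
    · exact hbase _ hst ⟨1, hstb⟩
  conv_lhs => rw [key]
  rw [map_add, map_sum, T.apply_weakIntegral]
  congr 1
  refine Finset.sum_congr rfl fun i _ => ?_
  rw [T.apply_weakIntegral]
  rfl

/-! ### Weighted norms in the parameter -/

lemma epsNorm_lt_top_iff_parMeas {q : ℝ≥0∞} (hq : q ≠ ⊤) (hq1 : 1 ≤ q) (σ : ℝ)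
    (F : Param → ℝ≥0∞) : epsNorm q σ F < ⊤ ↔
      ∫⁻ ε : Param, (ENNReal.ofReal ((ε : ℝ) ^ (-σ)) * F ε) ^ q.toReal ∂parMeas < ⊤ := by
  rw [lintegral_parMeas_eq]
  exact epsNorm_lt_top_iff hq (ENNReal.toReal_pos (zero_lt_one.trans_le hq1).ne' hq).ne' σ F

lemma epsNorm_top_lt_top_iff (σ : ℝ) (F : Param → ℝ≥0∞) : epsNorm ⊤ σ F < ⊤ ↔
    ⨆ ε : Param, ENNReal.ofReal ((ε : ℝ) ^ (-σ)) * F ε < ⊤ := by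
  rw [epsNorm, if_pos rfl]

lemma ENNReal.one_le_toReal {q : ℝ≥0∞} (hq : q ≠ ⊤) (hq1 : 1 ≤ q) : 1 ≤ q.toReal := by
  rwa [← ENNReal.toReal_one, ENNReal.toReal_le_toReal ENNReal.one_ne_top hq]

/-- Hölder's inequality for the measure with density `K`, with exponents arranged so that `q = 1`
needs no separate treatment. -/
lemma lintegral_mul_le_rpow {Ω : Type*} [MeasurableSpace Ω] {μ : Measure Ω} {q : ℝ} (hq : 1 ≤ q)
    {F K : Ω → ℝ≥0∞} (hF : Measurable F) (hK : Measurable K) :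
    (∫⁻ t, F t * K t ∂μ) ≤ (∫⁻ t, F t ^ q * K t ∂μ) ^ (1 / q) * (∫⁻ t, K t ∂μ) ^ (1 - 1 / q) := by
  have hq0 : 0 < q := by linarith
  have h1 : 0 ≤ 1 / q := by positivity
  have h2 : 0 ≤ 1 - 1 / q := sub_nonneg.2 ((div_le_one hq0).2 hq)
  refine le_trans (le_of_eq (lintegral_congr fun t => ?_))
    (ENNReal.lintegral_mul_norm_pow_le ((hF.pow_const q).mul hK).aemeasurable hK.aemeasurable
      h1 h2 (by ring))
  simp only [Pi.mul_apply]
  rw [ENNReal.mul_rpow_of_nonneg _ _ h1, ← ENNReal.rpow_mul, mul_one_div_cancel hq0.ne',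
    ENNReal.rpow_one, mul_assoc, ← ENNReal.rpow_add_of_nonneg _ _ h1 h2]
  simp

lemma measurable_ofReal_rpow (a : ℝ) : Measurable fun z : Param => ENNReal.ofReal ((z : ℝ) ^ a) :=
  (measurable_subtype_coe.pow_const a).ennreal_ofReal

/-- The kernel `(z/y)^{-r} min(y/z, z/y)^δ`. -/
noncomputable def schurKernel (r δ : ℝ) (y z : Param) : ℝ≥0∞ :=
  ENNReal.ofReal (((z : ℝ) / y) ^ (-r) * min ((y : ℝ) / z) (z / y) ^ δ)

lemma measurable_schurKernel (r δ : ℝ) :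
    Measurable fun w : Param × Param => schurKernel r δ w.1 w.2 := by
  have h1 : Measurable fun w : Param × Param => (w.1 : ℝ) := measurable_subtype_coe.comp measurable_fst
  have h2 : Measurable fun w : Param × Param => (w.2 : ℝ) := measurable_subtype_coe.comp measurable_snd
  exact (((h2.div h1).pow_const _).mul (((h1.div h2).min (h2.div h1)).pow_const _)).ennreal_ofReal

lemma measurable_schurKernel_right (r δ : ℝ) (y : Param) : Measurable (schurKernel r δ y) :=
  (measurable_schurKernel r δ).comp measurable_prodMk_left

lemma schurKernel_zero_comm (δ : ℝ) (y z : Param) : schurKernel 0 δ y z = schurKernel 0 δ z y := by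
  simp [schurKernel, min_comm]

lemma lintegral_schurKernel_zero_le {δ : ℝ} (hδ : 0 < δ) (y : Param) :
    ∫⁻ z, schurKernel 0 δ y z ∂parMeas ≤ ENNReal.ofReal (2 / δ) := by
  simpa [schurKernel] using lintegral_min_rpow_le hδ y

/-- Conjugation with the weight `y^{-r}` reduces the weighted kernel to the symmetric kernel with `r
= 0`. -/
lemma ofReal_rpow_mul_schurKernel (r δ : ℝ) (y z : Param) :
    ENNReal.ofReal ((y : ℝ) ^ (-r)) * schurKernel r δ y z
      = ENNReal.ofReal ((z : ℝ) ^ (-r)) * schurKernel 0 δ y z := by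
  have hy : (0 : ℝ) < y := y.2.1
  have hz : (0 : ℝ) < z := z.2.1
  rw [schurKernel, schurKernel, ← ENNReal.ofReal_mul (by positivity),
    ← ENNReal.ofReal_mul (by positivity), Real.div_rpow hz.le hy.le]
  congr 1
  have : (y : ℝ) ^ (-r) ≠ 0 := (Real.rpow_pos_of_pos hy _).ne'
  simp only [neg_zero, Real.rpow_zero, one_mul]
  field_simp

lemma measurable_lintegral_schurKernel {a : Param → ℝ≥0∞} (ha : Measurable a) (r δ : ℝ) :
    Measurable fun y => ∫⁻ z, a z * schurKernel r δ y z ∂parMeas :=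
  Measurable.lintegral_prod_right' (f := fun w : Param × Param => a w.2 * schurKernel r δ w.1 w.2)
    ((ha.comp measurable_snd).mul (measurable_schurKernel r δ))

/-- Schur's test for the weighted norms. -/
lemma epsNorm_lintegral_schurKernel_lt_top {q : ℝ≥0∞} (hq1 : 1 ≤ q) {r δ : ℝ} (hδ : 0 < δ)
    {a : Param → ℝ≥0∞} (ha : Measurable a) (h : epsNorm q r a < ⊤) :
    epsNorm q r (fun y => ∫⁻ z, a z * schurKernel r δ y z ∂parMeas) < ⊤ := by
  set F : Param → ℝ≥0∞ := fun z => ENNReal.ofReal ((z : ℝ) ^ (-r)) * a z with hF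
  have hFm : Measurable F := (measurable_ofReal_rpow _).mul ha
  have hKm : Measurable fun w : Param × Param => schurKernel 0 δ w.1 w.2 :=
    measurable_schurKernel 0 δ
  have e : ∀ y : Param, ENNReal.ofReal ((y : ℝ) ^ (-r)) *
      ∫⁻ z, a z * schurKernel r δ y z ∂parMeas = ∫⁻ z, F z * schurKernel 0 δ y z ∂parMeas := by
    intro y
    rw [← lintegral_const_mul' _ _ ENNReal.ofReal_ne_top]
    refine lintegral_congr fun z => ?_
    rw [mul_left_comm, ofReal_rpow_mul_schurKernel]
    simp only [hF]
    ring
  set A := ENNReal.ofReal (2 / δ)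
  by_cases hq : q = ⊤
  · subst hq
    rw [epsNorm_top_lt_top_iff] at h ⊢
    simp_rw [e]
    refine lt_of_le_of_lt (iSup_le fun y => ?_)
      (ENNReal.mul_lt_top h (ENNReal.ofReal_lt_top (r := 2 / δ)))
    calc _ ≤ ∫⁻ z, (⨆ z, F z) * schurKernel 0 δ y z ∂parMeas :=
          lintegral_mono fun z => mul_le_mul' (le_iSup F z) le_rfl
      _ = (⨆ z, F z) * ∫⁻ z, schurKernel 0 δ y z ∂parMeas :=
          lintegral_const_mul' _ _ h.ne
      _ ≤ _ := mul_le_mul' le_rfl (lintegral_schurKernel_zero_le hδ y)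
  rw [epsNorm_lt_top_iff_parMeas hq hq1] at h ⊢
  simp_rw [e]
  have hqr := ENNReal.one_le_toReal hq hq1
  have hq0 : 0 < q.toReal := by linarith
  -- Hölder with respect to the kernel: the integral of the kernel over `z` is bounded by `A` and
  -- enters with the power `q - 1`.
  have hb : ∀ y : Param, (∫⁻ z, F z * schurKernel 0 δ y z ∂parMeas) ^ q.toReal
      ≤ A ^ (q.toReal - 1) * ∫⁻ z, F z ^ q.toReal * schurKernel 0 δ y z ∂parMeas := fun y => by
    have h1 := lintegral_mul_le_rpow (μ := parMeas) hqr hFm 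
      (measurable_schurKernel_right 0 δ y)
    refine (ENNReal.rpow_le_rpow h1 hq0.le).trans ?_
    rw [ENNReal.mul_rpow_of_nonneg _ _ hq0.le, ← ENNReal.rpow_mul, ← ENNReal.rpow_mul,
      one_div_mul_cancel hq0.ne', ENNReal.rpow_one, mul_comm]
    have : (1 - 1 / q.toReal) * q.toReal = q.toReal - 1 := by field_simp
    rw [this]
    gcongr
    exact lintegral_schurKernel_zero_le hδ y
  refine (lintegral_mono hb).trans_lt ?_
  rw [lintegral_const_mul' _ _ (ENNReal.rpow_ne_top_of_nonneg (by linarith) ENNReal.ofReal_ne_top)]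
  refine ENNReal.mul_lt_top (ENNReal.rpow_ne_top_of_nonneg (by linarith)
    ENNReal.ofReal_ne_top).lt_top ?_
  -- After Tonelli the kernel is integrated in the other variable, where symmetry gives the same
  -- bound `A`.
  rw [lintegral_lintegral_swap]
  · have hz : ∀ z : Param, ∫⁻ y, F z ^ q.toReal * schurKernel 0 δ y z ∂parMeas
        ≤ A * F z ^ q.toReal := fun z => by
      simp_rw [schurKernel_zero_comm δ _ z]
      rw [lintegral_const_mul _ (measurable_schurKernel_right 0 δ z), mul_comm]
      gcongr
      exact lintegral_schurKernel_zero_le hδ z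
    refine (lintegral_mono hz).trans_lt ?_
    rw [lintegral_const_mul' _ _ ENNReal.ofReal_ne_top]
    exact ENNReal.mul_lt_top ENNReal.ofReal_lt_top h
  · exact (((hFm.pow_const _).comp measurable_snd).mul hKm).aemeasurable

lemma epsNorm_rpow_lt_top (q : ℝ≥0∞) {r a : ℝ} (h : r < a) :
    epsNorm q r (fun y => ENNReal.ofReal ((y : ℝ) ^ a)) < ⊤ := by
  have e : ∀ y : Param, ENNReal.ofReal ((y : ℝ) ^ (-r)) * ENNReal.ofReal ((y : ℝ) ^ a)
      = ENNReal.ofReal ((y : ℝ) ^ (a - r)) := fun y => by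
    have hy : (0 : ℝ) < y := y.2.1
    rw [← ENNReal.ofReal_mul (by positivity), ← Real.rpow_add hy]
    congr 2
    ring
  by_cases hq : q = ⊤
  · subst hq
    rw [epsNorm_top_lt_top_iff]
    simp_rw [e]
    refine lt_of_le_of_lt (iSup_le fun y => ?_) ENNReal.one_lt_top
    rw [ENNReal.ofReal_le_one]
    exact Real.rpow_le_one y.2.1.le y.2.2.le (by linarith)
  by_cases hq0 : q.toReal = 0
  · exact epsNorm_of_toReal_eq_zero hq hq0 _ _
  have hq' : 0 < q.toReal := lt_of_le_of_ne ENNReal.toReal_nonneg (Ne.symm hq0)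
  rw [epsNorm_lt_top_iff hq hq0, ← lintegral_parMeas_eq (fun y : Param =>
    (ENNReal.ofReal ((y : ℝ) ^ (-r)) * ENNReal.ofReal ((y : ℝ) ^ a)) ^ q.toReal)]
  simp_rw [e]
  refine lt_of_le_of_lt (lintegral_mono fun y => ?_)
    (lintegral_rpow_parMeas_lt_top (a := (a - r) * q.toReal) (mul_pos (by linarith) hq'))
  rw [ENNReal.ofReal_rpow_of_nonneg (Real.rpow_nonneg y.2.1.le _) hq'.le, ← Real.rpow_mul y.2.1.le]

/-- A strict loss in the weight turns an `L^q` bound into an `L^1` bound: the spare power `z^{σ -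
τ}` is at most `1` and integrable against `dz/z`, so Hölder's inequality applies. -/
lemma lintegral_rpow_mul_lt_top {q : ℝ≥0∞} (hq1 : 1 ≤ q) {σ τ : ℝ} (hτ : τ < σ)
    {F : Param → ℝ≥0∞} (hF : Measurable F) (h : epsNorm q σ F < ⊤) :
    ∫⁻ z : Param, ENNReal.ofReal ((z : ℝ) ^ (-τ)) * F z ∂parMeas < ⊤ := by
  have hk := lintegral_rpow_parMeas_lt_top (sub_pos.2 hτ)
  have e : ∀ z : Param, ENNReal.ofReal ((z : ℝ) ^ (-τ)) * F z
      = (ENNReal.ofReal ((z : ℝ) ^ (-σ)) * F z) * ENNReal.ofReal ((z : ℝ) ^ (σ - τ)) := fun z => by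
    have hz : (0 : ℝ) < z := z.2.1
    rw [mul_right_comm, ← ENNReal.ofReal_mul (by positivity), ← Real.rpow_add hz]
    congr 3
    ring
  simp_rw [e]
  have hle : ∀ z : Param, ENNReal.ofReal ((z : ℝ) ^ (σ - τ)) ≤ 1 := fun z => by
    rw [ENNReal.ofReal_le_one]
    exact Real.rpow_le_one z.2.1.le z.2.2.le (by linarith)
  by_cases hq : q = ⊤
  · subst hq
    rw [epsNorm_top_lt_top_iff] at h
    refine lt_of_le_of_lt (lintegral_mono fun z => mul_le_mul' (le_iSup (fun z : Param =>
      ENNReal.ofReal ((z : ℝ) ^ (-σ)) * F z) z) le_rfl) ?_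
    rw [lintegral_const_mul' _ _ h.ne]
    exact ENNReal.mul_lt_top h hk
  rw [epsNorm_lt_top_iff_parMeas hq hq1] at h
  have hqr := ENNReal.one_le_toReal hq hq1
  refine (lintegral_mul_le_rpow hqr ((measurable_ofReal_rpow _).mul hF)
    (measurable_ofReal_rpow _)).trans_lt (ENNReal.mul_lt_top ?_ ?_)
  · refine ENNReal.rpow_lt_top_of_nonneg (by positivity) (lt_of_le_of_lt
      (lintegral_mono fun z => ?_) h).ne
    exact mul_le_of_le_one_right' (hle z)
  · exact ENNReal.rpow_lt_top_of_nonneg (sub_nonneg.2 ((div_le_one (by linarith)).2 hqr)) hk.ne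

lemma epsNorm_sum_lt_top {ι : Type*} {q : ℝ≥0∞} {σ : ℝ} (s : Finset ι) {F : ι → Param → ℝ≥0∞}
    (hm : ∀ i, Measurable (F i)) (h : ∀ i ∈ s, epsNorm q σ (F i) < ⊤) :
    epsNorm q σ (fun y => ∑ i ∈ s, F i y) < ⊤ := by
  classical
  induction s using Finset.induction_on with
  | empty => simpa using epsNorm_zero q σ
  | insert i s hi ih =>
    simp_rw [Finset.sum_insert hi]
    exact epsNorm_add_lt_top (hm i) (h i (Finset.mem_insert_self i s))
      (ih fun j hj => h j (Finset.mem_insert_of_mem hj))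

/-! ### Bounds for averages of dilated kernels -/

lemma wNorm_zero {d : ℕ} (p : ℝ≥0∞) (f : Rd d → ℂ) : wNorm 0 p f = eLpNorm f p volume := by
  simp [wNorm]

lemma eLpNorm_avg_le {d : ℕ} (M : ℕ) {κ : 𝓢(Rd d, ℂ)} (hκ : VanishMoments M κ) :
    ∃ C : ℝ≥0∞, C ≠ ⊤ ∧ ∀ (χ : 𝓢(Rd d, ℂ)) (p : ℝ≥0∞) (ρ : ℝ), 1 ≤ p → |ρ| ≤ 1 →
      eLpNorm (avg χ κ ρ) p volume ≤ C * ‖ρ‖ₑ ^ M *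
        ⨆ a : Fin M → Fin d, eLpNorm (derivWord a χ) p volume := by
  simpa only [wNorm_zero] using wNorm_avg_le 0 M hκ

lemma eLpNorm_derivWord_le_sobNorm {d m k : ℕ} (h : m ≤ k) (a : Fin m → Fin d) (p : ℝ≥0∞)
    (χ : 𝓢(Rd d, ℂ)) : eLpNorm (derivWord a χ) p volume ≤ sobNorm k p volume χ := by
  have h' : (derivWord a χ : Rd d → ℂ)
      = fun x => iteratedFDeriv ℝ m χ x fun j => stdVec (a j) :=
    funext fun x => SchwartzMap.iteratedLineDerivOp_eq_iteratedFDeriv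
  rw [h']
  exact le_iSup₂ (f := fun (m : Fin (k + 1)) (a : Fin (m : ℕ) → Fin d) =>
      eLpNorm (fun x => iteratedFDeriv ℝ (m : ℕ) χ x (fun j => stdVec (a j))) p volume)
      ⟨m, Nat.lt_succ_of_le h⟩ a

lemma sobNorm_eq_iSup_derivWord {d k : ℕ} (p : ℝ≥0∞) (χ : 𝓢(Rd d, ℂ)) :
    sobNorm k p volume χ
      = ⨆ (m : Fin (k + 1)) (a : Fin (m : ℕ) → Fin d), eLpNorm (derivWord a χ) p volume := by
  unfold sobNorm
  congr! with m a x
  exact SchwartzMap.iteratedLineDerivOp_eq_iteratedFDeriv.symm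

lemma sobNorm_one_lt_top {d : ℕ} (k : ℕ) (χ : 𝓢(Rd d, ℂ)) : sobNorm k 1 volume χ < ⊤ := by
  rw [sobNorm_eq_iSup_derivWord]
  refine iSup_lt_top_of_finite fun m => iSup_lt_top_of_finite fun a => ?_
  rw [← wNorm_zero]
  exact wNorm_one_lt_top 0 _

lemma avg_reflectTranslate {d : ℕ} (f κ : 𝓢(Rd d, ℂ)) (ρ : ℝ) (w x : Rd d) :
    avg (reflectTranslate w f) κ ρ x = avg f κ (-ρ) (w - x) := by
  simp only [avg, reflectTranslate_apply]
  refine integral_congr_ae (Filter.Eventually.of_forall fun v => ?_)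
  simp only
  congr 2
  module

lemma avg_neg_param_eq {d : ℕ} (χ κ : 𝓢(Rd d, ℂ)) (z : Param) (x : Rd d) :
    avg χ κ (-z) x = ∫ v, χ (x + v) * dilate z κ v := by
  have h1 := avg_reflectTranslate (reflectTranslate 0 χ) κ (-z) (-x) 0
  have h := avg_param_eq (reflectTranslate 0 χ) κ z (-x)
  have e : ∀ v, reflectTranslate 0 χ (-x - v) = χ (x + v) := fun v => by
    rw [reflectTranslate_apply]
    congr 1
    abel
  simp_rw [e] at h
  rw [← h]
  simp only [avg, reflectTranslate_apply]
  refine integral_congr_ae (Filter.Eventually.of_forall fun v => ?_)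
  simp only
  congr 2
  module

lemma integral_add_mul_comm {d : ℕ} (f g : Rd d → ℂ) (w : Rd d) :
    ∫ v, f (w + v) * g v = ∫ v, g (-w + v) * f v := by
  rw [← integral_add_left_eq_self (fun v => g (-w + v) * f v) w]
  refine integral_congr_ae (Filter.Eventually.of_forall fun v => ?_)
  simp only [neg_add_cancel_left]
  rw [mul_comm]

/-- Convolution is symmetric, so the small scale may be moved from the averaged function to the
averaging kernel. This makes the vanishing moments of `κ` available; `avg_dilate_comm` plays the
same part for two dilated kernels. -/
lemma avg_dilate_neg_one {d : ℕ} (κ Λ : 𝓢(Rd d, ℂ)) (y : Param) (w : Rd d) :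
    avg (dilate y κ) Λ (-1) w = avg Λ κ (-y) (-w) := by
  rw [avg_neg_param_eq, ← integral_add_mul_comm]
  simp [avg]

lemma avg_dilate_comm {d : ℕ} (κ Ψ : 𝓢(Rd d, ℂ)) (y z : Param) (w : Rd d) :
    avg (dilate y κ) Ψ (-z) w = avg (dilate z Ψ) κ (-y) (-w) := by
  rw [avg_neg_param_eq, avg_neg_param_eq, ← integral_add_mul_comm]

lemma avg_dilate {d : ℕ} (κ Ψ : 𝓢(Rd d, ℂ)) (y : Param) (ρ : ℝ) (w : Rd d) :
    avg (dilate y κ) Ψ ρ w = ((y : ℝ) ^ d)⁻¹ • avg κ Ψ (ρ / y) ((y : ℝ)⁻¹ • w) := by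
  simp only [avg, dilate_apply, smul_mul_assoc]
  rw [integral_smul]
  congr 1
  refine integral_congr_ae (Filter.Eventually.of_forall fun v => ?_)
  simp only
  rw [smul_sub, smul_smul, div_eq_inv_mul]

lemma eLpNorm_one_dilate {d : ℕ} {f : Rd d → ℂ} (hf : Measurable f) (y : Param) :
    eLpNorm (fun w => ((y : ℝ) ^ d)⁻¹ • f ((y : ℝ)⁻¹ • w)) 1 volume = eLpNorm f 1 volume := by
  have hy : (0 : ℝ) < y := y.2.1
  rw [eLpNorm_one_eq_lintegral_enorm, eLpNorm_one_eq_lintegral_enorm]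
  simp_rw [enorm_smul]
  rw [lintegral_const_mul' _ _ enorm_ne_top]
  have h1 := lintegral_map (μ := (volume : Measure (Rd d))) (f := fun x => ‖f x‖ₑ)
    (g := fun w => (y : ℝ)⁻¹ • w) hf.enorm (by fun_prop)
  rw [Measure.map_addHaar_smul _ (inv_ne_zero hy.ne'), lintegral_smul_measure] at h1
  rw [← h1, finrank_euclideanSpace_fin, smul_eq_mul, ← mul_assoc, Real.enorm_of_nonneg
    (by positivity), ← ENNReal.ofReal_mul (by positivity), abs_of_pos (by positivity), inv_pow,
    inv_inv, inv_mul_cancel₀ (by positivity), ENNReal.ofReal_one, one_mul]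

lemma eLpNorm_one_comp_neg {d : ℕ} (f : Rd d → ℂ) :
    eLpNorm (fun w => f (-w)) 1 volume = eLpNorm f 1 volume := by
  rw [eLpNorm_one_eq_lintegral_enorm, eLpNorm_one_eq_lintegral_enorm]
  exact lintegral_neg_eq_self (fun w => ‖f w‖ₑ)

lemma enorm_ofReal_le_rpow {x : ℝ} (hx : 0 < x) (M : ℕ) :
    ‖x‖ₑ ^ M = ENNReal.ofReal (x ^ (M : ℝ)) := by
  rw [Real.enorm_of_nonneg hx.le, ← ENNReal.ofReal_pow hx.le, Real.rpow_natCast]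

lemma iSup_eLpNorm_one_lt_top {d : ℕ} (M : ℕ) (χ : 𝓢(Rd d, ℂ)) :
    ⨆ a : Fin M → Fin d, eLpNorm (derivWord a χ) 1 volume < ⊤ := by
  simpa only [wNorm_zero] using iSup_wNorm_one_lt_top 0 M χ

lemma exists_eLpNorm_avg_dilate_neg_one_le {d M : ℕ} {κ : 𝓢(Rd d, ℂ)} (hκ : VanishMoments M κ)
    (Λ : 𝓢(Rd d, ℂ)) : ∃ C : ℝ≥0∞, C ≠ ⊤ ∧ ∀ y : Param,
      eLpNorm (avg (dilate y κ) Λ (-1)) 1 volume ≤ C * ENNReal.ofReal ((y : ℝ) ^ (M : ℝ)) := by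
  obtain ⟨C, hC, hb⟩ := eLpNorm_avg_le M hκ
  refine ⟨C * ⨆ a : Fin M → Fin d, eLpNorm (derivWord a Λ) 1 volume,
    (ENNReal.mul_lt_top hC.lt_top (iSup_eLpNorm_one_lt_top M Λ)).ne, fun y => ?_⟩
  rw [funext fun w => avg_dilate_neg_one κ Λ y w, eLpNorm_one_comp_neg]
  refine (hb Λ 1 (-y) le_rfl (by rw [abs_neg, abs_of_pos y.2.1]; exact y.2.2.le)).trans_eq ?_
  rw [enorm_neg, enorm_ofReal_le_rpow y.2.1]
  ring

/-- Almost orthogonality of different scales. Cancellation is taken from the kernel with the finer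
scale: for `y ≤ z` the moments of `κ` give `(y/z)^M`, which is the Schur kernel with `δ = M - r`;
for `z ≤ y` the moments of `Ψ` give `(z/y)^N`. -/
lemma exists_eLpNorm_avg_dilate_le {d M : ℕ} {κ Ψ : 𝓢(Rd d, ℂ)} (hκ : VanishMoments M κ)
    (hΨ : ∀ N, VanishMoments N Ψ) {r : ℝ} (hr : r < M) : ∃ δ : ℝ, 0 < δ ∧ ∃ C : ℝ≥0∞, C ≠ ⊤ ∧
      ∀ y z : Param, eLpNorm (avg (dilate y κ) Ψ (-z)) 1 volume ≤ C * schurKernel r δ y z := by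
  -- For `z ≤ y` the Schur kernel equals `(z/y)^(-r + δ)` with `δ = M - r`, so `N` has to exceed
  -- this exponent.
  obtain ⟨N, hN⟩ := exists_nat_gt (-r + (M - r))
  obtain ⟨C₁, hC₁, hb₁⟩ := eLpNorm_avg_le M hκ
  obtain ⟨C₂, hC₂, hb₂⟩ := eLpNorm_avg_le N (hΨ N)
  set S₁ := ⨆ a : Fin M → Fin d, eLpNorm (derivWord a Ψ) 1 volume
  set S₂ := ⨆ a : Fin N → Fin d, eLpNorm (derivWord a κ) 1 volume
  refine ⟨M - r, sub_pos.2 hr, C₁ * S₁ + C₂ * S₂, ENNReal.add_ne_top.2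
    ⟨(ENNReal.mul_lt_top hC₁.lt_top (iSup_eLpNorm_one_lt_top M Ψ)).ne,
      (ENNReal.mul_lt_top hC₂.lt_top (iSup_eLpNorm_one_lt_top N κ)).ne⟩, fun y z => ?_⟩
  have hy : (0 : ℝ) < y := y.2.1
  have hz : (0 : ℝ) < z := z.2.1
  rw [add_mul]
  rcases le_total (y : ℝ) z with h | h
  · refine le_trans ?_ le_self_add
    have e : avg (dilate y κ) Ψ (-z) = fun w => ((z : ℝ) ^ d)⁻¹ •
        avg Ψ κ (-y / z) ((z : ℝ)⁻¹ • -w) := funext fun w => by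
      rw [avg_dilate_comm, avg_dilate]
    rw [e, eLpNorm_one_comp_neg (fun w => ((z : ℝ) ^ d)⁻¹ • avg Ψ κ (-y / z) ((z : ℝ)⁻¹ • w)),
      eLpNorm_one_dilate (measurable_avg_right _ _ _)]
    refine (hb₁ Ψ 1 (-y / z) le_rfl ?_).trans ?_
    · rw [abs_div, abs_neg, abs_of_pos hy, abs_of_pos hz]
      exact (div_le_one hz).2 h
    · rw [neg_div, enorm_neg, enorm_ofReal_le_rpow (div_pos hy hz), mul_right_comm]
      gcongr
      refine ENNReal.ofReal_le_ofReal (le_of_eq ?_)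
      rw [min_eq_left (((div_le_one hz).2 h).trans ((one_le_div hy).2 h)), ← inv_div (y : ℝ) z,
        Real.inv_rpow (by positivity), Real.rpow_neg (by positivity), inv_inv,
        ← Real.rpow_add (div_pos hy hz)]
      congr 1
      ring
  · refine le_trans ?_ le_add_self
    have e : avg (dilate y κ) Ψ (-z) = fun w => ((y : ℝ) ^ d)⁻¹ •
        avg κ Ψ (-z / y) ((y : ℝ)⁻¹ • w) := funext fun w => avg_dilate _ _ _ _ _
    rw [e, eLpNorm_one_dilate (measurable_avg_right _ _ _)]
    refine (hb₂ κ 1 (-z / y) le_rfl ?_).trans ?_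
    · rw [abs_div, abs_neg, abs_of_pos hy, abs_of_pos hz]
      exact (div_le_one hy).2 h
    · rw [neg_div, enorm_neg, enorm_ofReal_le_rpow (div_pos hz hy), mul_right_comm]
      gcongr
      refine ENNReal.ofReal_le_ofReal ?_
      rw [min_eq_right (((div_le_one hy).2 h).trans ((one_le_div hz).2 h)),
        ← Real.rpow_add (div_pos hz hy)]
      exact Real.rpow_le_rpow_of_exponent_ge (div_pos hz hy) ((div_le_one hy).2 h) hN.le

/-! ### Norm bounds from the reproducing formula -/

lemma eLpNorm_integral_mul_le {d : ℕ} {Ω : Type*} [MeasurableSpace Ω] {p : ℝ≥0∞} (hp : 1 ≤ p)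
    {μ : Measure Ω} [SigmaFinite μ] {a : Ω → ℂ} {H : Ω → Rd d → ℂ} (ha : Measurable a)
    (hH : Measurable fun z : Ω × Rd d => H z.1 z.2) :
    eLpNorm (fun x => ∫ t, a t * H t x ∂μ) p volume
      ≤ ∫⁻ t, ‖a t‖ₑ * eLpNorm (H t) p volume ∂μ := by
  refine (eLpNorm_integral_le hp μ volume (F := fun t x => a t * H t x)
    ((ha.comp measurable_fst).mul hH).enorm).trans_eq (lintegral_congr fun t => ?_)
  exact eLpNorm_const_smul (a t) (H t) p volume

lemma eLpNorm_comp_sub_right {d : ℕ} {f : Rd d → ℂ} (hf : Continuous f) (v : Rd d) (p : ℝ≥0∞) :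
    eLpNorm (fun x => f (x - v)) p volume = eLpNorm f p volume :=
  eLpNorm_comp_measurePreserving (f := fun x : Rd d => x - v) hf.aestronglyMeasurable
    (measurePreserving_sub_right volume v)

lemma integral_prod_sub_left {d : ℕ} {Ω : Type*} [MeasurableSpace Ω] {μ : Measure Ω} [SFinite μ]
    (f : Ω × Rd d → ℂ) (w : Rd d) :
    ∫ z, f (z.1, w - z.2) ∂(μ.prod volume) = ∫ z, f z ∂(μ.prod volume) := by
  have hmp : MeasurePreserving (fun z : Ω × Rd d => (z.1, w - z.2)) (μ.prod volume)
      (μ.prod volume) :=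
    (MeasurePreserving.id μ).prod (Measure.measurePreserving_sub_left volume w)
  have he : MeasurableEmbedding (fun z : Ω × Rd d => (z.1, w - z.2)) :=
    (((MeasurableEquiv.refl Ω).prodCongr (MeasurableEquiv.subLeft w))).measurableEmbedding
  exact hmp.integral_comp he f

lemma measurable_eLpNorm_conv_dilate {d : ℕ} (T : 𝓢'(Rd d, ℂ)) (ψ : 𝓢(Rd d, ℂ)) (p : ℝ≥0∞) :
    Measurable fun z : Param => eLpNorm (conv T (dilate z ψ)) p volume :=
  measurable_eLpNorm_param p volume (F := fun z : Param × Rd d => conv T (dilate z.1 ψ) z.2)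
    (continuous_conv_dilate T ψ)

lemma lintegral_prod_enorm_mul {d : ℕ} {Ω : Type*} [MeasurableSpace Ω] {μ : Measure Ω} [SFinite μ]
    {A : Ω → Rd d → ℂ} {g : Ω → ℝ≥0∞} (hA : Measurable fun z : Ω × Rd d => A z.1 z.2)
    (hg : Measurable g) : ∫⁻ z : Ω × Rd d, ‖A z.1 z.2‖ₑ * g z.1 ∂(μ.prod volume)
      = ∫⁻ z, g z * eLpNorm (A z) 1 volume ∂μ := by
  rw [lintegral_prod (fun z : Ω × Rd d => ‖A z.1 z.2‖ₑ * g z.1)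
    (hA.enorm.mul (hg.comp measurable_fst)).aemeasurable]
  refine lintegral_congr fun z => ?_
  have hz : Measurable fun x => A z x := hA.comp measurable_prodMk_left
  rw [eLpNorm_one_eq_lintegral_enorm, mul_comm, ← lintegral_mul_const _ hz.enorm]

/-- Applied to `χ = f(w - ·)`, the reproducing formula writes `T * f` as a superposition of
convolutions of `T * η` and `T * (ψ_i)_z` with averages of `f`. Minkowski's inequality and
translation invariance finish. -/
lemma eLpNorm_conv_le_of_reproducing {d : ℕ} {ι : Type} [Fintype ι] {η Λ : 𝓢(Rd d, ℂ)}
    {ψ Ψ : ι → 𝓢(Rd d, ℂ)} {T : 𝓢'(Rd d, ℂ)}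
    (hrep : ∀ χ : 𝓢(Rd d, ℂ), T χ = (∫ x, avg χ Λ 1 x * conv T η x) +
        ∑ i, ∫ z : Param × Rd d, avg χ (Ψ i) z.1 z.2 * conv T (dilate z.1 (ψ i)) z.2
          ∂(parMeas.prod volume)) {p : ℝ≥0∞} (hp : 1 ≤ p) (f : 𝓢(Rd d, ℂ)) :
    eLpNorm (conv T f) p volume ≤ eLpNorm (avg f Λ (-1)) 1 volume * eLpNorm (conv T η) p volume +
      ∑ i, ∫⁻ z : Param, eLpNorm (conv T (dilate z (ψ i))) p volume *
        eLpNorm (avg f (Ψ i) (-z)) 1 volume ∂parMeas := by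
  have hm : ∀ κ : 𝓢(Rd d, ℂ), Measurable fun z : Param × Rd d => avg f κ (-z.1) z.2 := fun κ =>
    (measurable_avg f κ).comp ((measurable_subtype_coe.comp measurable_fst).neg.prodMk
      measurable_snd)
  have hH : ∀ κ : 𝓢(Rd d, ℂ), Measurable fun y : (Param × Rd d) × Rd d =>
      conv T (dilate y.1.1 κ) (y.2 - y.1.2) := fun κ =>
    ((continuous_conv_dilate T κ).comp (by fun_prop : Continuous fun y : (Param × Rd d) × Rd d =>
      (y.1.1, y.2 - y.1.2))).measurable
  have hH0 : Measurable fun y : Rd d × Rd d => conv T η (y.2 - y.1) :=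
    ((continuous_conv T η).comp (by fun_prop)).measurable
  have e : conv T f = (fun w => ∫ v, avg f Λ (-1) v * conv T η (w - v)) +
      ∑ i, fun w => ∫ z : Param × Rd d, avg f (Ψ i) (-z.1) z.2 *
        conv T (dilate z.1 (ψ i)) (w - z.2) ∂(parMeas.prod volume) := by
    ext w
    rw [conv, hrep]
    simp only [Pi.add_apply, Finset.sum_apply, avg_reflectTranslate]
    congr 1
    · rw [← integral_sub_left_eq_self _ volume w]
      simp
    · refine Finset.sum_congr rfl fun i _ => ?_
      rw [← integral_prod_sub_left _ w]
      simp
  have m0 : AEStronglyMeasurable (fun w => ∫ v, avg f Λ (-1) v * conv T η (w - v)) volume :=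
    (StronglyMeasurable.integral_prod_left' (f := fun y : Rd d × Rd d =>
      avg f Λ (-1) y.1 * conv T η (y.2 - y.1)) (((measurable_avg_right f Λ (-1)).comp
      measurable_fst).mul hH0).stronglyMeasurable).aestronglyMeasurable
  have mi : ∀ i, AEStronglyMeasurable (fun w => ∫ z : Param × Rd d, avg f (Ψ i) (-z.1) z.2 *
        conv T (dilate z.1 (ψ i)) (w - z.2) ∂(parMeas.prod volume)) volume := fun i =>
    (StronglyMeasurable.integral_prod_left' (f := fun y : (Param × Rd d) × Rd d =>
      avg f (Ψ i) (-y.1.1) y.1.2 * conv T (dilate y.1.1 (ψ i)) (y.2 - y.1.2))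
      (((hm (Ψ i)).comp measurable_fst).mul (hH (ψ i))).stronglyMeasurable).aestronglyMeasurable
  rw [e]
  refine (eLpNorm_add_le m0 (Finset.aestronglyMeasurable_sum _ fun i _ => mi i) hp).trans
    (add_le_add ?_ ((eLpNorm_sum_le (fun i _ => mi i) hp).trans
      (Finset.sum_le_sum fun i _ => ?_)))
  · refine (eLpNorm_integral_mul_le hp (μ := volume) (measurable_avg_right f Λ (-1)) hH0).trans ?_
    simp_rw [eLpNorm_comp_sub_right (continuous_conv T η)]
    rw [lintegral_mul_const _ (measurable_avg_right f Λ (-1)).enorm,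
      eLpNorm_one_eq_lintegral_enorm]
  · refine (eLpNorm_integral_mul_le hp (μ := parMeas.prod volume) (hm (Ψ i)) (hH (ψ i))).trans ?_
    simp_rw [eLpNorm_comp_sub_right (continuous_conv T _)]
    exact (lintegral_prod_enorm_mul (A := fun (z : Param) x => avg f (Ψ i) (-z) x) (hm (Ψ i))
      (measurable_eLpNorm_conv_dilate T (ψ i) p)).le

/-- Norm bounds for one Tauberian family imply those for any kernel with enough vanishing
moments. -/
theorem IsTauberian.epsNorm_conv_dilate_lt_top {d : ℕ} {ι : Type} [Fintype ι] {η : 𝓢(Rd d, ℂ)}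
    {ψ : ι → 𝓢(Rd d, ℂ)} (h : IsTauberian η ψ) {M : ℕ} {κ : 𝓢(Rd d, ℂ)}
    (hκ : VanishMoments M κ) {r : ℝ} (hr : r < M) {p q : ℝ≥0∞} (hp : 1 ≤ p) (hq : 1 ≤ q)
    {T : 𝓢'(Rd d, ℂ)} (h0 : eLpNorm (conv T η) p volume < ⊤)
    (h1 : ∀ i, epsNorm q r (fun z => eLpNorm (conv T (dilate z (ψ i))) p volume) < ⊤) :
    epsNorm q r (fun y => eLpNorm (conv T (dilate y κ)) p volume) < ⊤ := by
  obtain ⟨Λ, Ψ, hΨ, hrep⟩ := h.exists_reproducing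
  obtain ⟨C₀, hC₀, hb₀⟩ := exists_eLpNorm_avg_dilate_neg_one_le hκ Λ
  choose δ hδ C hC hb using fun i => exists_eLpNorm_avg_dilate_le hκ (hΨ i) hr
  have hm := fun i => measurable_eLpNorm_conv_dilate T (ψ i) p
  -- The low-frequency part decays like `y^M`, which has finite weighted norm since `r < M`; the
  -- remaining terms are Schur operators applied to the given norms.
  refine lt_of_le_of_lt (epsNorm_mono (F := fun y =>
    (C₀ * eLpNorm (conv T η) p volume) * ENNReal.ofReal ((y : ℝ) ^ (M : ℝ)) +
    ∑ i, C i * ∫⁻ z, eLpNorm (conv T (dilate z (ψ i))) p volume * schurKernel r (δ i) y z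
      ∂parMeas) le_rfl fun y => ?_) ?_
  · refine (eLpNorm_conv_le_of_reproducing (hrep T) hp (dilate y κ)).trans
      (add_le_add ?_ (Finset.sum_le_sum fun i _ => ?_))
    · refine (mul_le_mul' (hb₀ y) le_rfl).trans_eq ?_
      ring
    · rw [← lintegral_const_mul' _ _ (hC i)]
      refine lintegral_mono fun z => ?_
      refine (mul_le_mul' le_rfl (hb i y z)).trans_eq ?_
      ring
  · refine epsNorm_add_lt_top ((measurable_ofReal_rpow _).const_mul _)
      (epsNorm_const_mul_lt_top (ENNReal.mul_lt_top hC₀.lt_top h0).ne (epsNorm_rpow_lt_top q hr))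
      (epsNorm_sum_lt_top _ (fun i => (measurable_lintegral_schurKernel (hm i) _ _).const_mul _)
        fun i _ => epsNorm_const_mul_lt_top (hC i)
          (epsNorm_lintegral_schurKernel_lt_top hq (hδ i) (hm i) (h1 i)))

/-! ### Besov spaces are contained in the dual space -/

lemma lintegral_enorm_mul_le {d : ℕ} {p : ℝ≥0∞} (hp : 1 ≤ p) {f g : Rd d → ℂ}
    (hf : AEStronglyMeasurable f volume) (hg : AEStronglyMeasurable g volume) :
    ∫⁻ x, ‖f x * g x‖ₑ ≤ eLpNorm f p.conjExponent volume * eLpNorm g p volume := by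
  have : p.HolderConjugate p.conjExponent := ENNReal.HolderConjugate.conjExponent hp
  have h := eLpNorm_smul_le_mul_eLpNorm (p := p.conjExponent) (q := p) (r := 1)
    (μ := (volume : Measure (Rd d))) hg hf
  rwa [eLpNorm_one_eq_lintegral_enorm] at h

lemma one_le_conjExponent {p : ℝ≥0∞} (hp : 1 ≤ p) : 1 ≤ p.conjExponent :=
  have : p.HolderConjugate p.conjExponent := ENNReal.HolderConjugate.conjExponent hp
  ENNReal.HolderConjugate.one_le p.conjExponent p

/-- Hölder's inequality in the reproducing formula leaves `‖avg χ Ψ_i z‖_{p'}`, which is `O(z^N)`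
times the `W^{N,p'}`-norm of `χ`. With `N > -r` the scale integral converges by
`lintegral_rpow_mul_lt_top`. -/
lemma IsTauberian.mem_DLpDual {d : ℕ} {ι : Type} [Fintype ι] {η : 𝓢(Rd d, ℂ)}
    {ψ : ι → 𝓢(Rd d, ℂ)} (h : IsTauberian η ψ) {r : ℝ} {p q : ℝ≥0∞} (hp : 1 ≤ p) (hq : 1 ≤ q)
    {T : 𝓢'(Rd d, ℂ)} (h0 : eLpNorm (conv T η) p volume < ⊤)
    (h1 : ∀ i, epsNorm q r (fun z => eLpNorm (conv T (dilate z (ψ i))) p volume) < ⊤) :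
    T ∈ DLpDual d p := by
  obtain ⟨Λ, Ψ, hΨ, hrep⟩ := h.exists_reproducing
  obtain ⟨N, hN⟩ := exists_nat_gt (-r)
  obtain ⟨C₀, hC₀, hb₀⟩ := eLpNorm_avg_le 0 (κ := Λ) trivial
  choose C hC hb using fun i => eLpNorm_avg_le N (hΨ i N)
  have hm := fun i => measurable_eLpNorm_conv_dilate T (ψ i) p
  let I : ι → ℝ≥0∞ := fun i => ∫⁻ z : Param, ENNReal.ofReal ((z : ℝ) ^ (-(-(N : ℝ)))) *
    eLpNorm (conv T (dilate z (ψ i))) p volume ∂parMeas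
  have hI : ∀ i, I i < ⊤ := fun i =>
    lintegral_rpow_mul_lt_top hq (by linarith) (hm i) (h1 i)
  have hp' := one_le_conjExponent hp
  set K : ℝ≥0∞ := C₀ * eLpNorm (conv T η) p volume + ∑ i, C i * I i with hK
  have hKt : K ≠ ⊤ := ENNReal.add_ne_top.2 ⟨(ENNReal.mul_lt_top hC₀.lt_top h0).ne,
    (ENNReal.sum_lt_top.2 fun i _ => ENNReal.mul_lt_top (hC i).lt_top (hI i)).ne⟩
  refine Set.mem_iUnion.2 ⟨N, K.toNNReal, fun χ => ?_⟩
  rw [ENNReal.coe_toNNReal hKt, hrep T χ, hK, add_mul, Finset.sum_mul]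
  refine (enorm_add_le _ _).trans (add_le_add ?_ ((enorm_sum_le _ _).trans
    (Finset.sum_le_sum fun i _ => ?_)))
  · refine (enorm_integral_le_lintegral_enorm _).trans ((lintegral_enorm_mul_le hp
      (measurable_avg_right χ Λ 1).aestronglyMeasurable
      (continuous_conv T η).aestronglyMeasurable).trans ?_)
    have h2 := hb₀ χ p.conjExponent 1 hp' (by simp)
    rw [pow_zero, mul_one] at h2
    have h3 : eLpNorm (avg χ Λ 1) p.conjExponent volume
        ≤ C₀ * sobNorm N p.conjExponent volume χ :=
      h2.trans (mul_le_mul' le_rfl (iSup_le fun a => eLpNorm_derivWord_le_sobNorm (Nat.zero_le N)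
        a _ χ))
    refine (mul_le_mul' h3 le_rfl).trans_eq ?_
    ring
  · refine (enorm_integral_le_lintegral_enorm _).trans ?_
    have hmm : Measurable fun z : Param × Rd d =>
        ‖avg χ (Ψ i) z.1 z.2 * conv T (dilate z.1 (ψ i)) z.2‖ₑ :=
      ((measurable_avg_param χ (Ψ i)).mul (continuous_conv_dilate T (ψ i)).measurable).enorm
    rw [lintegral_prod (fun z : Param × Rd d =>
        ‖avg χ (Ψ i) z.1 z.2 * conv T (dilate z.1 (ψ i)) z.2‖ₑ) hmm.aemeasurable]
    have hz : ∀ z : Param, ∫⁻ x, ‖avg χ (Ψ i) z x * conv T (dilate z (ψ i)) x‖ₑ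
        ≤ (C i * sobNorm N p.conjExponent volume χ) * (ENNReal.ofReal ((z : ℝ) ^ (-(-(N : ℝ)))) *
          eLpNorm (conv T (dilate z (ψ i))) p volume) := fun z => by
      refine (lintegral_enorm_mul_le hp (measurable_avg_right χ (Ψ i) z).aestronglyMeasurable
        (continuous_conv T _).aestronglyMeasurable).trans ?_
      have h2 := hb i χ p.conjExponent z hp' (by rw [abs_of_pos z.2.1]; exact z.2.2.le)
      rw [enorm_ofReal_le_rpow z.2.1] at h2
      have h3 := h2.trans (mul_le_mul' le_rfl (iSup_le fun a =>
        eLpNorm_derivWord_le_sobNorm (le_refl N) a p.conjExponent χ))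
      refine (mul_le_mul' h3 le_rfl).trans_eq ?_
      rw [neg_neg]
      ring
    refine (lintegral_mono hz).trans_eq ?_
    have hmI : Measurable fun z : Param => ENNReal.ofReal ((z : ℝ) ^ (-(-(N : ℝ)))) *
        eLpNorm (conv T (dilate z (ψ i))) p volume := (measurable_ofReal_rpow _).mul (hm i)
    rw [lintegral_const_mul _ hmI]
    simp only [I]
    ring

/-! ### Duality -/

/-- The function `|G|^{a-2} conj G`. -/
noncomputable def dualFn {d : ℕ} (a : ℝ) (G : Rd d → ℂ) (x : Rd d) : ℂ :=
  ((‖G x‖ ^ (a - 2) : ℝ) : ℂ) * (starRingEnd ℂ) (G x)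

lemma dualFn_mul {d : ℕ} {a : ℝ} (ha : 0 < a) (G : Rd d → ℂ) (x : Rd d) :
    dualFn a G x * G x = ((‖G x‖ ^ a : ℝ) : ℂ) := by
  by_cases h : G x = 0
  · simp [h, Real.zero_rpow ha.ne']
  · have h0 : 0 < ‖G x‖ := norm_pos_iff.2 h
    rw [dualFn, mul_assoc, mul_comm ((starRingEnd ℂ) (G x)), Complex.mul_conj, ← Complex.ofReal_mul,
      Complex.normSq_eq_norm_sq, ← Real.rpow_natCast, ← Real.rpow_add h0]
    norm_num

/-- Equality can fail only at zeros of `G`: for `a = 1` the right side is `0 ^ 0 = 1` there. -/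
lemma norm_dualFn_le {d : ℕ} (a : ℝ) (G : Rd d → ℂ) (x : Rd d) :
    ‖dualFn a G x‖ ≤ ‖G x‖ ^ (a - 1) := by
  by_cases h : G x = 0
  · simp only [dualFn, h, map_zero, mul_zero, norm_zero]
    positivity
  · have h0 : 0 < ‖G x‖ := norm_pos_iff.2 h
    rw [dualFn, norm_mul, RCLike.norm_conj, Complex.norm_real, Real.norm_of_nonneg (by positivity)]
    nth_rewrite 2 [← Real.rpow_one ‖G x‖]
    rw [← Real.rpow_add h0]
    ring_nf
    rfl

lemma measurable_dualFn {d : ℕ} (a : ℝ) {G : Rd d → ℂ} (hG : Measurable G) :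
    Measurable (dualFn a G) :=
  (Complex.measurable_ofReal.comp (hG.norm.pow_const _)).mul
    (Complex.continuous_conj.measurable.comp hG)

lemma lintegral_le_of_forall_closedBall {d : ℕ} {f : Rd d → ℝ≥0∞} {c : ℝ≥0∞}
    (h : ∀ n : ℕ, ∫⁻ x in Metric.closedBall 0 n, f x ≤ c) : ∫⁻ x, f x ≤ c := by
  have hu : ⋃ n : ℕ, Metric.closedBall (0 : Rd d) n = Set.univ := Metric.iUnion_closedBall_nat 0
  rw [← setLIntegral_univ, ← hu, setLIntegral_iUnion_of_directed]
  · exact iSup_le h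
  · exact (monotone_nat_of_le_succ fun n => Metric.closedBall_subset_closedBall
      (by push_cast; linarith)).directed_le

lemma enorm_integral_indicator_dualFn_mul {d : ℕ} {G : Rd d → ℂ} (hG : Continuous G) {a : ℝ}
    (ha : 1 ≤ a) {n : ℕ} {s : Set (Rd d)} (hs : MeasurableSet s)
    (hsn : s ⊆ Metric.closedBall 0 n) :
    ‖∫ x, s.indicator (dualFn a G) x * G x‖ₑ = ∫⁻ x in s, ‖G x‖ₑ ^ a := by
  have ha0 : 0 < a := by linarith
  have e : (fun x => s.indicator (dualFn a G) x * G x)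
      = s.indicator fun x => ((‖G x‖ ^ a : ℝ) : ℂ) := by
    ext x
    by_cases hx : x ∈ s
    · simp [hx, dualFn_mul ha0]
    · simp [hx]
  have hi : IntegrableOn (fun x => ‖G x‖ ^ a) s :=
    (((hG.norm.rpow_const fun _ => Or.inr ha0.le).continuousOn.integrableOn_compact
      (isCompact_closedBall 0 (n : ℝ)))).mono_set hsn
  rw [e, integral_indicator hs, show ∫ x in s, ((‖G x‖ ^ a : ℝ) : ℂ)
    = ((∫ x in s, ‖G x‖ ^ a : ℝ) : ℂ) from integral_ofReal]
  rw [show ‖((∫ x in s, ‖G x‖ ^ a : ℝ) : ℂ)‖ₑ = ‖∫ x in s, ‖G x‖ ^ a‖ₑ by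
    rw [← ofReal_norm, Complex.norm_real, ofReal_norm], Real.enorm_of_nonneg
    (integral_nonneg fun x => by positivity), ofReal_integral_eq_lintegral_ofReal hi
    (Filter.Eventually.of_forall fun x => by positivity)]
  refine lintegral_congr fun x => ?_
  rw [← ENNReal.ofReal_rpow_of_nonneg (norm_nonneg _) ha0.le, ofReal_norm]

/-- The converse of Hölder's inequality for continuous functions. -/
lemma eLpNorm_le_of_forall_integral_mul_le {d : ℕ} {p : ℝ≥0∞} (hp : 1 ≤ p) {G : Rd d → ℂ}
    (hG : Continuous G) {C : ℝ≥0∞}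
    (h : ∀ (f : Rd d → ℂ) (n : ℕ) (K : ℝ), Measurable f → (∀ x, ‖f x‖ ≤ K) →
      (∀ x, x ∉ Metric.closedBall (0 : Rd d) n → f x = 0) →
      ‖∫ x, f x * G x‖ₑ ≤ C * eLpNorm f p.conjExponent volume) :
    eLpNorm G p volume ≤ C := by
  -- The test function is the dual function of `G` cut off to a bounded set, so that `f * G = ‖G‖ ^
  -- a` on this set.
  have key : ∀ (a : ℝ) (_ : 1 ≤ a) (n : ℕ) (s : Set (Rd d)) (_ : MeasurableSet s)
      (_ : s ⊆ Metric.closedBall 0 n), ∫⁻ x in s, ‖G x‖ₑ ^ a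
        ≤ C * eLpNorm (s.indicator (dualFn a G)) p.conjExponent volume := by
    intro a ha n s hs hsn
    obtain ⟨K, hK⟩ := (isCompact_closedBall (0 : Rd d) (n : ℝ)).exists_bound_of_continuousOn
      (hG.norm.rpow_const fun _ => Or.inr (sub_nonneg.2 ha)).continuousOn
    rw [← enorm_integral_indicator_dualFn_mul hG ha hs hsn]
    refine h _ n (max K 0) ((measurable_dualFn a hG.measurable).indicator hs) (fun x => ?_)
      fun x hx => Set.indicator_of_notMem (fun h' => hx (hsn h')) _
    by_cases hx : x ∈ s
    · rw [Set.indicator_of_mem hx]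
      exact (norm_dualFn_le a G x).trans (((le_abs_self _).trans (hK x (hsn hx))).trans
        (le_max_left _ _))
    · rw [Set.indicator_of_notMem hx, norm_zero]
      exact le_max_right _ _
  -- For `p = ∞` one tests with `a = 1` on arbitrary measurable subsets of balls: `∫_s ‖G‖ ≤ C |s|`
  -- for all `s` forces `‖G‖ ≤ C` almost everywhere. For finite `p` one tests with `a = p` on balls.
  by_cases hpt : p = ⊤
  · subst hpt
    have hall : ∀ n : ℕ, ∀ᵐ x ∂(volume.restrict (Metric.closedBall (0 : Rd d) n)), ‖G x‖ₑ ≤ C := by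
      intro n
      refine ae_le_of_forall_setLIntegral_le_of_sigmaFinite hG.measurable.enorm fun s hs _ => ?_
      rw [Measure.restrict_restrict hs]
      have h1 := key 1 le_rfl n (s ∩ Metric.closedBall 0 n) (hs.inter measurableSet_closedBall)
        Set.inter_subset_right
      simp only [ENNReal.rpow_one] at h1
      refine h1.trans ?_
      rw [setLIntegral_const]
      gcongr
      rw [show (⊤ : ℝ≥0∞).conjExponent = 1 by simp [ENNReal.conjExponent],
        eLpNorm_one_eq_lintegral_enorm, ← lintegral_indicator_one
        (hs.inter measurableSet_closedBall)]
      refine lintegral_mono fun x => ?_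
      by_cases hx : x ∈ s ∩ Metric.closedBall 0 n
      · rw [Set.indicator_of_mem hx, Set.indicator_of_mem hx, Pi.one_apply, ← ofReal_norm,
          ENNReal.ofReal_le_one]
        exact (norm_dualFn_le 1 G x).trans (by simp)
      · rw [Set.indicator_of_notMem hx, Set.indicator_of_notMem hx, enorm_zero]
    rw [eLpNorm_exponent_top]
    refine essSup_le_of_ae_le C ?_
    have h2 := (ae_restrict_iUnion_iff (μ := (volume : Measure (Rd d)))
      (fun n : ℕ => Metric.closedBall (0 : Rd d) n) fun x => ‖G x‖ₑ ≤ C).2 hall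
    rwa [Metric.iUnion_closedBall_nat, Measure.restrict_univ] at h2
  · have hr := ENNReal.one_le_toReal hpt hp
    set r := p.toReal with hr_def
    have hr0 : 0 < r := by linarith
    have hp0 : p ≠ 0 := (zero_lt_one.trans_le hp).ne'
    rw [eLpNorm_eq_lintegral_rpow_enorm_toReal hp0 hpt, ← hr_def]
    suffices hs : ∫⁻ x, ‖G x‖ₑ ^ r ≤ C ^ r by
      calc _ ≤ (C ^ r) ^ (1 / r) := by gcongr
        _ = C := by rw [← ENNReal.rpow_mul, mul_one_div_cancel hr0.ne', ENNReal.rpow_one]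
    refine lintegral_le_of_forall_closedBall fun n => ?_
    set I := ∫⁻ x in Metric.closedBall (0 : Rd d) n, ‖G x‖ₑ ^ r with hI
    have h1 := key r hr n (Metric.closedBall 0 n) measurableSet_closedBall le_rfl
    have h2 : eLpNorm ((Metric.closedBall (0 : Rd d) n).indicator (dualFn r G)) p.conjExponent
        volume ≤ I ^ (1 - 1 / r) := by
      have hle : ∀ x, ‖(Metric.closedBall (0 : Rd d) n).indicator (dualFn r G) x‖ₑ
          ≤ (Metric.closedBall (0 : Rd d) n).indicator (fun x => ‖G x‖ₑ ^ (r - 1)) x := fun x => by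
        by_cases hx : x ∈ Metric.closedBall (0 : Rd d) n
        · rw [Set.indicator_of_mem hx, Set.indicator_of_mem hx, ← ofReal_norm, ← ofReal_norm,
            ENNReal.ofReal_rpow_of_nonneg (norm_nonneg _) (sub_nonneg.2 hr)]
          exact ENNReal.ofReal_le_ofReal (norm_dualFn_le r G x)
        · simp [Set.indicator_of_notMem hx]
      rcases hr.eq_or_lt with hr1 | hr1
      · have hp1 : p = 1 := by
          rw [← ENNReal.ofReal_toReal hpt, ← hr_def, ← hr1, ENNReal.ofReal_one]
        rw [hp1, show (1 : ℝ≥0∞).conjExponent = ⊤ by simp [ENNReal.conjExponent], ← hr1,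
          eLpNorm_exponent_top]
        simp only [ne_eq, one_ne_zero, not_false_eq_true, div_self, sub_self, ENNReal.rpow_zero]
        refine essSup_le_of_ae_le 1 (Filter.Eventually.of_forall fun x => ?_)
        rw [hr1]
        refine (hle x).trans ?_
        rw [← hr1, sub_self]
        by_cases hx : x ∈ Metric.closedBall (0 : Rd d) n
        · simp [Set.indicator_of_mem hx]
        · simp [Set.indicator_of_notMem hx]
      · have : p.HolderConjugate p.conjExponent := ENNReal.HolderConjugate.conjExponent hp
        have hconj := ENNReal.HolderConjugate.toReal (q := p.conjExponent) hr1
        have hq0 : 0 < p.conjExponent.toReal := hconj.symm.pos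
        have hq' := ENNReal.toReal_pos_iff.1 hq0
        rw [eLpNorm_eq_lintegral_rpow_enorm_toReal hq'.1.ne' hq'.2.ne]
        have he : 1 / p.conjExponent.toReal = 1 - 1 / r := by
          rw [one_div, one_div, hconj.one_sub_inv]
        rw [he]
        refine ENNReal.rpow_le_rpow ?_ (sub_nonneg.2 ((div_le_one hr0).2 hr))
        rw [hI, ← lintegral_indicator measurableSet_closedBall]
        refine lintegral_mono fun x => (ENNReal.rpow_le_rpow (hle x) hq0.le).trans ?_
        by_cases hx : x ∈ Metric.closedBall (0 : Rd d) n
        · rw [Set.indicator_of_mem hx, Set.indicator_of_mem hx, ← ENNReal.rpow_mul,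
            hconj.sub_one_mul_conj]
        · simp [Set.indicator_of_notMem hx, ENNReal.zero_rpow_of_pos hq0]
    have hIt : I ≠ ⊤ := by
      have hi : IntegrableOn (fun x => ‖G x‖ ^ r) (Metric.closedBall (0 : Rd d) n) :=
        (hG.norm.rpow_const fun _ => Or.inr hr0.le).continuousOn.integrableOn_compact
          (isCompact_closedBall 0 (n : ℝ))
      refine (lt_of_le_of_lt (lintegral_mono fun x => ?_) hi.lintegral_lt_top).ne
      rw [← ENNReal.ofReal_rpow_of_nonneg (norm_nonneg _) hr0.le, ofReal_norm]
    by_cases hI0 : I = 0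
    · rw [hI0]; exact bot_le
    -- So far `I ≤ C * I ^ (1 - 1 / r)`. Restriction to a ball made `I` finite, hence the common
    -- factor may be cancelled.
    have h3 : I ^ (1 / r) ≤ C := by
      have h4 := h1.trans (mul_le_mul' le_rfl h2)
      have h5 : I = I ^ (1 / r) * I ^ (1 - 1 / r) := by
        rw [← ENNReal.rpow_add _ _ hI0 hIt]
        simp
      rw [← hI] at h4
      nth_rewrite 1 [h5] at h4
      have h6 : I ^ (1 - 1 / r) ≠ ⊤ := ENNReal.rpow_ne_top_of_nonneg
        (sub_nonneg.2 ((div_le_one hr0).2 hr)) hIt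
      have h7 : I ^ (1 - 1 / r) ≠ 0 := by
        simp [ENNReal.rpow_eq_zero_iff, hI0, hIt]
      exact (ENNReal.mul_le_mul_iff_left h7 h6).1 h4
    calc I = (I ^ (1 / r)) ^ r := by
          rw [← ENNReal.rpow_mul, one_div_mul_cancel hr0.ne', ENNReal.rpow_one]
      _ ≤ C ^ r := by gcongr

/-! ### Convolutions with elements of the dual space -/

lemma lineDerivOp_reflectTranslate {d : ℕ} (x v : Rd d) (ψ : 𝓢(Rd d, ℂ)) :
    ∂_{v} (reflectTranslate x ψ) = (-1 : ℝ) • reflectTranslate x (∂_{v} ψ) := by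
  ext u
  rw [_root_.smul_apply, reflectTranslate_apply, lineDerivOp_apply_eq_fderiv,
    lineDerivOp_apply_eq_fderiv]
  have h1 : HasFDerivAt (fun u => x - u) (-ContinuousLinearMap.id ℝ (Rd d)) u :=
    (hasFDerivAt_id u).const_sub x
  have h2 := (ψ.hasFDerivAt (x - u)).comp u h1
  have h3 : (reflectTranslate x ψ : Rd d → ℂ) = ψ ∘ fun u => x - u :=
    funext fun u => reflectTranslate_apply x ψ u
  rw [h3, h2.fderiv]
  simp

lemma iteratedLineDerivOp_reflectTranslate {d m : ℕ} (x : Rd d) (v : Fin m → Rd d)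
    (ψ : 𝓢(Rd d, ℂ)) :
    ∂^{v} (reflectTranslate x ψ) = ((-1 : ℝ) ^ m) • reflectTranslate x (∂^{v} ψ) := by
  induction m with
  | zero => simp
  | succ m ih =>
    rw [iteratedLineDerivOp_succ_left, ih, iteratedLineDerivOp_succ_left, lineDerivOp_smul,
      lineDerivOp_reflectTranslate, smul_smul, pow_succ]

lemma integrable_mul_seminorm_reflectTranslate {d : ℕ} {f : Rd d → ℂ} {n : ℕ} {K : ℝ}
    (hf : Measurable f) (hK : ∀ x, ‖f x‖ ≤ K)
    (hs : ∀ x, x ∉ Metric.closedBall (0 : Rd d) n → f x = 0) (ψ : 𝓢(Rd d, ℂ)) (k l : ℕ) :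
    Integrable fun x => ‖f x‖ * SchwartzMap.seminorm ℝ k l (reflectTranslate x ψ) := by
  have hc : Continuous fun x : Rd d => SchwartzMap.seminorm ℝ k l (reflectTranslate x ψ) :=
    (continuous_seminorm k l).comp (continuous_reflectTranslate ψ)
  have hi : IntegrableOn (fun x => K * SchwartzMap.seminorm ℝ k l (reflectTranslate x ψ))
      (Metric.closedBall 0 n) :=
    (hc.const_mul K).continuousOn.integrableOn_compact (isCompact_closedBall 0 (n : ℝ))
  refine (hi.integrable_indicator measurableSet_closedBall).mono'
    (hf.norm.mul hc.measurable).aestronglyMeasurable (Filter.Eventually.of_forall fun x => ?_)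
  by_cases hx : x ∈ Metric.closedBall (0 : Rd d) n
  · rw [Set.indicator_of_mem hx, norm_mul, norm_norm, Real.norm_of_nonneg (apply_nonneg _ _)]
    exact mul_le_mul_of_nonneg_right (hK x) (apply_nonneg _ _)
  · rw [Set.indicator_of_notMem hx, hs x hx]
    simp

/-- Elements of `W_0^{-k,p}` are mapped to `L^p` by convolution with Schwartz functions. -/
theorem exists_eLpNorm_conv_le {d k : ℕ} {p : ℝ≥0∞} (hp : 1 ≤ p) {T : 𝓢'(Rd d, ℂ)}
    (hT : T ∈ negSobolevSpace d k p) : ∃ C : ℝ≥0∞, C ≠ ⊤ ∧ ∀ ψ : 𝓢(Rd d, ℂ),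
      eLpNorm (conv T ψ) p volume ≤ C * sobNorm k 1 volume ψ := by
  obtain ⟨C, hC⟩ := hT
  refine ⟨C, ENNReal.coe_ne_top, fun ψ => ?_⟩
  refine eLpNorm_le_of_forall_integral_mul_le hp (continuous_conv T ψ) fun f n K hf hK hs => ?_
  have hi := integrable_mul_seminorm_reflectTranslate hf hK hs ψ
  -- By duality it suffices to integrate `T * ψ` against bounded `f` of bounded support. This
  -- integral is `T` evaluated at the convolution of `f` with the reflected `ψ`; the derivatives of
  -- that function fall on `ψ`, and Young's inequality bounds them in `L^{p'}`.
  have e := T.apply_weakIntegral hf.aestronglyMeasurable (continuous_reflectTranslate ψ) hi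
  change _ = ∫ x, f x * conv T ψ x at e
  rw [← e, mul_assoc]
  refine (hC _).trans (mul_le_mul' le_rfl ?_)
  rw [sobNorm_eq_iSup_derivWord]
  refine iSup_le fun m => iSup_le fun a => ?_
  have h1 : (derivWord a (weakIntegral volume hf.aestronglyMeasurable
      (continuous_reflectTranslate ψ) hi) : Rd d → ℂ)
      = ((-1 : ℝ) ^ (m : ℕ)) • fun u => ∫ t, derivWord a ψ t * f (u + t) := by
    ext u
    rw [derivWord, iteratedLineDerivOp_weakIntegral, Pi.smul_apply, ← integral_smul,
      ← integral_sub_right_eq_self (fun t => ((-1 : ℝ) ^ (m : ℕ)) • (derivWord a ψ t * f (u + t)))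
      u]
    refine integral_congr_ae (Filter.Eventually.of_forall fun x => ?_)
    simp only [iteratedLineDerivOp_reflectTranslate, _root_.smul_apply, reflectTranslate_apply,
      add_sub_cancel, mul_smul_comm]
    rw [mul_comm]
  rw [h1, eLpNorm_const_smul]
  have h2 : ‖((-1 : ℝ) ^ (m : ℕ))‖ₑ = 1 := by
    rw [enorm_pow, enorm_neg, enorm_one, one_pow]
  rw [h2, one_mul]
  refine (eLpNorm_integral_mul_le (one_le_conjExponent hp) (μ := volume)
    (H := fun t u => f (u + t)) (derivWord a ψ).continuous.measurable
    (hf.comp (measurable_snd.add measurable_fst))).trans ?_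
  have h3 : ∀ t : Rd d, eLpNorm (fun u => f (u + t)) p.conjExponent volume
      = eLpNorm f p.conjExponent volume := fun t =>
    eLpNorm_comp_measurePreserving (f := fun u : Rd d => u + t) hf.aestronglyMeasurable
      (measurePreserving_add_right volume t)
  simp_rw [h3]
  rw [lintegral_mul_const _ (derivWord a ψ).continuous.measurable.enorm,
    ← eLpNorm_one_eq_lintegral_enorm]
  gcongr
  exact eLpNorm_derivWord_le_sobNorm (Nat.lt_succ_iff.1 m.2) a 1 ψ

lemma eLpNorm_conv_lt_top {d : ℕ} {p : ℝ≥0∞} (hp : 1 ≤ p) {T : 𝓢'(Rd d, ℂ)}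
    (hT : T ∈ DLpDual d p) (ψ : 𝓢(Rd d, ℂ)) : eLpNorm (conv T ψ) p volume < ⊤ := by
  obtain ⟨k, hk⟩ := Set.mem_iUnion.1 hT
  obtain ⟨C, hC, hb⟩ := exists_eLpNorm_conv_le hp hk
  exact (hb ψ).trans_lt (ENNReal.mul_lt_top hC.lt_top (sobNorm_one_lt_top k ψ))

lemma sobNorm_one_dilate_le {d : ℕ} (k : ℕ) (κ : 𝓢(Rd d, ℂ)) (ε : Param) :
    sobNorm k 1 volume (dilate ε κ) ≤ ENNReal.ofReal ((ε : ℝ) ^ (-(k : ℝ))) * sobNorm k 1 volume κ := by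
  have hε : (0 : ℝ) < ε := ε.2.1
  rw [sobNorm_eq_iSup_derivWord]
  refine iSup_le fun m => iSup_le fun a => ?_
  have hm : (m : ℕ) ≤ k := Nat.lt_succ_iff.1 m.2
  have h1 : (derivWord a (dilate ε κ) : Rd d → ℂ)
      = ((ε : ℝ)⁻¹ ^ (m : ℕ)) • fun w => ((ε : ℝ) ^ d)⁻¹ • derivWord a κ ((ε : ℝ)⁻¹ • w) := by
    ext u
    rw [derivWord, iteratedLineDerivOp_dilate]
    rfl
  rw [h1, eLpNorm_const_smul, eLpNorm_one_dilate (derivWord a κ).continuous.measurable,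
    Real.enorm_of_nonneg (by positivity)]
  gcongr
  · rw [Real.rpow_neg hε.le, Real.rpow_natCast, ← inv_pow]
    exact pow_le_pow_right₀ (one_le_inv_param ε) hm
  · exact eLpNorm_derivWord_le_sobNorm hm a 1 κ

lemma sobNorm_mollify_eq {d : ℕ} (k : ℕ) (p : ℝ≥0∞) (φ : 𝓢(Rd d, ℂ)) (T : 𝓢'(Rd d, ℂ))
    (ε : Param) : sobNorm k p volume (mollify φ T ε)
      = ⨆ (m : Fin (k + 1)) (a : Fin (m : ℕ) → Fin d), ENNReal.ofReal ((ε : ℝ) ^ (-((m : ℕ) : ℝ))) *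
        eLpNorm (conv T (dilate ε (derivWord a φ))) p volume := by
  have hε : (0 : ℝ) < ε := ε.2.1
  unfold sobNorm
  refine iSup_congr fun m => iSup_congr fun a => ?_
  have h1 : (fun x => iteratedFDeriv ℝ (m : ℕ) (mollify φ T ε) x fun j => stdVec (a j))
      = ((ε : ℝ)⁻¹ ^ (m : ℕ)) • conv T (dilate ε (derivWord a φ)) := by
    ext x
    rw [iteratedFDeriv_mollify]
    rfl
  rw [h1, eLpNorm_const_smul, Real.enorm_of_nonneg (by positivity), Real.rpow_neg hε.le,
    Real.rpow_natCast, inv_pow]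

lemma sobNorm_restrict_le {d : ℕ} (k : ℕ) (p : ℝ≥0∞) (U : Set (Rd d)) (f : Rd d → ℂ) :
    sobNorm k p (volume.restrict U) f ≤ sobNorm k p volume f :=
  iSup_mono fun _ => iSup_mono fun _ => eLpNorm_mono_measure _ Measure.restrict_le_self

lemma exists_epsNorm_sobNorm_mollify_lt_top {d : ℕ} {p : ℝ≥0∞} (q : ℝ≥0∞) (hp : 1 ≤ p)
    (φ : 𝓢(Rd d, ℂ)) {T : 𝓢'(Rd d, ℂ)} (hT : T ∈ DLpDual d p) (k : ℕ) :
    ∃ s : ℝ, epsNorm q (-s) (fun ε => sobNorm k p volume (mollify φ T ε)) < ⊤ := by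
  obtain ⟨k₀, hk⟩ := Set.mem_iUnion.1 hT
  obtain ⟨C, hC, hb⟩ := exists_eLpNorm_conv_le hp hk
  set S : ℝ≥0∞ := ⨆ (m : Fin (k + 1)) (a : Fin (m : ℕ) → Fin d), sobNorm k₀ 1 volume (derivWord a φ)
    with hS
  have hSt : S < ⊤ := iSup_lt_top_of_finite fun m => iSup_lt_top_of_finite fun a =>
    sobNorm_one_lt_top k₀ _
  -- The `k` derivatives of the net cost `ε^{-k}`, the order `k₀` of `T` costs `ε^{-k₀}`, and the
  -- extra `1` secures integrability against `dε/ε`.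
  refine ⟨k + k₀ + 1, lt_of_le_of_lt (epsNorm_mono (F := fun ε => (C * S) *
    ENNReal.ofReal ((ε : ℝ) ^ (-((k : ℝ) + k₀)))) le_rfl fun ε => ?_)
    (epsNorm_const_mul_lt_top (ENNReal.mul_lt_top hC.lt_top hSt).ne
      (epsNorm_rpow_lt_top q (by linarith)))⟩
  have hε : (0 : ℝ) < ε := ε.2.1
  rw [sobNorm_mollify_eq]
  refine iSup_le fun m => iSup_le fun a => ?_
  have hm : ((m : ℕ) : ℝ) ≤ k := by exact_mod_cast Nat.lt_succ_iff.1 m.2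
  have h1 : sobNorm k₀ 1 volume (derivWord a φ) ≤ S :=
    le_iSup₂ (f := fun (m : Fin (k + 1)) (a : Fin (m : ℕ) → Fin d) =>
      sobNorm k₀ 1 volume (derivWord a φ)) m a
  calc _ ≤ ENNReal.ofReal ((ε : ℝ) ^ (-(k : ℝ))) *
        (C * (ENNReal.ofReal ((ε : ℝ) ^ (-(k₀ : ℝ))) * S)) := by
        gcongr ENNReal.ofReal ?_ * ?_
        · exact Real.rpow_le_rpow_of_exponent_ge hε ε.2.2.le (by linarith)
        · refine (hb _).trans (mul_le_mul' le_rfl ((sobNorm_one_dilate_le k₀ _ ε).trans ?_))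
          gcongr
    _ = (C * S) * (ENNReal.ofReal ((ε : ℝ) ^ (-(k : ℝ))) *
        ENNReal.ofReal ((ε : ℝ) ^ (-(k₀ : ℝ)))) := by ring
    _ = _ := by
        rw [← ENNReal.ofReal_mul (by positivity), ← Real.rpow_add hε, neg_add]

lemma mollify_mem_globalNets_iff {d : ℕ} {p q : ℝ≥0∞} (hp : 1 ≤ p) (φ : 𝓢(Rd d, ℂ))
    {T : 𝓢'(Rd d, ℂ)} (hT : T ∈ DLpDual d p) (k : ℕ) (σ : ℝ) :
    mollify φ T ∈ globalNets d q p k σ ↔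
      epsNorm q σ (fun ε => sobNorm k p volume (mollify φ T ε)) < ⊤ := by
  refine ⟨fun h => h.2, fun h => ⟨⟨isContNet_mollify φ T, fun k U _ _ => ?_⟩, h⟩⟩
  obtain ⟨s, hs⟩ := exists_epsNorm_sobNorm_mollify_lt_top q hp φ hT k
  exact ⟨s, (epsNorm_mono le_rfl fun ε => sobNorm_restrict_le k p U _).trans_lt hs⟩

theorem mollify_mem_moderateNets {d : ℕ} {p q : ℝ≥0∞} (hp : 1 ≤ p) (φ : 𝓢(Rd d, ℂ))
    {T : 𝓢'(Rd d, ℂ)} (hT : T ∈ DLpDual d p) : mollify φ T ∈ moderateNets d q p := by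
  refine Set.mem_iInter.2 fun k => ?_
  obtain ⟨s, hs⟩ := exists_epsNorm_sobNorm_mollify_lt_top q hp φ hT k
  exact Set.mem_iUnion.2 ⟨s, (mollify_mem_globalNets_iff hp φ hT k _).2 hs⟩

/-! ### Distributions given by `L^p` functions -/

lemma ae_lt_top_of_eLpNorm_lt_top {d : ℕ} {p : ℝ≥0∞} (hp : 1 ≤ p) {g : Rd d → ℝ≥0∞}
    (hg : Measurable g) (h : eLpNorm g p volume < ⊤) : ∀ᵐ x, g x < ⊤ := by
  by_cases hpt : p = ⊤
  · subst hpt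
    rw [eLpNorm_exponent_top] at h
    filter_upwards [ae_le_eLpNormEssSup (f := g) (μ := (volume : Measure (Rd d)))] with x hx
    exact lt_of_le_of_lt hx h
  · have hr : 0 < p.toReal := by linarith [ENNReal.one_le_toReal hpt hp]
    rw [eLpNorm_lt_top_iff_lintegral_rpow_enorm_lt_top (zero_lt_one.trans_le hp).ne' hpt] at h
    filter_upwards [ae_lt_top (hg.enorm.pow_const _) h.ne] with x hx
    simpa [hr] using ENNReal.rpow_lt_top_iff_of_pos hr |>.1 hx

lemma lintegral_mul_lt_top {d : ℕ} {p : ℝ≥0∞} (hp : 1 ≤ p) (χ : 𝓢(Rd d, ℂ)) {g : Rd d → ℝ≥0∞}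
    (hg : Measurable g) (h : eLpNorm g p volume < ⊤) : ∫⁻ x, ‖χ x‖ₑ * g x < ⊤ := by
  have hae := ae_lt_top_of_eLpNorm_lt_top hp hg h
  have e : ∀ᵐ x, ‖((g x).toReal : ℂ)‖ₑ = ‖g x‖ₑ := by
    filter_upwards [hae] with x hx
    rw [← ofReal_norm, Complex.norm_real, Real.norm_of_nonneg ENNReal.toReal_nonneg,
      ENNReal.ofReal_toReal hx.ne]
    rfl
  have h2 : eLpNorm (fun x => ((g x).toReal : ℂ)) p volume = eLpNorm g p volume :=
    eLpNorm_congr_enorm_ae e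
  have h1 := lintegral_enorm_mul_le hp χ.continuous.aestronglyMeasurable
    (Complex.measurable_ofReal.comp hg.ennreal_toReal).aestronglyMeasurable
  refine lt_of_le_of_lt ((lintegral_mono_ae ?_).trans h1) (ENNReal.mul_lt_top
    (χ.memLp _ _).2 (h2.trans_lt h))
  filter_upwards [e] with x hx
  rw [enorm_mul]
  exact mul_le_mul' le_rfl hx.ge

/-- Absolute convergence in `L^p` gives membership in `L^p`; by Hölder against `χ` it also gives the
integrability on the product space that Fubini requires. -/
lemma memLp_integral_kernel {d : ℕ} {Ω : Type*} [MeasurableSpace Ω] {μ : Measure Ω}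
    [SigmaFinite μ] {p : ℝ≥0∞} (hp : 1 ≤ p) {c : Ω → ℂ} {k : Ω → Rd d → ℂ}
    (hc : Measurable c) (hk : Measurable fun z : Ω × Rd d => k z.1 z.2)
    (hg : eLpNorm (fun u => ∫⁻ t, ‖k t u * c t‖ₑ ∂μ) p volume < ⊤) :
    MemLp (fun u => ∫ t, k t u * c t ∂μ) p volume ∧ ∀ χ : 𝓢(Rd d, ℂ),
      Integrable (fun u => χ u * ∫ t, k t u * c t ∂μ) ∧
      ∫ u, χ u * ∫ t, k t u * c t ∂μ = ∫ t, (∫ u, χ u * k t u) * c t ∂μ := by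
  have hm : Measurable fun z : Ω × Rd d => k z.1 z.2 * c z.1 := hk.mul (hc.comp measurable_fst)
  have hf : StronglyMeasurable fun u => ∫ t, k t u * c t ∂μ :=
    StronglyMeasurable.integral_prod_left' (f := fun z : Ω × Rd d => k z.1 z.2 * c z.1)
      hm.stronglyMeasurable
  have hgm : Measurable fun u => ∫⁻ t, ‖k t u * c t‖ₑ ∂μ :=
    Measurable.lintegral_prod_left' (f := fun z : Ω × Rd d => ‖k z.1 z.2 * c z.1‖ₑ) hm.enorm
  refine ⟨⟨hf.aestronglyMeasurable, lt_of_le_of_lt (eLpNorm_mono_enorm fun u => ?_) hg⟩,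
    fun χ => ?_⟩
  · exact enorm_integral_le_lintegral_enorm _
  have hH : ∫⁻ u, ‖χ u‖ₑ * ∫⁻ t, ‖k t u * c t‖ₑ ∂μ < ⊤ :=
    lintegral_mul_lt_top hp χ hgm hg
  have hint : Integrable (fun z : Ω × Rd d => χ z.2 * (k z.1 z.2 * c z.1)) (μ.prod volume) := by
    have hm' : Measurable fun z : Ω × Rd d => χ z.2 * (k z.1 z.2 * c z.1) :=
      (χ.continuous.measurable.comp measurable_snd).mul hm
    refine ⟨hm'.aestronglyMeasurable, ?_⟩
    rw [HasFiniteIntegral, lintegral_prod_symm _ hm'.enorm.aemeasurable]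
    refine lt_of_le_of_lt (lintegral_mono fun u => ?_) hH
    simp_rw [enorm_mul (χ u)]
    rw [lintegral_const_mul' _ _ enorm_ne_top]
  have e : ∀ u, χ u * ∫ t, k t u * c t ∂μ = ∫ t, χ u * (k t u * c t) ∂μ := fun u =>
    (integral_const_mul _ _).symm
  simp_rw [e]
  refine ⟨hint.integral_prod_right, ?_⟩
  rw [← integral_integral_swap (f := fun t u => χ u * (k t u * c t)) hint]
  refine integral_congr_ae (Filter.Eventually.of_forall fun t => ?_)
  simp only
  rw [← integral_mul_const]
  simp_rw [mul_assoc]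

/-- Young's inequality for absolute values, integrated over a parameter. The substitution `x = u +
v` turns the kernel into a superposition of translates of `H z`. -/
lemma eLpNorm_lintegral_translate_le {d : ℕ} {Ω : Type*} [MeasurableSpace Ω] {μ : Measure Ω}
    [SigmaFinite μ] {p : ℝ≥0∞} (hp : 1 ≤ p) {A H : Ω → Rd d → ℂ}
    (hA : Measurable fun z : Ω × Rd d => A z.1 z.2)
    (hH : Measurable fun z : Ω × Rd d => H z.1 z.2) (hHc : ∀ z, Continuous (H z)) :
    eLpNorm (fun u => ∫⁻ t : Ω × Rd d, ‖A t.1 (t.2 - u) * H t.1 t.2‖ₑ ∂(μ.prod volume)) p volume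
      ≤ ∫⁻ z, eLpNorm (H z) p volume * eLpNorm (A z) 1 volume ∂μ := by
  have hmH : Measurable fun y : (Ω × Rd d) × Rd d => H y.1.1 (y.2 + y.1.2) :=
    hH.comp (measurable_fst.fst.prodMk (measurable_snd.add measurable_fst.snd))
  have hmp : Measurable fun z => eLpNorm (H z) p volume := by
    have h := measurable_eLpNorm_of_prod p volume (F := fun z : Ω × Rd d => ‖H z.1 z.2‖ₑ) hH.enorm
    simpa only [eLpNorm_enorm] using h
  have e : ∀ u : Rd d, ∫⁻ t : Ω × Rd d, ‖A t.1 (t.2 - u) * H t.1 t.2‖ₑ ∂(μ.prod volume)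
      = ∫⁻ t : Ω × Rd d, ‖A t.1 t.2 * H t.1 (u + t.2)‖ₑ ∂(μ.prod volume) := fun u => by
    have m1 : Measurable fun t : Ω × Rd d => ‖A t.1 (t.2 - u) * H t.1 t.2‖ₑ :=
      ((hA.comp (measurable_fst.prodMk (measurable_snd.sub_const u))).mul hH).enorm
    have m2 : Measurable fun t : Ω × Rd d => ‖A t.1 t.2 * H t.1 (u + t.2)‖ₑ :=
      (hA.mul (hH.comp (measurable_fst.prodMk (measurable_snd.const_add u)))).enorm
    rw [lintegral_prod _ m1.aemeasurable, lintegral_prod _ m2.aemeasurable]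
    refine lintegral_congr fun z => ?_
    rw [← lintegral_add_left_eq_self _ u]
    simp
  simp_rw [e]
  refine (eLpNorm_lintegral_le hp (μ.prod volume) volume (F := fun y : (Ω × Rd d) × Rd d =>
    ‖A y.1.1 y.1.2 * H y.1.1 (y.2 + y.1.2)‖ₑ) ((hA.comp measurable_fst).mul hmH).enorm).trans ?_
  rw [← lintegral_prod_enorm_mul hA hmp]
  refine lintegral_mono fun t => ?_
  rw [eLpNorm_enorm]
  refine (eLpNorm_const_smul (A t.1 t.2) (fun x => H t.1 (x + t.2)) p volume).trans_le ?_
  gcongr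
  exact (eLpNorm_comp_measurePreserving (f := fun u : Rd d => u + t.2)
    (hHc t.1).aestronglyMeasurable (measurePreserving_add_right volume t.2)).le

lemma avg_one_eq {d : ℕ} (χ Λ : 𝓢(Rd d, ℂ)) (x : Rd d) : avg χ Λ 1 x = ∫ u, χ u * Λ (x - u) := by
  rw [← integral_sub_left_eq_self _ volume x]
  simp [avg]

lemma avg_param_eq' {d : ℕ} (χ Λ : 𝓢(Rd d, ℂ)) (z : Param) (x : Rd d) :
    avg χ Λ z x = ∫ u, χ u * dilate z Λ (x - u) := by
  rw [avg_param_eq, ← integral_sub_left_eq_self _ volume x]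
  simp

lemma continuous_dilate {d : ℕ} (Λ : 𝓢(Rd d, ℂ)) :
    Continuous fun z : Param × Rd d => dilate z.1 Λ z.2 := by
  have hc : Continuous fun z : Param × Rd d => ((z.1 : ℝ))⁻¹ :=
    (continuous_subtype_val.comp continuous_fst).inv₀ fun z => z.1.2.1.ne'
  simp_rw [dilate_apply, ← inv_pow]
  exact (hc.pow d).smul (Λ.continuous.comp (hc.smul continuous_snd))

/-- An average of `χ` is the integral of `χ` against a translated kernel, so Fubini moves `χ`
outside the reproducing formula. What remains is `∫ Λ(x - u) (S * η)(x) dx` plus the corresponding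
integrals with `(Ψ_i)_z`. These converge absolutely in `L^p`, because dilation preserves the
`L^1`-norm of `Ψ_i`. -/
lemma IsTauberian.exists_memLp {d : ℕ} {ι : Type} [Fintype ι] {η : 𝓢(Rd d, ℂ)}
    {ψ : ι → 𝓢(Rd d, ℂ)} (h : IsTauberian η ψ) {p : ℝ≥0∞} (hp : 1 ≤ p) {S : 𝓢'(Rd d, ℂ)}
    (h0 : eLpNorm (conv S η) p volume < ⊤)
    (h1 : ∀ i, ∫⁻ z : Param, eLpNorm (conv S (dilate z (ψ i))) p volume ∂parMeas < ⊤) :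
    ∃ f : Rd d → ℂ, MemLp f p volume ∧ ∀ χ : 𝓢(Rd d, ℂ), S χ = ∫ x, χ x * f x := by
  obtain ⟨Λ, Ψ, hΨ, hrep⟩ := h.exists_reproducing
  have k0 := memLp_integral_kernel (μ := (volume : Measure (Rd d))) hp
    (c := conv S η) (k := fun x u => Λ (x - u)) (continuous_conv S η).measurable
    (Λ.continuous.comp (by fun_prop)).measurable (by
      -- The low-frequency term has a single scale, treated as a family over a one-point parameter
      -- space.
      have h2 := eLpNorm_lintegral_translate_le (μ := Measure.dirac ()) hp (A := fun _ => Λ)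
        (H := fun _ => conv S η) (Λ.continuous.measurable.comp measurable_snd)
        ((continuous_conv S η).measurable.comp measurable_snd) fun _ => continuous_conv S η
      have h3 : ∀ u : Rd d, ∫⁻ t : Unit × Rd d, ‖Λ (t.2 - u) * conv S η t.2‖ₑ
          ∂((Measure.dirac ()).prod volume) = ∫⁻ x, ‖Λ (x - u) * conv S η x‖ₑ := fun u => by
        have hm : Measurable fun t : Unit × Rd d => ‖Λ (t.2 - u) * conv S η t.2‖ₑ :=
          ((Λ.continuous.measurable.comp (measurable_snd.sub_const u)).mul
            ((continuous_conv S η).measurable.comp measurable_snd)).enorm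
        rw [lintegral_prod _ hm.aemeasurable, lintegral_dirac]
      simp_rw [h3] at h2
      refine h2.trans_lt ?_
      rw [lintegral_dirac]
      exact ENNReal.mul_lt_top h0 (sobNorm_one_lt_top 0 Λ |>.trans_le' (by
        simpa using eLpNorm_derivWord_le_sobNorm (le_refl 0) Fin.elim0 1 Λ)))
  have ki := fun i => memLp_integral_kernel (μ := parMeas.prod (volume : Measure (Rd d))) hp
    (c := fun t => conv S (dilate t.1 (ψ i)) t.2) (k := fun t u => dilate t.1 (Ψ i) (t.2 - u))
    (continuous_conv_dilate S (ψ i)).measurable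
    ((continuous_dilate (Ψ i)).comp (by fun_prop : Continuous fun y : (Param × Rd d) × Rd d =>
      (y.1.1, y.1.2 - y.2))).measurable (by
      refine (eLpNorm_lintegral_translate_le hp (A := fun (z : Param) => dilate z (Ψ i))
        (H := fun (z : Param) => conv S (dilate z (ψ i))) (continuous_dilate (Ψ i)).measurable
        (continuous_conv_dilate S (ψ i)).measurable fun z => continuous_conv S _).trans_lt ?_
      have h2 : ∀ z : Param, eLpNorm (dilate z (Ψ i)) 1 volume = eLpNorm (Ψ i) 1 volume :=
        fun z => eLpNorm_one_dilate (Ψ i).continuous.measurable z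
      have h3 : eLpNorm (Ψ i) 1 volume < ⊤ := sobNorm_one_lt_top 0 (Ψ i) |>.trans_le' (by
        simpa using eLpNorm_derivWord_le_sobNorm (le_refl 0) Fin.elim0 1 (Ψ i))
      simp_rw [h2]
      rw [lintegral_mul_const' _ _ h3.ne]
      exact ENNReal.mul_lt_top (h1 i) h3)
  refine ⟨_, k0.1.add (memLp_finsetSum' Finset.univ fun i _ => (ki i).1), fun χ => ?_⟩
  rw [hrep S χ]
  simp only [Pi.add_apply, Finset.sum_apply, mul_add, Finset.mul_sum]
  rw [integral_add (k0.2 χ).1 (integrable_finsetSum _ fun i _ => ((ki i).2 χ).1),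
    integral_finsetSum _ fun i _ => ((ki i).2 χ).1, (k0.2 χ).2]
  simp only [((ki _).2 χ).2, avg_one_eq, avg_param_eq']

/-! ### LP-pairs and mollifiers -/

lemma IsLPPair.isTauberian {d : ℕ} {r : ℝ} {η ψ : 𝓢(Rd d, ℂ)} (h : IsLPPair r η ψ) :
    IsTauberian η fun _ : Unit => ψ := by
  obtain ⟨⟨σ, hσ, θ, hθ, h1, h2⟩, -⟩ := h
  refine ⟨θ * σ, σ, mul_pos hθ.1 hσ, by nlinarith [hθ.2], fun ξ hξ => norm_pos_iff.1 (h1 ξ hξ),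
    fun ξ hξ hξ' => ⟨(), norm_pos_iff.1 (h2 ξ hξ hξ')⟩⟩

lemma IsLPPair.exists_vanishMoments {d : ℕ} {r : ℝ} {η ψ : 𝓢(Rd d, ℂ)} (h : IsLPPair r η ψ) :
    ∃ M : ℕ, r < M ∧ VanishMoments M ψ := by
  -- For negative `r` this is `0`: no moment needs to vanish, and `r < 0` still holds.
  refine ⟨(⌊r⌋ + 1).toNat, ?_, VanishMoments.of_moment fun α hα => h.2 α ?_⟩
  · have h1 : r < (⌊r⌋ + 1 : ℤ) := by exact_mod_cast Int.lt_floor_add_one r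
    have h2 : ((⌊r⌋ + 1 : ℤ) : ℝ) ≤ ((⌊r⌋ + 1).toNat : ℤ) := by
      exact_mod_cast Int.self_le_toNat _
    exact_mod_cast h1.trans_le h2
  · omega

lemma fourier_lineDerivOp_apply {d : ℕ} (φ : 𝓢(Rd d, ℂ)) (v ξ : Rd d) :
    𝓕 (∂_{v} φ) ξ = (2 * Real.pi * Complex.I) * ((inner ℝ ξ v : ℝ) * 𝓕 φ ξ) := by
  have h2 := congrArg (fun f : 𝓢(Rd d, ℂ) => f ξ) (SchwartzMap.fourier_lineDerivOp_eq φ v)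
  refine h2.trans ?_
  rw [_root_.smul_apply, SchwartzMap.smulLeftCLM_apply_apply (by fun_prop)]
  simp

lemma fourier_derivWord_const_ne_zero {d : ℕ} {φ : 𝓢(Rd d, ℂ)} {ξ : Rd d} (hφ : 𝓕 φ ξ ≠ 0)
    {i : Fin d} (hi : ξ i ≠ 0) (k : ℕ) : 𝓕 (derivWord (fun _ : Fin k => i) φ) ξ ≠ 0 := by
  induction k with
  | zero => simpa using hφ
  | succ k ih =>
    rw [derivWord, iteratedLineDerivOp_succ_left, fourier_lineDerivOp_apply, inner_stdVec]
    refine mul_ne_zero (by simp [Real.pi_ne_zero]) (mul_ne_zero (by simpa using hi) ih)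

/-- The Fourier transform of `φ` equals `1` at the origin, hence is nonzero on a ball. At `ξ ≠ 0`
some coordinate `ξ i` is nonzero, and the pure derivative `∂_i^k φ` has Fourier transform `(2πi
ξ_i)^k φ̂(ξ) ≠ 0` in that ball. No single derivative need work for all `ξ`, which is why
`IsTauberian` allows families. -/
lemma IsMollifier.isTauberian {d : ℕ} {φ : 𝓢(Rd d, ℂ)} (h : IsMollifier φ) (k : ℕ) :
    IsTauberian φ fun a : Fin k → Fin d => derivWord a φ := by
  have h0 : 𝓕 φ 0 ≠ 0 := by
    rw [SchwartzMap.fourier_coe, Real.fourier_eq]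
    simp [h.1]
  obtain ⟨b, hb, hball⟩ := Metric.eventually_nhds_iff.1
    ((𝓕 φ).continuous.continuousAt.eventually_ne h0)
  have hne : ∀ ξ : Rd d, ‖ξ‖ ≤ b / 2 → 𝓕 φ ξ ≠ 0 := fun ξ hξ =>
    hball (by rw [dist_zero_right]; linarith)
  refine ⟨b / 4, b / 2, by linarith, by linarith, hne, fun ξ h1 h2 => ?_⟩
  have hξ : ξ ≠ 0 := norm_pos_iff.1 (by linarith)
  obtain ⟨i, hi⟩ : ∃ i, ξ i ≠ 0 := by
    by_contra! hc
    exact hξ (by ext i; simpa using hc i)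
  exact ⟨fun _ => i, fourier_derivWord_const_ne_zero (hne ξ h2) hi k⟩

/-! ### Membership of `ι(T)` in spaces of generalized functions -/

lemma nullNets_le_globalNets {d : ℕ} (q p : ℝ≥0∞) (k : ℕ) (σ : ℝ) :
    nullNets d q p ≤ globalNets d q p k σ := by
  have h := iInf₂_le (f := fun (k : ℕ) (s : ℝ) => globalNets d q p k (-s)) k (-σ)
  rwa [neg_neg] at h

lemma iota_eq {d : ℕ} {q p : ℝ≥0∞} (hp : 1 ≤ p) (φ : 𝓢(Rd d, ℂ)) {T : 𝓢'(Rd d, ℂ)}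
    (hT : T ∈ DLpDual d p) :
    iota q p φ T = genClass ⟨mollify φ T, mollify_mem_moderateNets hp φ hT⟩ :=
  dif_pos (mollify_mem_moderateNets hp φ hT)

lemma genClass_eq_iff {d : ℕ} {q p : ℝ≥0∞} {f g : moderateNets d q p} :
    genClass f = genClass g ↔ (f : Net d) - g ∈ nullNets d q p := by
  rw [genClass, genClass, Submodule.Quotient.eq]
  rfl

/-- Two representatives differ by a null net, which lies in every `globalNets`; so the canonical
representative can be tested. -/
lemma iota_mem_GenFunKS_iff {d : ℕ} {q p : ℝ≥0∞} (hp : 1 ≤ p) (φ : 𝓢(Rd d, ℂ)) {T : 𝓢'(Rd d, ℂ)}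
    (hT : T ∈ DLpDual d p) (k : ℕ) (σ : ℝ) :
    iota q p φ T ∈ GenFunKS d q p k σ ↔ mollify φ T ∈ globalNets d q p k σ := by
  rw [iota_eq hp φ hT]
  refine ⟨?_, fun h => ⟨_, h, rfl⟩⟩
  rintro ⟨f, hf, he⟩
  have h1 := nullNets_le_globalNets q p k σ (genClass_eq_iff.1 he)
  simpa using Submodule.add_mem _ h1 hf

lemma iota_mem_GenFunRegular_iff {d : ℕ} {q p : ℝ≥0∞} (hp : 1 ≤ p) (φ : 𝓢(Rd d, ℂ))
    {T : 𝓢'(Rd d, ℂ)} (hT : T ∈ DLpDual d p) :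
    iota q p φ T ∈ GenFunRegular d q p ↔ mollify φ T ∈ regularNets d q p := by
  rw [iota_eq hp φ hT]
  refine ⟨?_, fun h => ⟨_, h, rfl⟩⟩
  rintro ⟨f, hf, he⟩
  obtain ⟨s, hs⟩ := Set.mem_iUnion.1 hf
  refine Set.mem_iUnion.2 ⟨s, Set.mem_iInter.2 fun k => ?_⟩
  have h1 := nullNets_le_globalNets q p k (-s) (genClass_eq_iff.1 he)
  simpa using Submodule.add_mem _ h1 (Set.mem_iInter.1 hs k)

/-! ### Characterization of Besov spaces by mollification -/

lemma epsNorm_rpow_mul (q : ℝ≥0∞) (σ a : ℝ) (F : Param → ℝ≥0∞) :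
    epsNorm q σ (fun ε => ENNReal.ofReal ((ε : ℝ) ^ (-a)) * F ε) = epsNorm q (σ + a) F := by
  have e : ∀ ε : Param, ENNReal.ofReal ((ε : ℝ) ^ (-σ)) * (ENNReal.ofReal ((ε : ℝ) ^ (-a)) * F ε)
      = ENNReal.ofReal ((ε : ℝ) ^ (-(σ + a))) * F ε := fun ε => by
    have hε : (0 : ℝ) < ε := ε.2.1
    rw [← mul_assoc, ← ENNReal.ofReal_mul (by positivity), ← Real.rpow_add hε, neg_add]
  simp only [epsNorm, e]

lemma epsNorm_iSup_lt_top {ι : Type*} [Fintype ι] {q : ℝ≥0∞} {σ : ℝ} {F : ι → Param → ℝ≥0∞}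
    (hm : ∀ i, Measurable (F i)) (h : ∀ i, epsNorm q σ (F i) < ⊤) :
    epsNorm q σ (fun y => ⨆ i, F i y) < ⊤ :=
  (epsNorm_mono le_rfl fun y => iSup_le fun i => Finset.single_le_sum (f := fun i => F i y)
    (fun _ _ => bot_le) (Finset.mem_univ i)).trans_lt
    (epsNorm_sum_lt_top Finset.univ hm fun i _ => h i)

/-- The factor `ε^{-m}` produced by `m` derivatives is absorbed into the weight, which becomes `σ +
m`. -/
lemma epsNorm_sobNorm_mollify_lt_top_iff {d : ℕ} {q p : ℝ≥0∞} {k : ℕ} {σ : ℝ} (φ : 𝓢(Rd d, ℂ))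
    (T : 𝓢'(Rd d, ℂ)) : epsNorm q σ (fun ε => sobNorm k p volume (mollify φ T ε)) < ⊤ ↔
      ∀ m ≤ k, ∀ a : Fin m → Fin d,
        epsNorm q (σ + m) (fun ε => eLpNorm (conv T (dilate ε (derivWord a φ))) p volume) < ⊤ := by
  simp_rw [sobNorm_mollify_eq]
  constructor
  · intro h m hm a
    rw [← epsNorm_rpow_mul]
    refine (epsNorm_mono le_rfl fun ε => ?_).trans_lt h
    exact le_iSup₂ (f := fun (m : Fin (k + 1)) (a : Fin (m : ℕ) → Fin d) =>
      ENNReal.ofReal ((ε : ℝ) ^ (-((m : ℕ) : ℝ))) *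
        eLpNorm (conv T (dilate ε (derivWord a φ))) p volume) ⟨m, Nat.lt_succ_of_le hm⟩ a
  · intro h
    have hmeas : ∀ (m : ℕ) (a : Fin m → Fin d), Measurable fun ε : Param =>
        ENNReal.ofReal ((ε : ℝ) ^ (-(m : ℝ))) *
          eLpNorm (conv T (dilate ε (derivWord a φ))) p volume := fun m a =>
      (measurable_ofReal_rpow _).mul (measurable_eLpNorm_conv_dilate T _ p)
    refine epsNorm_iSup_lt_top (fun m => Measurable.iSup fun a => hmeas m a) fun m =>
      epsNorm_iSup_lt_top (fun a => hmeas m a) fun a => ?_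
    rw [epsNorm_rpow_mul]
    exact h m (Nat.lt_succ_iff.1 m.2) a

lemma BesovSpace_subset_DLpDual {d : ℕ} {q p : ℝ≥0∞} (hp : 1 ≤ p) (hq : 1 ≤ q) {r : ℝ}
    {η ψ : 𝓢(Rd d, ℂ)} (h : IsLPPair r η ψ) : BesovSpace η ψ r p q ⊆ DLpDual d p := fun T hT => by
  have hT' := ENNReal.add_lt_top.1 (show _ + _ < ⊤ from hT)
  exact h.isTauberian.mem_DLpDual hp hq hT'.1 fun _ => hT'.2

/-- With `σ = r - k` the kernels `∂^a φ`, `|a| = m ≤ k`, carry the exponent `r - k + m`. It is at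
most `r`, so the Besov bound applies, and less than `m`, the number of vanishing moments of `∂^a φ`.
Conversely, the top order `m = k` alone gives a Tauberian family with exponent `r`, and `ψ` has
enough vanishing moments by the order of the pair. -/
theorem mem_BesovSpace_iff {d : ℕ} {q p : ℝ≥0∞} (hp : 1 ≤ p) (hq : 1 ≤ q) {φ : 𝓢(Rd d, ℂ)}
    (hφ : IsMollifier φ) {r : ℝ} {k : ℕ} (hr : r < k) {η ψ : 𝓢(Rd d, ℂ)} (h : IsLPPair r η ψ)
    {T : 𝓢'(Rd d, ℂ)} (hT : T ∈ DLpDual d p) :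
    T ∈ BesovSpace η ψ r p q ↔ mollify φ T ∈ globalNets d q p k (r - k) := by
  rw [mollify_mem_globalNets_iff hp φ hT, epsNorm_sobNorm_mollify_lt_top_iff]
  constructor
  · intro hB m hm a
    have hB' := ENNReal.add_lt_top.1 (show _ + _ < ⊤ from hB)
    have hmk : (m : ℝ) ≤ k := by exact_mod_cast hm
    exact h.isTauberian.epsNorm_conv_dilate_lt_top
      (VanishMoments.iteratedLineDerivOp φ fun j => (stdVec (a j) : Rd d)) (by linarith) hp hq
      hB'.1 fun _ => (epsNorm_mono (by linarith) fun _ => le_rfl).trans_lt hB'.2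
  · intro hG
    obtain ⟨M, hM, hψ⟩ := h.exists_vanishMoments
    refine ENNReal.add_lt_top.2 ⟨eLpNorm_conv_lt_top hp hT η, ?_⟩
    refine (hφ.isTauberian k).epsNorm_conv_dilate_lt_top hψ hM hp hq
      (eLpNorm_conv_lt_top hp hT φ) fun a => ?_
    have := hG k le_rfl a
    rwa [sub_add_cancel] at this

lemma image_BesovSpace_eq {d : ℕ} {q p : ℝ≥0∞} (hp : 1 ≤ p) (hq : 1 ≤ q) {φ : 𝓢(Rd d, ℂ)}
    (hφ : IsMollifier φ) {r : ℝ} {k : ℕ} (hr : r < k) {η ψ : 𝓢(Rd d, ℂ)} (h : IsLPPair r η ψ) :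
    iota q p φ '' BesovSpace η ψ r p q
      = GenFunKS d q p k (r - k) ∩ iota q p φ '' DLpDual d p := by
  ext u
  constructor
  · rintro ⟨T, hT, rfl⟩
    have hT' := BesovSpace_subset_DLpDual hp hq h hT
    exact ⟨(iota_mem_GenFunKS_iff hp φ hT' k _).2 ((mem_BesovSpace_iff hp hq hφ hr h hT').1 hT),
      T, hT', rfl⟩
  · rintro ⟨hu, T, hT, rfl⟩
    exact ⟨T, (mem_BesovSpace_iff hp hq hφ hr h hT).2 ((iota_mem_GenFunKS_iff hp φ hT k _).1 hu),
      rfl⟩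

/-! ### The space `𝓓_{L^p}` -/

lemma DLp_subset_DLpDual {d : ℕ} {p : ℝ≥0∞} (hp : 1 ≤ p) : DLp d p ⊆ DLpDual d p := fun T hT => by
  obtain ⟨f, hf, hTf⟩ := Set.mem_iInter.1 hT 0 0 le_rfl Fin.elim0
  simp only [iteratedLineDerivOp_fin_zero] at hTf
  refine Set.mem_iUnion.2 ⟨0, (eLpNorm f p volume).toNNReal, fun χ => ?_⟩
  rw [hTf, ENNReal.coe_toNNReal hf.2.ne, mul_comm]
  refine (enorm_integral_le_lintegral_enorm _).trans
    ((lintegral_enorm_mul_le hp χ.continuous.aestronglyMeasurable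
      hf.1).trans (mul_le_mul' ?_ le_rfl))
  simpa using eLpNorm_derivWord_le_sobNorm (le_refl 0) Fin.elim0 p.conjExponent χ

lemma conv_lineDerivOp {d : ℕ} (T : 𝓢'(Rd d, ℂ)) (v : Rd d) (ψ : 𝓢(Rd d, ℂ)) :
    conv (∂_{v} T) ψ = conv T (∂_{v} ψ) := by
  ext x
  rw [conv, conv, TemperedDistribution.lineDerivOp_apply_apply, lineDerivOp_reflectTranslate]
  simp

/-- Derivatives pass from `T` to the kernel in reversed order. The sign of the distributional
derivative cancels against that of the reflection. -/
lemma conv_iteratedLineDerivOp {d m : ℕ} (T : 𝓢'(Rd d, ℂ)) (a : Fin m → Fin d)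
    (ψ : 𝓢(Rd d, ℂ)) : conv (∂^{fun j => (stdVec (a j) : Rd d)} T) ψ
      = conv T (derivWord (fun j => a j.rev) ψ) := by
  induction m generalizing ψ with
  | zero => simp
  | succ m ih =>
    rw [iteratedLineDerivOp_succ_left, conv_lineDerivOp, derivWord, iteratedLineDerivOp_succ_right]
    have := ih (Fin.tail a) (∂_{(stdVec (a 0) : Rd d)} ψ)
    refine this.trans ?_
    congr 2
    · ext j : 1
      simp [Fin.tail, Fin.rev_castSucc]
    · simp

lemma exists_derivWord_derivWord {d m n : ℕ} (a : Fin m → Fin d) (b : Fin n → Fin d)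
    (φ : 𝓢(Rd d, ℂ)) : ∃ c : Fin (m + n) → Fin d, derivWord a (derivWord b φ) = derivWord c φ := by
  induction n generalizing φ with
  | zero => exact ⟨a, by simp⟩
  | succ n ih =>
    obtain ⟨c, hc⟩ := ih (fun j => b j.castSucc) (∂_{(stdVec (b (Fin.last n)) : Rd d)} φ)
    refine ⟨Fin.snoc c (b (Fin.last n)), ?_⟩
    refine (congrArg (derivWord a) ?_).trans (hc.trans (derivWord_snoc _ _ _).symm)
    rw [derivWord, iteratedLineDerivOp_succ_right]
    rfl

lemma eLpNorm_conv_le_of_memLp {d : ℕ} {p : ℝ≥0∞} (hp : 1 ≤ p) {S : 𝓢'(Rd d, ℂ)} {f : Rd d → ℂ}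
    (hf : AEStronglyMeasurable f volume) (hS : ∀ χ : 𝓢(Rd d, ℂ), S χ = ∫ x, χ x * f x)
    (ψ : 𝓢(Rd d, ℂ)) :
    eLpNorm (conv S ψ) p volume ≤ eLpNorm ψ 1 volume * eLpNorm f p volume := by
  have hg := hf.stronglyMeasurable_mk.measurable
  set g := hf.mk f with hg_def
  have hgf : eLpNorm g p volume = eLpNorm f p volume := eLpNorm_congr_ae hf.ae_eq_mk.symm
  have e : conv S ψ = fun x => ∫ v, ψ v * g (x - v) := funext fun x => by
    rw [conv, hS, ← integral_sub_left_eq_self (fun v => ψ v * g (x - v)) volume x]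
    refine integral_congr_ae (hf.ae_eq_mk.mono fun u hu => ?_)
    simp [hu, hg_def, reflectTranslate_apply]
  rw [e]
  refine (eLpNorm_integral_mul_le hp (μ := volume) (a := ψ) (H := fun v x => g (x - v))
    ψ.continuous.measurable (hg.comp (measurable_snd.sub measurable_fst))).trans (le_of_eq ?_)
  have ht : ∀ v, eLpNorm (fun x => g (x - v)) p volume = eLpNorm f p volume := fun v =>
    (eLpNorm_comp_measurePreserving hg.aestronglyMeasurable
      (measurePreserving_sub_right volume v)).trans hgf
  simp only [ht]
  rw [lintegral_mul_const _ ψ.continuous.measurable.enorm, ← eLpNorm_one_eq_lintegral_enorm]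

/-- For `T` in `𝓓_{L^p}` all derivatives of `T * φ_ε` are bounded in `L^p` uniformly in `ε`, by
Young's inequality. Conversely, if one exponent `s` serves all orders, then `n > s` additional
derivatives make the scale integral converge for any derivative of `T`, and
`IsTauberian.exists_memLp` represents that derivative by an `L^p` function. -/
theorem mem_DLp_iff {d : ℕ} {q p : ℝ≥0∞} (hp : 1 ≤ p) (hq : 1 ≤ q) {φ : 𝓢(Rd d, ℂ)}
    (hφ : IsMollifier φ) {T : 𝓢'(Rd d, ℂ)} (hT : T ∈ DLpDual d p) :
    T ∈ DLp d p ↔ mollify φ T ∈ regularNets d q p := by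
  constructor
  · intro hD
    -- The norms are bounded in `ε`; any positive exponent makes them integrable against `dε/ε`.
    refine Set.mem_iUnion.2 ⟨1, Set.mem_iInter.2 fun k => ?_⟩
    rw [SetLike.mem_coe, mollify_mem_globalNets_iff hp φ hT, epsNorm_sobNorm_mollify_lt_top_iff]
    intro m hm a
    obtain ⟨f, hf, hTf⟩ := Set.mem_iInter.1 hD m m le_rfl fun j => a j.rev
    rw [← epsNorm_rpow_mul]
    have hb : ∀ ε : Param, ENNReal.ofReal ((ε : ℝ) ^ (-(m : ℝ))) *
        eLpNorm (conv T (dilate ε (derivWord a φ))) p volume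
        ≤ (eLpNorm φ 1 volume * eLpNorm f p volume) * ENNReal.ofReal ((ε : ℝ) ^ (0 : ℝ)) := by
      intro ε
      have hε : (0 : ℝ) < ε := ε.2.1
      have h1 := eLpNorm_conv_le_of_memLp hp hf.1 hTf (dilate ε φ)
      rw [conv_iteratedLineDerivOp] at h1
      simp only [Fin.rev_rev] at h1
      have h2 : conv T (derivWord a (dilate ε φ))
          = ((ε : ℝ)⁻¹ ^ m) • conv T (dilate ε (derivWord a φ)) := by
        ext x
        rw [derivWord, iteratedLineDerivOp_dilate, conv_smul]
      have h3 : eLpNorm (dilate ε φ) 1 volume = eLpNorm φ 1 volume :=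
        eLpNorm_one_dilate φ.continuous.measurable ε
      rw [h2, h3, eLpNorm_const_smul, Real.enorm_of_nonneg (by positivity), inv_pow,
        ← Real.rpow_natCast, ← Real.rpow_neg hε.le] at h1
      simpa using h1
    have hφ1 : eLpNorm φ 1 volume < ⊤ := (φ.memLp 1 volume).2
    exact (epsNorm_mono le_rfl hb).trans_lt (epsNorm_const_mul_lt_top
      (ENNReal.mul_lt_top hφ1 hf.2).ne (epsNorm_rpow_lt_top q (by norm_num)))
  · intro hR
    obtain ⟨s, hs⟩ := Set.mem_iUnion.1 hR
    have hs' : ∀ n (c : Fin n → Fin d), epsNorm q (-s + n)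
        (fun ε => eLpNorm (conv T (dilate ε (derivWord c φ))) p volume) < ⊤ := fun n c =>
      (epsNorm_sobNorm_mollify_lt_top_iff φ T).1
        ((mollify_mem_globalNets_iff hp φ hT n (-s)).1 (Set.mem_iInter.1 hs n)) n le_rfl c
    -- The Tauberian family consists of the derivatives of `φ` of order `n`; `n > s` compensates the
    -- loss `s`.
    obtain ⟨n, hn⟩ := exists_nat_gt s
    refine Set.mem_iInter.2 fun k m _ a => ?_
    refine (hφ.isTauberian n).exists_memLp hp ?_ fun b => ?_
    · rw [conv_iteratedLineDerivOp]
      exact eLpNorm_conv_lt_top hp hT _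
    · obtain ⟨c, hc⟩ := exists_derivWord_derivWord (fun j => a j.rev) b φ
      -- The kernel has order `m + n` and the bound has exponent `-s + m + n > m`. The weight
      -- `z^{-m}` is the cost of moving the `m` derivatives of `T` onto the dilated kernel.
      have h1 := lintegral_rpow_mul_lt_top hq (σ := -s + (m + n : ℕ)) (τ := m)
        (by push_cast; linarith) (measurable_eLpNorm_conv_dilate T (derivWord c φ) p)
        (hs' (m + n) c)
      refine lt_of_le_of_lt (lintegral_mono fun z => le_of_eq ?_) h1
      have hz : (0 : ℝ) < z := z.2.1
      rw [conv_iteratedLineDerivOp, ← hc]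
      have h2 : conv T (derivWord (fun j => a j.rev) (dilate z (derivWord b φ)))
          = ((z : ℝ)⁻¹ ^ m) •
            conv T (dilate z (derivWord (fun j => a j.rev) (derivWord b φ))) := by
        ext x
        rw [derivWord, iteratedLineDerivOp_dilate, conv_smul]
      rw [h2, eLpNorm_const_smul, Real.enorm_of_nonneg (by positivity), inv_pow,
        ← Real.rpow_natCast, ← Real.rpow_neg hz.le]

lemma image_DLp_eq {d : ℕ} {q p : ℝ≥0∞} (hp : 1 ≤ p) (hq : 1 ≤ q) {φ : 𝓢(Rd d, ℂ)}
    (hφ : IsMollifier φ) :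
    iota q p φ '' DLp d p = GenFunRegular d q p ∩ iota q p φ '' DLpDual d p := by
  ext u
  constructor
  · rintro ⟨T, hT, rfl⟩
    have hT' := DLp_subset_DLpDual hp hT
    exact ⟨(iota_mem_GenFunRegular_iff hp φ hT').2 ((mem_DLp_iff hp hq hφ hT').1 hT), T, hT', rfl⟩
  · rintro ⟨hu, T, hT, rfl⟩
    exact ⟨T, (mem_DLp_iff hp hq hφ hT).2 ((iota_mem_GenFunRegular_iff hp φ hT).1 hu), rfl⟩

theorem mainTheorem2 {d : ℕ} (p q : ℝ≥0∞) (hp : 1 ≤ p) (hq : 1 ≤ q)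
    (φ : 𝓢(Rd d, ℂ)) (hφ : IsMollifier φ) :
    -- `ι` is well defined on `𝓓'_{L^p}`, which contains the Besov spaces and `𝓓_{L^p}`
    (∀ T ∈ DLpDual d p, mollify φ T ∈ moderateNets d q p) ∧
    (∀ (r : ℝ) (η ψ : 𝓢(Rd d, ℂ)), IsLPPair r η ψ → BesovSpace η ψ r p q ⊆ DLpDual d p) ∧
    DLp d p ⊆ DLpDual d p ∧
    (∀ (k : ℕ) (s : ℝ), 0 < s → ∀ η ψ : 𝓢(Rd d, ℂ), IsLPPair (k - s) η ψ →
      GenFunKS d q p k (-s) ∩ iota q p φ '' DLpDual d p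
        = iota q p φ '' BesovSpace η ψ (k - s) p q) ∧
    (∀ (r : ℝ) (k : ℕ), r < k → ∀ η ψ : 𝓢(Rd d, ℂ), IsLPPair r η ψ →
      iota q p φ '' BesovSpace η ψ r p q
        = GenFunKS d q p k (r - k) ∩ iota q p φ '' DLpDual d p) ∧
    iota q p φ '' DLp d p = GenFunRegular d q p ∩ iota q p φ '' DLpDual d p := by
  refine ⟨fun T hT => mollify_mem_moderateNets hp φ hT,
    fun r η ψ h => BesovSpace_subset_DLpDual hp hq h, DLp_subset_DLpDual hp,
    fun k s hs η ψ h => ?_, fun r k hr η ψ h => image_BesovSpace_eq hp hq hφ hr h,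
    image_DLp_eq hp hq hφ⟩
  -- Statement (i) is (ii) for `r = k - s`: then `r < k` means `s > 0`, and `r - k = -s`.
  have h1 := image_BesovSpace_eq (q := q) hp hq hφ (show (k : ℝ) - s < k by linarith) h
  rw [h1, sub_sub_cancel_left]
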